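/- Let $G$ be a compact connected (smooth, real) Lie group whose Lie algebra $\mathfrak g$ is isomorphic to $\mathfrak{su}_2$, and let $\rho\colon G\to \mathrm{GL}(V)$ be a smooth linear representation on a finite-dimensional real vector space $V$. Let $\mathfrak g$ act on $V$ by the differential $d\rho$, and put $V_0=\{v\in V:\mathfrak g v=0\}$. Suppose that $V=V_0\oplus V_1$, where $V_1$ is an irreducible real $\mathfrak g$-subrepresentation of dimension $7$. Then the orbit space $V/G$, with the quotient topology, is homeomorphic to $\mathbb R^{4+\dim V_0}$. In particular, if $V_0=0$ (that is, if $V$ is the $7$-dimensional irreducible representation), then $V/G\cong\mathbb R^4$. -/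

import Mathlib

open scoped Manifold ContDiff

/-- A real `C^∞` Lie group is of class `C^3`, in the form in which Mathlib's Lie algebra of a Lie
group asks for it. -/
instance lieGroupMinSmoothness {d : ℕ} {G : Type*} [TopologicalSpace G]
    [ChartedSpace (EuclideanSpace ℝ (Fin d)) G] [Group G] [LieGroup (𝓡 d) ∞ G] :
    LieGroup (𝓡 d) (minSmoothness ℝ 3) G :=
  LieGroup.of_le (n := ∞) (by
    rw [minSmoothness_of_isRCLikeNormedField]
    exact ENat.LEInfty.out)

section SU2

attribute [local instance] LieRing.ofAssociativeRing

/-- The real Lie algebra `su₂` of traceless skew-Hermitian complex `2 × 2` matrices, with the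
commutator bracket. -/
def su2 : LieSubalgebra ℝ (Matrix (Fin 2) (Fin 2) ℂ) where
  carrier := {A | A.conjTranspose = -A ∧ A.trace = 0}
  add_mem' := by
    rintro A B ⟨hA, hA'⟩ ⟨hB, hB'⟩
    refine ⟨?_, ?_⟩
    · rw [Matrix.conjTranspose_add, hA, hB, neg_add]
    · rw [Matrix.trace_add, hA', hB', add_zero]
  zero_mem' := by simp
  smul_mem' := by
    rintro c A ⟨hA, hA'⟩
    refine ⟨?_, ?_⟩
    · rw [Matrix.conjTranspose_smul, hA, star_trivial, smul_neg]
    · rw [Matrix.trace_smul, hA', smul_zero]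
  lie_mem' := by
    rintro A B ⟨hA, -⟩ ⟨hB, -⟩
    refine ⟨?_, ?_⟩
    · rw [Ring.lie_def, Matrix.conjTranspose_sub, Matrix.conjTranspose_mul,
        Matrix.conjTranspose_mul, hA, hB]
      noncomm_ring
    · rw [Ring.lie_def, Matrix.trace_sub, Matrix.trace_mul_comm, sub_self]

end SU2

namespace LieGroupRep

section Orbits

variable {G : Type*} [Group G] {V : Type*} [NormedAddCommGroup V] [NormedSpace ℝ V]

/-- The equivalence relation on `V` whose classes are the orbits `G v = {ρ(g) v : g ∈ G}`. -/
def orbitSetoid (ρ : G →* (V →L[ℝ] V)) : Setoid V where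
  r v w := ∃ g : G, ρ g v = w
  iseqv :=
    { refl := fun v => ⟨1, by simp⟩
      symm := by
        rintro v w ⟨g, rfl⟩
        refine ⟨g⁻¹, ?_⟩
        rw [← mul_apply_eq_comp, ← map_mul]
        simp
      trans := by
        rintro u v w ⟨g, rfl⟩ ⟨h, rfl⟩
        refine ⟨h * g, ?_⟩
        rw [map_mul, mul_apply_eq_comp] }

/-- The orbit space `V/G`; its topology is the quotient topology. -/
abbrev OrbitSpace (ρ : G →* (V →L[ℝ] V)) : Type _ := Quotient (orbitSetoid ρ)

end Orbits

section Infinitesimal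

variable {d : ℕ} {G : Type*} [TopologicalSpace G] [ChartedSpace (EuclideanSpace ℝ (Fin d)) G]
  [Group G] {V : Type*} [NormedAddCommGroup V] [NormedSpace ℝ V]

/-- The operator `dρ(ξ)` on `V` by which the element `ξ` of the Lie algebra `𝔤 = T₁G` acts, that
is, the differential of `ρ : G → End V` at the identity, evaluated at `ξ`. -/
noncomputable def infinitesimal (ρ : G →* (V →L[ℝ] V)) (ξ : GroupLieAlgebra (𝓡 d) G) :
    V →L[ℝ] V :=
  mfderiv (𝓡 d) 𝓘(ℝ, V →L[ℝ] V) (fun g : G => ρ g) 1 ξ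

variable (d) in
/-- The subspace `V₀ = {v : 𝔤 v = 0}`. -/
noncomputable def nullSubspace (ρ : G →* (V →L[ℝ] V)) : Submodule ℝ V :=
  ⨅ ξ : GroupLieAlgebra (𝓡 d) G, LinearMap.ker (infinitesimal ρ ξ : V →ₗ[ℝ] V)

variable (d) in
/-- The subspace `W` of `V` is invariant under the representation of `𝔤`. -/
def IsInvariant (ρ : G →* (V →L[ℝ] V)) (W : Submodule ℝ V) : Prop :=
  ∀ ξ : GroupLieAlgebra (𝓡 d) G, ∀ w ∈ W, infinitesimal ρ ξ w ∈ W

variable (d) in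
/-- The subspace `W` of `V` is an irreducible (real) subrepresentation of `𝔤`. -/
def IsIrreducible (ρ : G →* (V →L[ℝ] V)) (W : Submodule ℝ V) : Prop :=
  IsInvariant d ρ W ∧ W ≠ ⊥ ∧
    ∀ U : Submodule ℝ V, U ≤ W → IsInvariant d ρ U → U = ⊥ ∨ U = W

end Infinitesimal

end LieGroupRep

/-! Through `infinitesimal` the Lie algebra acts on `V₁` as `ℝ³` with the cross product. The
irreducible module of dimension 7 is the space `realForms 6` of binary sextics fixed by the
antipodal involution (`exists_equiv_realForms`). The roots of such a form on the Riemann sphere come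
in antipodal pairs, and each pair is the root set of `quad u` for a vector `u` of `ℝ³`, unique up to
a scalar. Hence every sextic is a product `quad u * quad v * quad w` with `u`, `v`, `w` of equal
norm. For a nonzero sextic, the triple is unique up to permutations and even sign changes
(`exists_eq_quad_mul_quad_mul_quad`, `apply_eq_of_quad_mul_eq`).

The group acts on `V₁` exactly by the rotations of the triples, so `V₁/G` is the space of such
triples modulo rotations, permutations and even sign changes. Up to rotation, a triple is given by
its Gram matrix and its volume `D`. Since the Gram determinant increases with the common norm, the
invariants `(a, b, c) = (v·w, u·w, u·v)` and `D` suffice, and they may take any real values.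
Permutations and even sign changes act on `(a, b, c)` as the Weyl group of type `D₃`, with chamber
`α ≥ β ≥ |γ|`, and on `D` by the sign of the permutation. The wall coordinates and `|D|` give a
point of the orthant `ℝ≥0⁴`. The sign that remains distinguishes two copies of the orthant, glued
along their boundary: on a wall a reflection fixes `(a, b, c)` and changes the sign of `D`. The
double of an orthant is `ℝ⁴`, and `unfold` is the resulting map.

Both the product map to `V₁` and `unfold` are proper surjections from the triples of equal norm
(`isProperMap_of_homogeneous`, `isProperMap_unfold`). After taking the product with `V₀`, which `G`
fixes, they become quotient maps to `V/G` and to `ℝ⁴ × V₀`. These have the same fibres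
(`exists_rotation_of_unfold_eq`, `unfold_eq_of_quad_mul_eq`), which gives the homeomorphism. -/

namespace LieGroupRep

/-! ### The differential of a representation: brackets, exponentials, conjugation, fixed vectors. -/

section Differential

variable {d : ℕ} {G : Type*} [TopologicalSpace G] [ChartedSpace (EuclideanSpace ℝ (Fin d)) G]
  [Group G] {V : Type*} [NormedAddCommGroup V] [NormedSpace ℝ V]

lemma infinitesimal_add (ρ : G →* (V →L[ℝ] V)) (ξ η : GroupLieAlgebra (𝓡 d) G) :
    infinitesimal ρ (ξ + η) = infinitesimal ρ ξ + infinitesimal ρ η :=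
  (mfderiv (𝓡 d) 𝓘(ℝ, V →L[ℝ] V) (fun g : G => ρ g) 1).map_add ξ η

lemma infinitesimal_smul (ρ : G →* (V →L[ℝ] V)) (c : ℝ) (ξ : GroupLieAlgebra (𝓡 d) G) :
    infinitesimal ρ (c • ξ) = c • infinitesimal ρ ξ :=
  (mfderiv (𝓡 d) 𝓘(ℝ, V →L[ℝ] V) (fun g : G => ρ g) 1).map_smul c ξ

variable [LieGroup (𝓡 d) ∞ G]

/-- Differentiate `ρ (g * h) = ρ g * ρ h` in `h` at `1`. -/
lemma mfderiv_mulInvariantVectorField (ρ : G →* (V →L[ℝ] V))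
    (hρ : ContMDiff (𝓡 d) 𝓘(ℝ, V →L[ℝ] V) ∞ (fun g : G => ρ g))
    (ξ : GroupLieAlgebra (𝓡 d) G) (g : G) :
    (mfderiv (𝓡 d) 𝓘(ℝ, V →L[ℝ] V) (fun g : G => ρ g) g (mulInvariantVectorField ξ g) :
      V →L[ℝ] V) = ρ g * infinitesimal ρ ξ := by
  have hd : ∀ h : G, MDifferentiableAt (𝓡 d) 𝓘(ℝ, V →L[ℝ] V) (fun g : G => ρ g) h :=
    fun h => (hρ h).mdifferentiableAt (by simp)
  have hm : MDifferentiableAt (𝓡 d) (𝓡 d) (fun h : G => g * h) 1 :=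
    ((contMDiff_mul_left (I := 𝓡 d) (n := ∞) (a := g)) 1).mdifferentiableAt (by simp)
  have e1 : mfderiv (𝓡 d) 𝓘(ℝ, V →L[ℝ] V) ((fun g : G => ρ g) ∘ fun h : G => g * h) 1 =
      (mfderiv (𝓡 d) 𝓘(ℝ, V →L[ℝ] V) (fun g : G => ρ g) (g * 1)).comp
        (mfderiv (𝓡 d) (𝓡 d) (fun h : G => g * h) 1) :=
    mfderiv_comp 1 (hd _) hm
  have e2 : ((fun g : G => ρ g) ∘ fun h : G => g * h) =
      (ContinuousLinearMap.mul ℝ (V →L[ℝ] V) (ρ g)) ∘ (fun g : G => ρ g) := by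
    ext h; simp
  have e3 : mfderiv (𝓡 d) 𝓘(ℝ, V →L[ℝ] V)
      ((ContinuousLinearMap.mul ℝ (V →L[ℝ] V) (ρ g)) ∘ (fun g : G => ρ g)) 1 =
      (ContinuousLinearMap.mul ℝ (V →L[ℝ] V) (ρ g)).comp
        (mfderiv (𝓡 d) 𝓘(ℝ, V →L[ℝ] V) (fun g : G => ρ g) 1) := by
    have := mfderiv_comp (I := 𝓡 d) (I' := 𝓘(ℝ, V →L[ℝ] V)) (I'' := 𝓘(ℝ, V →L[ℝ] V)) (1 : G)
      (f := fun g : G => ρ g) (g := (ContinuousLinearMap.mul ℝ (V →L[ℝ] V) (ρ g)))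
      (ContinuousLinearMap.mul ℝ (V →L[ℝ] V) (ρ g)).differentiableAt.mdifferentiableAt (hd 1)
    rw [this, mfderiv_eq_fderiv, ContinuousLinearMap.fderiv]
    rfl
  rw [e2, e3] at e1
  -- The base point `g * 1` equals `g` only propositionally. All tangent spaces unfold to the model
  -- space, so the derivative can be transported along this equality.
  have e4 : ∀ k : G, k = g → ∀ w : EuclideanSpace ℝ (Fin d),
      (mfderiv (𝓡 d) 𝓘(ℝ, V →L[ℝ] V) (fun g : G => ρ g) k w : V →L[ℝ] V) =
        mfderiv (𝓡 d) 𝓘(ℝ, V →L[ℝ] V) (fun g : G => ρ g) g w := by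
    rintro k rfl w
    rfl
  exact (e4 (g * 1) (mul_one g) _).symm.trans (congrArg (fun T => T ξ) e1).symm

/-- This is `[X, Y]F = X(YF) - Y(XF)` with `a = XF` and `b = YF`; the second derivatives of `F`
cancel by symmetry. -/
lemma _root_.fderiv_lieBracket_of_eventuallyEq {E B : Type*} [NormedAddCommGroup E]
    [NormedSpace ℝ E] [NormedAddCommGroup B] [NormedSpace ℝ B] {F : E → B} {X Y : E → E}
    {a b : E → B} {y : E} (hF : ContDiffAt ℝ 2 F y) (hX : DifferentiableAt ℝ X y)
    (hY : DifferentiableAt ℝ Y y) (ha : (fun z => fderiv ℝ F z (X z)) =ᶠ[nhds y] a)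
    (hb : (fun z => fderiv ℝ F z (Y z)) =ᶠ[nhds y] b) :
    fderiv ℝ F y (VectorField.lieBracket ℝ X Y y) = fderiv ℝ b y (X y) - fderiv ℝ a y (Y y) := by
  have hF' : DifferentiableAt ℝ (fderiv ℝ F) y :=
    (hF.fderiv_right (m := 1) (by norm_num)).differentiableAt (by simp)
  have key : ∀ Z : E → E, DifferentiableAt ℝ Z y → ∀ w,
      fderiv ℝ (fun z => fderiv ℝ F z (Z z)) y w =
        fderiv ℝ (fderiv ℝ F) y w (Z y) + fderiv ℝ F y (fderiv ℝ Z y w) := by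
    intro Z hZ w
    rw [fderiv_clm_apply hF' hZ]
    simp [add_comm]
  have hsymm : IsSymmSndFDerivAt ℝ F y := hF.isSymmSndFDerivAt (by simp)
  rw [← ha.fderiv_eq, ← hb.fderiv_eq, key X hX, key Y hY, VectorField.lieBracket, map_sub,
    hsymm.eq]
  abel

/-- In the chart at `1`, the left-invariant field of `ζ` maps `F = ρ ∘ φ⁻¹` to `F * infinitesimal ρ
ζ`. Applying two such fields in both orders at the identity, where `F = 1`, gives the commutator. -/
lemma infinitesimal_lie (ρ : G →* (V →L[ℝ] V))
    (hρ : ContMDiff (𝓡 d) 𝓘(ℝ, V →L[ℝ] V) ∞ (fun g : G => ρ g))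
    (ξ η : GroupLieAlgebra (𝓡 d) G) :
    infinitesimal ρ ⁅ξ, η⁆ =
      infinitesimal ρ ξ * infinitesimal ρ η - infinitesimal ρ η * infinitesimal ρ ξ := by
  have : IsManifold (𝓡 d) ∞ G := inferInstance
  have : IsManifold (𝓡 d) 2 G := inferInstance
  have : IsManifold (𝓡 d) 1 G := inferInstance
  have hd : ∀ h : G, MDifferentiableAt (𝓡 d) 𝓘(ℝ, V →L[ℝ] V) (fun g : G => ρ g) h :=
    fun h => (hρ h).mdifferentiableAt (by simp)
  set φ := extChartAt (𝓡 d) (1 : G) with hφ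
  let F : EuclideanSpace ℝ (Fin d) → (V →L[ℝ] V) := fun y => ρ (φ.symm y)
  have hF1 : F (φ 1) = 1 := by
    simp only [F, hφ, extChartAt_to_inv, map_one]
  have hF : ContDiffAt ℝ 2 F (φ 1) := by
    have h1 : ContMDiffAt 𝓘(ℝ, EuclideanSpace ℝ (Fin d)) 𝓘(ℝ, V →L[ℝ] V) ∞ F (φ 1) :=
      (hρ _).comp _ ((contMDiffOn_extChartAt_symm (n := ∞) (1 : G)).contMDiffAt
        (extChartAt_target_mem_nhds (I := 𝓡 d) (1 : G)))
    exact h1.contDiffAt.of_le ENat.LEInfty.out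
  have hFd : ∀ y ∈ φ.target, fderiv ℝ F y =
      (mfderiv (𝓡 d) 𝓘(ℝ, V →L[ℝ] V) (fun g : G => ρ g) (φ.symm y)).comp
        (mfderivWithin 𝓘(ℝ, EuclideanSpace ℝ (Fin d)) (𝓡 d) φ.symm (Set.range (𝓡 d)) y) := by
    intro y hy
    have h1 : MDifferentiableWithinAt 𝓘(ℝ, EuclideanSpace ℝ (Fin d)) (𝓡 d) φ.symm
        (Set.range (𝓡 d)) y :=
      mdifferentiableWithinAt_extChartAt_symm hy
    have h2 := mfderivWithin_comp (I'' := 𝓘(ℝ, V →L[ℝ] V)) y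
      (hd (φ.symm y)).mdifferentiableWithinAt h1 (Set.subset_preimage_univ)
      (by rw [ModelWithCorners.range_eq_univ]; exact uniqueMDiffWithinAt_univ _)
    rw [mfderivWithin_univ, ModelWithCorners.range_eq_univ, mfderivWithin_univ,
      mfderiv_eq_fderiv] at h2
    rw [ModelWithCorners.range_eq_univ]
    exact h2
  let X : GroupLieAlgebra (𝓡 d) G → EuclideanSpace ℝ (Fin d) → EuclideanSpace ℝ (Fin d) := fun ζ =>
    VectorField.mpullbackWithin 𝓘(ℝ, EuclideanSpace ℝ (Fin d)) (𝓡 d) φ.symm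
      (mulInvariantVectorField ζ) (Set.range (𝓡 d))
  have hX : ∀ ζ, DifferentiableAt ℝ (X ζ) (φ 1) := by
    intro ζ
    have := (mdifferentiableAt_mulInvariantVectorField (I := 𝓡 d) ζ
      (g := (1 : G))).mdifferentiableWithinAt (s := Set.univ)
      |>.differentiableWithinAt_mpullbackWithin_vectorField
    rw [Set.preimage_univ, Set.univ_inter, ModelWithCorners.range_eq_univ] at this
    simp only [X, hφ, ModelWithCorners.range_eq_univ]
    exact differentiableWithinAt_univ.1 this
  have hXF : ∀ ζ, ∀ y ∈ φ.target, fderiv ℝ F y (X ζ y) = F y * infinitesimal ρ ζ := by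
    intro ζ y hy
    rw [hFd y hy]
    have h1 := (isInvertible_mfderivWithin_extChartAt_symm (I := 𝓡 d) hy).self_comp_inverse
    have h2 := mfderiv_mulInvariantVectorField ρ hρ ζ (φ.symm y)
    rw [← h2]
    exact congrArg (mfderiv (𝓡 d) 𝓘(ℝ, V →L[ℝ] V) (fun g : G => ρ g) (φ.symm y))
      (congrArg (fun T => T (mulInvariantVectorField ζ (φ.symm y))) h1)
  have hev : ∀ ζ, (fun y => fderiv ℝ F y (X ζ y)) =ᶠ[nhds (φ 1)]
      fun y => F y * infinitesimal ρ ζ := by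
    intro ζ
    filter_upwards [extChartAt_target_mem_nhds (I := 𝓡 d) (1 : G)] with y hy
    exact hXF ζ y hy
  have hder : ∀ ζ τ : GroupLieAlgebra (𝓡 d) G,
      fderiv ℝ (fun y => F y * infinitesimal ρ ζ) (φ 1) (X τ (φ 1)) =
      infinitesimal ρ τ * infinitesimal ρ ζ := by
    intro ζ τ
    have hy := mem_extChartAt_target (I := 𝓡 d) (1 : G)
    rw [fderiv_mul_const' (hF.differentiableAt (by simp))]
    simp only [smul_apply]
    rw [hXF τ _ hy, hF1, one_mul]
    rfl
  have main := fderiv_lieBracket_of_eventuallyEq hF (hX ξ) (hX η) (hev ξ) (hev η)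
  rw [hder, hder] at main
  rw [← main, hFd _ (mem_extChartAt_target (I := 𝓡 d) (1 : G)), hφ,
    mfderivWithin_range_extChartAt_symm, extChartAt_to_inv]
  have hb : (⁅ξ, η⁆ : GroupLieAlgebra (𝓡 d) G) =
      VectorField.lieBracket ℝ (X ξ) (X η) (φ 1) := by
    rw [GroupLieAlgebra.bracket_def, VectorField.mlieBracket,
      VectorField.mlieBracketWithin_apply]
    have hinv := isInvertible_mfderiv_extChartAt (I := 𝓡 d) (mem_extChartAt_source (1 : G))
    refine hinv.inverse_apply_eq.2 ?_
    rw [mfderiv_extChartAt_self, Set.preimage_univ, Set.univ_inter]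
    simp only [X, hφ, ModelWithCorners.range_eq_univ]
    exact congrFun (VectorField.lieBracketWithin_univ (𝕜 := ℝ) (E := EuclideanSpace ℝ (Fin d))) _
  rw [hb]
  rfl

/-- Along a local integral curve `γ` of the left-invariant field through `1`, `ρ ∘ γ` solves `y' = y
A`, so it is `exp (t A)` for small `t`. A power of `γ (1 / n)` reaches time `1`. -/
lemma exists_eq_exp_infinitesimal [CompleteSpace V] (ρ : G →* (V →L[ℝ] V))
    (hρ : ContMDiff (𝓡 d) 𝓘(ℝ, V →L[ℝ] V) ∞ (fun g : G => ρ g))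
    (ξ : GroupLieAlgebra (𝓡 d) G) : ∃ g : G, ρ g = NormedSpace.exp (infinitesimal ρ ξ) := by
  have hd : ∀ h : G, MDifferentiableAt (𝓡 d) 𝓘(ℝ, V →L[ℝ] V) (fun g : G => ρ g) h :=
    fun h => (hρ h).mdifferentiableAt (by simp)
  have : IsManifold (𝓡 d) 1 G := inferInstance
  let := NormedAlgebra.restrictScalars ℚ ℝ (V →L[ℝ] V)
  set A := infinitesimal ρ ξ with hA
  obtain ⟨γ, hγ0, hγ⟩ := exists_isMIntegralCurveAt_of_contMDiffAt_boundaryless (I := 𝓡 d)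
    (M := G) (v := mulInvariantVectorField ξ) 0 (x₀ := 1)
    ((contMDiffAt_mulInvariantVectorField ξ).of_le
      (le_trans (by norm_num) (le_minSmoothness (n := 2))))
  have hc : ∀ᶠ t in nhds (0 : ℝ), HasDerivAt (fun t => ρ (γ t)) (ρ (γ t) * A) t := by
    filter_upwards [hγ] with t ht
    have h1 := (hd (γ t)).hasMFDerivAt.comp t ht
    have h2 : HasFDerivAt (fun t => ρ (γ t))
        ((1 : ℝ →L[ℝ] ℝ).smulRight (ρ (γ t) * A)) t := by
      refine hasMFDerivAt_iff_hasFDerivAt.1 (h1.congr_mfderiv ?_)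
      rw [← mfderiv_mulInvariantVectorField ρ hρ ξ (γ t)]
      ext : 1
      exact (ContinuousLinearMap.map_smul_of_tower _ (1 : ℝ) _)
    simpa using h2.hasDerivAt
  obtain ⟨ε, hε, hball⟩ := Metric.eventually_nhds_iff_ball.1 hc
  have hexp : ∀ t ∈ Metric.ball (0 : ℝ) ε, ρ (γ t) = NormedSpace.exp (t • A) := by
    have hder : ∀ t ∈ Metric.ball (0 : ℝ) ε,
        HasDerivAt (fun t => ρ (γ t) * NormedSpace.exp (t • -A)) 0 t := by
      intro t ht
      refine ((hball t ht).mul (hasDerivAt_exp_smul_const' (-A) t)).congr_deriv ?_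
      simp [mul_assoc]
    have hconst : ∀ t ∈ Metric.ball (0 : ℝ) ε,
        ρ (γ t) * NormedSpace.exp (t • -A) = 1 := by
      intro t ht
      have := (convex_ball (0 : ℝ) ε).is_const_of_fderivWithin_eq_zero (𝕜 := ℝ)
        (f := fun t => ρ (γ t) * NormedSpace.exp (t • -A))
        (fun x hx => (hder x hx).differentiableAt.differentiableWithinAt)
        (fun x hx => by
          rw [fderivWithin_of_isOpen Metric.isOpen_ball hx]
          have := (hder x hx).hasFDerivAt.fderiv
          simpa using this)
        ht (Metric.mem_ball_self hε)
      simpa [hγ0] using this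
    intro t ht
    have h1 := hconst t ht
    have h2 : NormedSpace.exp (t • -A) * NormedSpace.exp (t • A) = 1 := by
      rw [← NormedSpace.exp_add_of_commute (by simp), smul_neg, neg_add_cancel,
        NormedSpace.exp_zero]
    rw [← mul_one (ρ (γ t)), ← h2, ← mul_assoc, h1, one_mul]
  obtain ⟨n, hn⟩ := exists_nat_gt (1 / ε)
  have hn0 : 0 < (n : ℝ) := lt_trans (by positivity) hn
  refine ⟨γ ((n : ℝ)⁻¹) ^ n, ?_⟩
  rw [map_pow, hexp, ← NormedSpace.exp_nsmul, ← Nat.cast_smul_eq_nsmul ℝ, smul_smul,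
    mul_inv_cancel₀ hn0.ne', one_smul]
  rw [mem_ball_zero_iff, Real.norm_of_nonneg (by positivity)]
  rw [inv_lt_comm₀ hn0 hε, ← one_div]
  exact hn

/-- The element `η` is the adjoint action of `g` on `ξ`, obtained by differentiating `ρ (g * h *
g⁻¹)` at `h = 1`. -/
lemma exists_conj_infinitesimal (ρ : G →* (V →L[ℝ] V))
    (hρ : ContMDiff (𝓡 d) 𝓘(ℝ, V →L[ℝ] V) ∞ (fun g : G => ρ g)) (g : G)
    (ξ : GroupLieAlgebra (𝓡 d) G) :
    ∃ η : GroupLieAlgebra (𝓡 d) G, ρ g * infinitesimal ρ ξ = infinitesimal ρ η * ρ g := by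
  have hd : ∀ h : G, MDifferentiableAt (𝓡 d) 𝓘(ℝ, V →L[ℝ] V) (fun g : G => ρ g) h :=
    fun h => (hρ h).mdifferentiableAt (by simp)
  have hm : MDifferentiableAt (𝓡 d) (𝓡 d) (fun h : G => g * h * g⁻¹) 1 :=
    (((contMDiff_mul_right (I := 𝓡 d) (n := ∞) (a := g⁻¹)).comp
      (contMDiff_mul_left (I := 𝓡 d) (n := ∞) (a := g))) 1).mdifferentiableAt (by simp)
  let L : (V →L[ℝ] V) →L[ℝ] (V →L[ℝ] V) :=
    ((ContinuousLinearMap.mul ℝ (V →L[ℝ] V)).flip (ρ g⁻¹)).comp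
      (ContinuousLinearMap.mul ℝ (V →L[ℝ] V) (ρ g))
  have e1 : mfderiv (𝓡 d) 𝓘(ℝ, V →L[ℝ] V) ((fun g : G => ρ g) ∘ fun h : G => g * h * g⁻¹) 1 =
      (mfderiv (𝓡 d) 𝓘(ℝ, V →L[ℝ] V) (fun g : G => ρ g) (g * 1 * g⁻¹)).comp
        (mfderiv (𝓡 d) (𝓡 d) (fun h : G => g * h * g⁻¹) 1) :=
    mfderiv_comp 1 (hd _) hm
  have e2 : ((fun g : G => ρ g) ∘ fun h : G => g * h * g⁻¹) = L ∘ (fun g : G => ρ g) := by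
    ext h; simp [L]
  have e3 : mfderiv (𝓡 d) 𝓘(ℝ, V →L[ℝ] V) (L ∘ (fun g : G => ρ g)) 1 =
      L.comp (mfderiv (𝓡 d) 𝓘(ℝ, V →L[ℝ] V) (fun g : G => ρ g) 1) := by
    have := mfderiv_comp (I := 𝓡 d) (I' := 𝓘(ℝ, V →L[ℝ] V)) (I'' := 𝓘(ℝ, V →L[ℝ] V)) (1 : G)
      (f := fun g : G => ρ g) (g := L) L.differentiableAt.mdifferentiableAt (hd 1)
    rw [this, mfderiv_eq_fderiv, ContinuousLinearMap.fderiv]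
    rfl
  rw [e2, e3] at e1
  have e4 : ∀ k : G, k = 1 → ∀ w : EuclideanSpace ℝ (Fin d),
      (mfderiv (𝓡 d) 𝓘(ℝ, V →L[ℝ] V) (fun g : G => ρ g) k w : V →L[ℝ] V) =
        mfderiv (𝓡 d) 𝓘(ℝ, V →L[ℝ] V) (fun g : G => ρ g) 1 w := by
    rintro k rfl w
    rfl
  let η : EuclideanSpace ℝ (Fin d) := mfderiv (𝓡 d) (𝓡 d) (fun h : G => g * h * g⁻¹) 1 ξ
  refine ⟨η, ?_⟩
  have e5 : infinitesimal ρ η = ρ g * infinitesimal ρ ξ * ρ g⁻¹ :=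
    (e4 (g * 1 * g⁻¹) (by simp) _).symm.trans (congrArg (fun T => T ξ) e1).symm
  rw [e5, mul_assoc, ← map_mul, inv_mul_cancel, map_one, mul_one]

lemma _root_.IsLocallyConstant.of_mfderiv_eq_zero {M : Type*} [TopologicalSpace M]
    [ChartedSpace (EuclideanSpace ℝ (Fin d)) M] [IsManifold (𝓡 d) 1 M] {f : M → V}
    (hf : MDifferentiable (𝓡 d) 𝓘(ℝ, V) f)
    (h0 : ∀ x, mfderiv (𝓡 d) 𝓘(ℝ, V) f x = 0) : IsLocallyConstant f := by
  rw [IsLocallyConstant.iff_eventually_eq]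
  intro x
  set φ := extChartAt (𝓡 d) x with hφ
  obtain ⟨ε, hε, hball⟩ := Metric.mem_nhds_iff.1 (extChartAt_target_mem_nhds (I := 𝓡 d) x)
  have hder : ∀ y ∈ φ.target, MDifferentiableAt 𝓘(ℝ, EuclideanSpace ℝ (Fin d)) 𝓘(ℝ, V)
      (f ∘ φ.symm) y ∧ mfderiv 𝓘(ℝ, EuclideanSpace ℝ (Fin d)) 𝓘(ℝ, V) (f ∘ φ.symm) y = 0 := by
    intro y hy
    have h1 : MDifferentiableAt 𝓘(ℝ, EuclideanSpace ℝ (Fin d)) (𝓡 d) φ.symm y := by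
      have := mdifferentiableWithinAt_extChartAt_symm (I := 𝓡 d) hy
      rwa [ModelWithCorners.range_eq_univ, mdifferentiableWithinAt_univ] at this
    refine ⟨(hf _).comp y h1, ?_⟩
    rw [mfderiv_comp y (hf _) h1, h0]
    ext w
    rfl
  have hconst : ∀ y ∈ Metric.ball (φ x) ε, f (φ.symm y) = f x := by
    intro y hy
    have := (convex_ball (φ x) ε).is_const_of_fderivWithin_eq_zero (𝕜 := ℝ) (f := f ∘ φ.symm)
        (fun z hz => (hder z (hball hz)).1.differentiableAt.differentiableWithinAt)
        (fun z hz => by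
          rw [fderivWithin_of_isOpen Metric.isOpen_ball hz, ← mfderiv_eq_fderiv]
          exact (hder z (hball hz)).2)
        hy (Metric.mem_ball_self hε)
    simpa [hφ, extChartAt_to_inv] using this
  have h2 : ∀ᶠ y in nhds x, φ y ∈ Metric.ball (φ x) ε :=
    (continuousAt_extChartAt (I := 𝓡 d) x).eventually (Metric.ball_mem_nhds _ hε)
  filter_upwards [h2, extChartAt_source_mem_nhds (I := 𝓡 d) x] with y hy hys
  rw [← hconst _ hy, φ.left_inv hys]

lemma exists_mfderiv_eq_mul_infinitesimal (ρ : G →* (V →L[ℝ] V))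
    (hρ : ContMDiff (𝓡 d) 𝓘(ℝ, V →L[ℝ] V) ∞ (fun g : G => ρ g)) (g : G)
    (w : TangentSpace (𝓡 d) g) :
    ∃ ξ : GroupLieAlgebra (𝓡 d) G,
      (mfderiv (𝓡 d) 𝓘(ℝ, V →L[ℝ] V) (fun g : G => ρ g) g w : V →L[ℝ] V) =
        ρ g * infinitesimal ρ ξ := by
  have hd : ∀ h : G, MDifferentiableAt (𝓡 d) 𝓘(ℝ, V →L[ℝ] V) (fun g : G => ρ g) h :=
    fun h => (hρ h).mdifferentiableAt (by simp)
  have hm : MDifferentiableAt (𝓡 d) (𝓡 d) (fun h : G => g⁻¹ * h) g :=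
    ((contMDiff_mul_left (I := 𝓡 d) (n := ∞) (a := g⁻¹)) g).mdifferentiableAt (by simp)
  let L : (V →L[ℝ] V) →L[ℝ] (V →L[ℝ] V) := ContinuousLinearMap.mul ℝ (V →L[ℝ] V) (ρ g)
  have e1 : mfderiv (𝓡 d) 𝓘(ℝ, V →L[ℝ] V) ((fun g : G => ρ g) ∘ fun h : G => g⁻¹ * h) g =
      (mfderiv (𝓡 d) 𝓘(ℝ, V →L[ℝ] V) (fun g : G => ρ g) (g⁻¹ * g)).comp
        (mfderiv (𝓡 d) (𝓡 d) (fun h : G => g⁻¹ * h) g) :=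
    mfderiv_comp g (hd _) hm
  have e2 : (fun g : G => ρ g) = L ∘ ((fun g : G => ρ g) ∘ fun h : G => g⁻¹ * h) := by
    ext h : 1
    simp [L, ← map_mul]
  have e3 : mfderiv (𝓡 d) 𝓘(ℝ, V →L[ℝ] V) (L ∘ ((fun g : G => ρ g) ∘ fun h : G => g⁻¹ * h)) g =
      L.comp (mfderiv (𝓡 d) 𝓘(ℝ, V →L[ℝ] V) ((fun g : G => ρ g) ∘ fun h : G => g⁻¹ * h) g) := by
    have := mfderiv_comp (I := 𝓡 d) (I' := 𝓘(ℝ, V →L[ℝ] V)) (I'' := 𝓘(ℝ, V →L[ℝ] V)) (g : G)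
      (f := (fun g : G => ρ g) ∘ fun h : G => g⁻¹ * h) (g := L)
      L.differentiableAt.mdifferentiableAt ((hd _).comp g hm)
    rw [this, mfderiv_eq_fderiv, ContinuousLinearMap.fderiv]
    rfl
  have e4 : ∀ k : G, k = 1 → ∀ w : EuclideanSpace ℝ (Fin d),
      (mfderiv (𝓡 d) 𝓘(ℝ, V →L[ℝ] V) (fun g : G => ρ g) k w : V →L[ℝ] V) =
        mfderiv (𝓡 d) 𝓘(ℝ, V →L[ℝ] V) (fun g : G => ρ g) 1 w := by
    rintro k rfl w
    rfl
  let ξ : EuclideanSpace ℝ (Fin d) := mfderiv (𝓡 d) (𝓡 d) (fun h : G => g⁻¹ * h) g w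
  refine ⟨ξ, ?_⟩
  have e5 : infinitesimal ρ ξ =
      mfderiv (𝓡 d) 𝓘(ℝ, V →L[ℝ] V) ((fun g : G => ρ g) ∘ fun h : G => g⁻¹ * h) g w :=
    (e4 (g⁻¹ * g) (by simp) _).symm.trans (congrArg (fun T => T w) e1).symm
  rw [e5]
  conv_lhs => rw [e2, e3]
  rfl

/-- The orbit map `h ↦ ρ h v` has derivatives `ρ h (infinitesimal ρ ξ v) = 0`, so it is locally
constant, hence constant on the connected group. -/
lemma apply_eq_self_of_infinitesimal_eq_zero [ConnectedSpace G] (ρ : G →* (V →L[ℝ] V))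
    (hρ : ContMDiff (𝓡 d) 𝓘(ℝ, V →L[ℝ] V) ∞ (fun g : G => ρ g)) {v : V}
    (hv : ∀ ξ : GroupLieAlgebra (𝓡 d) G, infinitesimal ρ ξ v = 0) (g : G) : ρ g v = v := by
  have hd : ∀ h : G, MDifferentiableAt (𝓡 d) 𝓘(ℝ, V →L[ℝ] V) (fun g : G => ρ g) h :=
    fun h => (hρ h).mdifferentiableAt (by simp)
  let E : (V →L[ℝ] V) →L[ℝ] V := ContinuousLinearMap.apply ℝ V v
  have hE : ∀ h : G, MDifferentiableAt 𝓘(ℝ, V →L[ℝ] V) 𝓘(ℝ, V) E (ρ h) :=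
    fun h => E.differentiableAt.mdifferentiableAt
  have h0 : IsLocallyConstant (E ∘ fun g : G => ρ g) := by
    refine IsLocallyConstant.of_mfderiv_eq_zero (d := d) (fun h => (hE h).comp h (hd h))
      fun h => ?_
    rw [mfderiv_comp h (hE h) (hd h), mfderiv_eq_fderiv, ContinuousLinearMap.fderiv]
    ext w
    obtain ⟨ξ, hξ⟩ := exists_mfderiv_eq_mul_infinitesimal ρ hρ h w
    refine (congrArg E hξ).trans ?_
    change ρ h (infinitesimal ρ ξ v) = 0
    rw [hv, map_zero]
  have := h0.apply_eq_of_preconnectedSpace g 1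
  simpa [E] using this

end Differential

end LieGroupRep

/-! ### Binary forms, infinitesimal rotations and the antipodal real structure. -/

namespace BinarySextic

open Polynomial Module

/-- The quadratic form attached to a vector of `ℝ³`. -/
noncomputable def quad : (Fin 3 → ℝ) →ₗ[ℝ] ℂ[X] where
  toFun u := C ((u 0 : ℂ) - Complex.I * u 1) + C (2 * Complex.I * u 2) * X +
    C ((u 0 : ℂ) + Complex.I * u 1) * X ^ 2
  map_add' u v := by
    simp only [Pi.add_apply, Complex.ofReal_add, mul_add, map_add, map_sub, map_mul]
    ring
  map_smul' c u := by
    have h : ∀ p : ℂ[X], c • p = C (c : ℂ) * p := fun p => by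
      rw [← smul_eq_C_mul]
      ext k
      simp
    simp only [h, RingHom.id_apply, Pi.smul_apply, smul_eq_mul, Complex.ofReal_mul, map_add, map_sub,
      map_mul]
    ring

lemma quad_apply (u : Fin 3 → ℝ) : quad u = C ((u 0 : ℂ) - Complex.I * u 1) +
    C (2 * Complex.I * u 2) * X + C ((u 0 : ℂ) + Complex.I * u 1) * X ^ 2 := rfl

/-- The infinitesimal rotation `ξ` acting on binary forms of degree `n`. -/
noncomputable def rotForm (n : ℕ) (ξ : Fin 3 → ℝ) (p : ℂ[X]) : ℂ[X] :=
  C (1 / 2) * (quad ξ * derivative p) - C ((n : ℂ) / 4) * (derivative (quad ξ) * p)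

lemma rotForm_add (n : ℕ) (ξ : Fin 3 → ℝ) (p q : ℂ[X]) :
    rotForm n ξ (p + q) = rotForm n ξ p + rotForm n ξ q := by
  simp only [rotForm, derivative_add]
  ring

lemma rotForm_smul (n : ℕ) (ξ : Fin 3 → ℝ) (c : ℂ) (p : ℂ[X]) :
    rotForm n ξ (c • p) = c • rotForm n ξ p := by
  simp only [rotForm, smul_eq_C_mul, derivative_C_mul]
  ring

/-- The zeroth-order coefficient `n / 4` is additive in the degree, so the Leibniz rule survives the
correction term. -/
lemma rotForm_mul (m n : ℕ) (ξ : Fin 3 → ℝ) (p q : ℂ[X]) :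
    rotForm (m + n) ξ (p * q) = rotForm m ξ p * q + p * rotForm n ξ q := by
  simp only [rotForm, derivative_mul, Nat.cast_add, add_div, map_add]
  ring

/-- This identifies quadratic forms with `ℝ³` under rotation and fixes the constants in `rotForm`.
-/
lemma rotForm_quad (ξ u : Fin 3 → ℝ) : rotForm 2 ξ (quad u) = quad (crossProduct ξ u) := by
  refine Polynomial.funext fun z => ?_
  simp only [rotForm, quad_apply, cross_apply, eval_add, eval_sub, eval_mul, eval_C, eval_X, eval_pow,
    derivative_add, derivative_mul, derivative_C, derivative_X, derivative_X_pow,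
    Matrix.cons_val_zero, Matrix.cons_val_one, Matrix.cons_val, Complex.ofReal_sub,
    Complex.ofReal_mul, eval_zero, eval_one, Nat.cast_ofNat]
  ring_nf
  simp only [Complex.I_sq]
  ring

/-- The antipodal involution on binary forms of degree `n`. -/
noncomputable def antipode (n : ℕ) (p : ℂ[X]) : ℂ[X] :=
  (reflect n (p.map (starRingEnd ℂ))).comp (-X)

lemma coeff_antipode {n k : ℕ} (hk : k ≤ n) (p : ℂ[X]) :
    (antipode n p).coeff k = (-1) ^ k * (starRingEnd ℂ) (p.coeff (n - k)) := by
  have : ∀ (q : ℂ[X]) (k : ℕ), (q.comp (-X)).coeff k = (-1) ^ k * q.coeff k := by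
    intro q k
    rw [show (-X : ℂ[X]) = C (-1) * X by simp, comp_C_mul_X_coeff, mul_comm]
  rw [antipode, this, coeff_reflect, revAt_le hk, coeff_map]

lemma antipode_mul {m n : ℕ} {p q : ℂ[X]} (hp : p.natDegree ≤ m) (hq : q.natDegree ≤ n) :
    antipode (m + n) (p * q) = antipode m p * antipode n q := by
  rw [antipode, Polynomial.map_mul, reflect_mul _ _ ((natDegree_map_le).trans hp)
    ((natDegree_map_le).trans hq), mul_comp]
  rfl

lemma antipode_add (n : ℕ) (p q : ℂ[X]) : antipode n (p + q) = antipode n p + antipode n q := by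
  simp [antipode]

lemma antipode_real_smul (n : ℕ) (c : ℝ) (p : ℂ[X]) : antipode n (c • p) = c • antipode n p := by
  have h : ∀ p : ℂ[X], c • p = C (c : ℂ) * p := fun p => by
    rw [← smul_eq_C_mul]
    ext k
    simp
  simp [antipode, h]

/-- Binary forms of degree `n` fixed by the antipodal involution. -/
noncomputable def realForms (n : ℕ) : Submodule ℝ ℂ[X] where
  carrier := {p | p.natDegree ≤ n ∧ antipode n p = p}
  add_mem' := by
    rintro p q ⟨hp, hp'⟩ ⟨hq, hq'⟩
    exact ⟨natDegree_add_le_of_degree_le hp hq, by rw [antipode_add, hp', hq']⟩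
  zero_mem' := ⟨by simp, by simp [antipode]⟩
  smul_mem' := by
    rintro c p ⟨hp, hp'⟩
    exact ⟨(natDegree_smul_le c p).trans hp, by rw [antipode_real_smul, hp']⟩

lemma coeff_eq_of_mem_realForms {n k : ℕ} {p : ℂ[X]} (hp : p ∈ realForms n) (hk : k ≤ n) :
    p.coeff k = (-1) ^ k * (starRingEnd ℂ) (p.coeff (n - k)) := by
  conv_lhs => rw [← hp.2]
  exact coeff_antipode hk p

lemma mul_mem_realForms {m n : ℕ} {p q : ℂ[X]} (hp : p ∈ realForms m) (hq : q ∈ realForms n) :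
    p * q ∈ realForms (m + n) :=
  ⟨natDegree_mul_le.trans (add_le_add hp.1 hq.1), by rw [antipode_mul hp.1 hq.1, hp.2, hq.2]⟩

lemma natDegree_antipode_le (n : ℕ) {p : ℂ[X]} (hp : p.natDegree ≤ n) :
    (antipode n p).natDegree ≤ n := by
  rw [antipode, natDegree_comp]
  simpa using natDegree_reflect_le.trans (max_le le_rfl (natDegree_map_le.trans hp))

lemma mem_realForms_of_coeff {n : ℕ} {p : ℂ[X]} (hd : p.natDegree ≤ n)
    (h : ∀ k ≤ n, p.coeff k = (-1) ^ k * (starRingEnd ℂ) (p.coeff (n - k))) : p ∈ realForms n := by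
  refine ⟨hd, ?_⟩
  ext k
  rcases le_or_gt k n with hk | hk
  · rw [coeff_antipode hk, ← h k hk]
  · rw [coeff_eq_zero_of_natDegree_lt ((natDegree_antipode_le n hd).trans_lt hk),
      coeff_eq_zero_of_natDegree_lt (hd.trans_lt hk)]

lemma natDegree_quad_le (u : Fin 3 → ℝ) : (quad u).natDegree ≤ 2 := by
  rw [quad_apply]
  compute_degree

lemma coeff_quad (u : Fin 3 → ℝ) : (quad u).coeff 0 = (u 0 : ℂ) - Complex.I * u 1 ∧
    (quad u).coeff 1 = 2 * Complex.I * u 2 ∧ (quad u).coeff 2 = (u 0 : ℂ) + Complex.I * u 1 := by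
  rw [quad_apply]
  refine ⟨?_, ?_, ?_⟩ <;> simp only [coeff_add, coeff_C_mul, coeff_X_pow, coeff_X, coeff_C] <;> simp

lemma quad_mem_realForms (u : Fin 3 → ℝ) : quad u ∈ realForms 2 := by
  refine mem_realForms_of_coeff (natDegree_quad_le u) fun k hk => ?_
  obtain ⟨h0, h1, h2⟩ := coeff_quad u
  interval_cases k <;> simp [h0, h1, h2, Complex.conj_ofNat, sub_eq_add_neg]

/-- Reality makes the coefficient at `n - k` a signed conjugate of the one at `k`. So `re + im` at
the two places gives `re + im` and `±(re - im)` of the coefficient at `k`, and one real number per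
index suffices. -/
lemma finrank_realForms_le (n : ℕ) :
    Module.Finite ℝ (realForms n) ∧ finrank ℝ (realForms n) ≤ n + 1 := by
  let T : realForms n →ₗ[ℝ] (Fin (n + 1) → ℝ) :=
    { toFun := fun p k => ((p : ℂ[X]).coeff k).re + ((p : ℂ[X]).coeff k).im
      map_add' := fun p q => by
        ext k
        simp
        ring
      map_smul' := fun c p => by
        ext k
        simp
        ring }
  have hT : Function.Injective T := by
    rw [← LinearMap.ker_eq_bot, LinearMap.ker_eq_bot']
    intro p hp
    have h1 : ∀ k ≤ n, ((p : ℂ[X]).coeff k).re + ((p : ℂ[X]).coeff k).im = 0 := fun k hk =>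
      congrFun hp ⟨k, by omega⟩
    ext k
    rcases le_or_gt k n with hk | hk
    · have h2 := h1 k hk
      have h3 := h1 (n - k) (by omega)
      have h4 := coeff_eq_of_mem_realForms p.2 (show n - k ≤ n by omega)
      rw [Nat.sub_sub_self hk] at h4
      have h5 : ((p : ℂ[X]).coeff k).re - ((p : ℂ[X]).coeff k).im = 0 := by
        rw [h4] at h3
        rcases neg_one_pow_eq_or ℂ (n - k) with h | h <;> rw [h] at h3 <;>
          simp at h3 <;> linarith
      apply Complex.ext <;> simp <;> linarith
    · simp [coeff_eq_zero_of_natDegree_lt (p.2.1.trans_lt hk)]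
  exact ⟨Module.Finite.of_injective T hT,
    by simpa using LinearMap.finrank_le_finrank_of_injective hT⟩

/-- The real span of the products of `m` quadratic forms `quad u`. -/
noncomputable def quadPow (m : ℕ) : Submodule ℝ ℂ[X] := (LinearMap.range quad) ^ m

lemma quadPow_le_realForms (m : ℕ) : quadPow m ≤ realForms (2 * m) := by
  induction m with
  | zero =>
    rw [quadPow, pow_zero, Submodule.one_le]
    exact ⟨by simp, by simp [antipode]⟩
  | succ m ih =>
    rw [quadPow, pow_succ, Submodule.mul_le]
    rintro p hp _ ⟨u, rfl⟩
    exact mul_mem_realForms (ih hp) (quad_mem_realForms u)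

lemma rotForm_mem_quadPow (m : ℕ) (ξ : Fin 3 → ℝ) {p : ℂ[X]} (hp : p ∈ quadPow m) :
    rotForm (2 * m) ξ p ∈ quadPow m := by
  induction m generalizing p with
  | zero =>
    rw [quadPow, pow_zero, Submodule.mem_one] at hp
    obtain ⟨c, rfl⟩ := hp
    simp [rotForm, Polynomial.algebraMap_apply]
  | succ m ih =>
    rw [quadPow, pow_succ] at hp ⊢
    refine Submodule.mul_induction_on hp ?_ ?_
    · rintro p hp _ ⟨u, rfl⟩
      rw [Nat.mul_succ, rotForm_mul, rotForm_quad]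
      exact add_mem (Submodule.mul_mem_mul (ih hp) ⟨u, rfl⟩)
        (Submodule.mul_mem_mul hp ⟨_, rfl⟩)
    · intro p q hp hq
      rw [rotForm_add]
      exact add_mem hp hq

lemma exists_smul_X_pow_mem_quadPow (m : ℕ) : ∃ c : ℂ, c ≠ 0 ∧ C c * X ^ m ∈ quadPow m := by
  refine ⟨(2 * Complex.I) ^ m, by simp, ?_⟩
  have : (C ((2 * Complex.I) ^ m) * X ^ m : ℂ[X]) = quad ![0, 0, 1] ^ m := by
    rw [quad_apply, C_pow, ← mul_pow]
    simp
  rw [this]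
  exact Submodule.pow_mem_pow _ (LinearMap.mem_range_self _ _) m

end BinarySextic

/-! ### The irreducible representation of dimension 7 as the space of real sextic forms. -/

namespace BinarySextic

open Polynomial Module

lemma coeff_rotForm_zero (n : ℕ) (ξ : Fin 3 → ℝ) (p : ℂ[X]) :
    (rotForm n ξ p).coeff 0 =
      1 / 2 * (ξ 0 - Complex.I * ξ 1) * p.coeff 1 - n / 2 * Complex.I * ξ 2 * p.coeff 0 := by
  simp only [rotForm, coeff_sub, mul_coeff_zero, coeff_derivative,
    (coeff_quad ξ).1, (coeff_quad ξ).2.1, coeff_C_zero]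
  push_cast
  ring

lemma coeff_rotForm_succ (n k : ℕ) (ξ : Fin 3 → ℝ) (p : ℂ[X]) :
    (rotForm n ξ p).coeff (k + 1) =
      1 / 2 * (ξ 0 - Complex.I * ξ 1) * (k + 2) * p.coeff (k + 2) +
      Complex.I * ξ 2 * ((k + 1) - n / 2) * p.coeff (k + 1) +
      1 / 2 * (ξ 0 + Complex.I * ξ 1) * (k - n) * p.coeff k := by
  have h1 : derivative (quad ξ) = C (2 * Complex.I * ξ 2) +
      C (2 * ((ξ 0 : ℂ) + Complex.I * ξ 1)) * X := by
    rw [quad_apply]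
    simp only [derivative_add, derivative_C, derivative_C_mul, derivative_X, derivative_X_pow]
    simp only [map_mul, Nat.cast_ofNat]
    ring
  have h2 : (X ^ 2 * derivative p).coeff (k + 1) = k * p.coeff k := by
    rcases k with _ | k
    · simp [coeff_X_pow_mul']
    · rw [show k + 1 + 1 = k + 2 by ring, coeff_X_pow_mul, coeff_derivative]
      push_cast
      ring
  rw [rotForm, h1, quad_apply]
  simp only [add_mul, mul_add, coeff_sub, coeff_add, coeff_C_mul, mul_assoc, h2, coeff_X_mul,
    coeff_derivative]
  push_cast
  ring

attribute [local instance] LieRing.ofAssociativeRing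

section Irreducible

variable {U : Type*} [AddCommGroup U] [Module ℝ U]

/-- Precomposition with an endomorphism, on complex-valued functionals. -/
noncomputable def precomp (A : Module.End ℝ U) : Module.End ℂ (U →ₗ[ℝ] ℂ) where
  toFun l := l.comp A
  map_add' _ _ := rfl
  map_smul' _ _ := rfl

lemma precomp_apply (A : Module.End ℝ U) (l : U →ₗ[ℝ] ℂ) (v : U) : precomp A l v = l (A v) := rfl

lemma finrank_functionals [FiniteDimensional ℝ U] :
    Module.Finite ℂ (U →ₗ[ℝ] ℂ) ∧ finrank ℂ (U →ₗ[ℝ] ℂ) = finrank ℝ U := by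
  have h1 : Module.Finite ℂ (U →ₗ[ℝ] ℂ) := Module.Finite.of_restrictScalars_finite ℝ ℂ _
  exact ⟨h1, by rw [Module.finrank_linearMap, finrank_self, mul_one]⟩

/-- A real characteristic polynomial of odd degree changes sign, hence has a real root. -/
lemma exists_eigenvector_of_odd [FiniteDimensional ℝ U] (h : Odd (finrank ℝ U))
    (A : Module.End ℝ U) : ∃ (t : ℝ) (v : U), v ≠ 0 ∧ A v = t • v := by
  have hdeg : A.charpoly.natDegree = finrank ℝ U := LinearMap.charpoly_natDegree A
  have hmon : A.charpoly.Monic := LinearMap.charpoly_monic A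
  have hpos : 0 < A.charpoly.degree := by
    rw [← natDegree_pos_iff_degree_pos, hdeg]
    exact h.pos
  have h1 := tendsto_atTop_of_leadingCoeff_nonneg A.charpoly hpos (by rw [hmon]; exact zero_le_one)
  have h2 := tendsto_atBot_of_leadingCoeff_nonpos (A.charpoly.comp (-X))
    (by
      rw [← natDegree_pos_iff_degree_pos, natDegree_comp, hdeg]
      simpa using h.pos)
    (by
      rw [leadingCoeff_comp (by simp), hmon, hdeg]
      simp [h.neg_one_pow])
  obtain ⟨a, ha⟩ := (h1.eventually_ge_atTop 0).exists
  obtain ⟨b, hb⟩ := (h2.eventually_le_atBot 0).exists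
  rw [eval_comp] at hb
  obtain ⟨t, ht⟩ := mem_range_of_exists_le_of_exists_ge A.charpoly.continuous ⟨_, hb⟩ ⟨_, ha⟩
  have he : A.HasEigenvalue t := by
    rw [Module.End.hasEigenvalue_iff_isRoot_charpoly]
    exact ht
  obtain ⟨v, hv⟩ := he.exists_hasEigenvector
  exact ⟨t, v, hv.2, hv.apply_eq_smul⟩

variable {j : (Fin 3 → ℝ) →ₗ[ℝ] Module.End ℝ U}

lemma map_eq_sum_basis {N : Type*} [AddCommGroup N] [Module ℝ N] (f : (Fin 3 → ℝ) →ₗ[ℝ] N)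
    (ξ : Fin 3 → ℝ) :
    f ξ = ξ 0 • f ![1, 0, 0] + ξ 1 • f ![0, 1, 0] + ξ 2 • f ![0, 0, 1] := by
  have : ξ = ξ 0 • ![1, 0, 0] + ξ 1 • ![0, 1, 0] + ξ 2 • ![0, 0, 1] := by
    ext i; fin_cases i <;> simp
  conv_lhs => rw [this]
  simp only [map_add, map_smul]

/-- The complexification of `ℝ³` with the cross product is `sl₂`. Precomposition reverses products,
which accounts for the choice of signs. -/
lemma exists_isSl2Triple (hU : 1 < finrank ℝ U)
    (hj : ∀ ξ η, j (crossProduct ξ η) = j ξ * j η - j η * j ξ)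
    (hirr : ∀ S : Submodule ℝ U, (∀ ξ, ∀ v ∈ S, j ξ v ∈ S) → S = ⊥ ∨ S = ⊤) :
    IsSl2Triple (L := Module.End ℂ (U →ₗ[ℝ] ℂ)) ((2 * Complex.I) • precomp (j ![0, 0, 1]))
      (Complex.I • precomp (j ![0, 1, 0]) - precomp (j ![1, 0, 0]))
      (precomp (j ![1, 0, 0]) + Complex.I • precomp (j ![0, 1, 0])) := by
  have h12 : j ![0, 0, 1] = j ![1, 0, 0] * j ![0, 1, 0] - j ![0, 1, 0] * j ![1, 0, 0] := by
    rw [← hj]; congr 1; ext i; fin_cases i <;> simp [cross_apply]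
  have h23 : j ![1, 0, 0] = j ![0, 1, 0] * j ![0, 0, 1] - j ![0, 0, 1] * j ![0, 1, 0] := by
    rw [← hj]; congr 1; ext i; fin_cases i <;> simp [cross_apply]
  have h31 : j ![0, 1, 0] = j ![0, 0, 1] * j ![1, 0, 0] - j ![1, 0, 0] * j ![0, 0, 1] := by
    rw [← hj]; congr 1; ext i; fin_cases i <;> simp [cross_apply]
  have hmul : ∀ A B : Module.End ℝ U, precomp A * precomp B = precomp (B * A) := fun _ _ => rfl
  have hsub : ∀ A B : Module.End ℝ U, precomp (A - B) = precomp A - precomp B := fun A B => by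
    ext l v
    simp [precomp_apply]
  have r12 : precomp (j ![0, 1, 0]) * precomp (j ![1, 0, 0]) -
      precomp (j ![1, 0, 0]) * precomp (j ![0, 1, 0]) = precomp (j ![0, 0, 1]) := by
    rw [hmul, hmul, ← hsub, ← h12]
  have r23 : precomp (j ![0, 0, 1]) * precomp (j ![0, 1, 0]) -
      precomp (j ![0, 1, 0]) * precomp (j ![0, 0, 1]) = precomp (j ![1, 0, 0]) := by
    rw [hmul, hmul, ← hsub, ← h23]
  have r31 : precomp (j ![1, 0, 0]) * precomp (j ![0, 0, 1]) -
      precomp (j ![0, 0, 1]) * precomp (j ![1, 0, 0]) = precomp (j ![0, 1, 0]) := by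
    rw [hmul, hmul, ← hsub, ← h31]
  set A := precomp (j ![1, 0, 0])
  set B := precomp (j ![0, 1, 0])
  set D := precomp (j ![0, 0, 1]) with hD
  have hI : 2 * Complex.I * Complex.I = -2 := by rw [mul_assoc, Complex.I_mul_I]; ring
  have hI' : Complex.I * (2 * Complex.I) = -2 := by rw [mul_comm, hI]
  refine ⟨?_, ?_, ?_, ?_⟩
  · intro h0
    have hD0 : D = 0 := by
      rcases smul_eq_zero.1 h0 with h | h
      · simp at h
      · exact h
    have h3 : j ![0, 0, 1] = 0 := by
      ext v
      refine (Module.forall_dual_apply_eq_zero_iff ℝ _).1 fun f => ?_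
      have := congrArg (fun T => T (Complex.ofRealCLM.toLinearMap.comp f) v) hD0
      simpa [hD, precomp_apply] using this
    have h1 : j ![1, 0, 0] = 0 := by rw [h23, h3]; simp
    have h2 : j ![0, 1, 0] = 0 := by rw [h31, h3]; simp
    -- If the weight operator vanished, so would the whole action; then every line would be
    -- invariant and the dimension would be 1.
    have hall : ∀ ξ, j ξ = 0 := by
      intro ξ
      rw [map_eq_sum_basis, h1, h2, h3]
      simp
    have hnt : Nontrivial U := Module.nontrivial_of_finrank_pos (R := ℝ) (by omega)
    obtain ⟨v, hv⟩ := exists_ne (0 : U)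
    rcases hirr (Submodule.span ℝ {v}) (fun ξ w _ => by simp [hall]) with h | h
    · exact hv (Submodule.span_singleton_eq_bot.1 h)
    · have := finrank_span_singleton (K := ℝ) hv
      rw [h, finrank_top] at this
      omega
  · rw [LieRing.of_associative_ring_bracket, ← r12]
    simp only [sub_mul, mul_sub, mul_add, add_mul, smul_mul_assoc, mul_smul_comm]
    module
  · rw [LieRing.of_associative_ring_bracket]
    have e : (2 • (Complex.I • B - A)) =
        (2 * Complex.I) • (A * D - D * A) - (2 : ℂ) • (D * B - B * D) := by
      rw [r31, r23]
      module
    rw [e]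
    simp only [sub_mul, mul_sub, smul_mul_assoc, mul_smul_comm, smul_sub, smul_smul, hI, hI']
    module
  · rw [LieRing.of_associative_ring_bracket]
    have e : (2 • (A + Complex.I • B)) =
        (2 : ℂ) • (D * B - B * D) + (2 * Complex.I) • (A * D - D * A) := by
      rw [r31, r23]
      module
    rw [e]
    simp only [mul_add, add_mul, smul_mul_assoc, mul_smul_comm, smul_add, smul_sub, smul_smul, hI,
      hI']
    module

/-- The functional `l 0` is a primitive vector and `l k` is obtained by lowering it `k` times. Those
with `k ≤ n` are eigenvectors for distinct eigenvalues, which bounds `n` by the dimension. -/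
lemma exists_weight_sequence [FiniteDimensional ℝ U] (hU : 1 < finrank ℝ U)
    (hj : ∀ ξ η, j (crossProduct ξ η) = j ξ * j η - j η * j ξ)
    (hirr : ∀ S : Submodule ℝ U, (∀ ξ, ∀ v ∈ S, j ξ v ∈ S) → S = ⊥ ∨ S = ⊤) :
    ∃ (n : ℕ) (l : ℕ → U →ₗ[ℝ] ℂ), n < finrank ℝ U ∧ l 0 ≠ 0 ∧ (∀ k, n < k → l k = 0) ∧
      (∀ k v, l k (j ![1, 0, 0] v) + Complex.I * l k (j ![0, 1, 0] v) = l (k + 1) v) ∧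
      (∀ k v, 2 * Complex.I * l k (j ![0, 0, 1] v) = (n - 2 * k) * l k v) ∧
      (∀ v, Complex.I * l 0 (j ![0, 1, 0] v) - l 0 (j ![1, 0, 0] v) = 0) ∧
      (∀ k v, Complex.I * l (k + 1) (j ![0, 1, 0] v) - l (k + 1) (j ![1, 0, 0] v) =
        (k + 1) * (n - k) * l k v) := by
  obtain ⟨hfin, hrank⟩ := finrank_functionals (U := U)
  have t := exists_isSl2Triple hU hj hirr
  have : Nontrivial (U →ₗ[ℝ] ℂ) := Module.nontrivial_of_finrank_pos (R := ℂ) (by omega)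
  have : LieModule.IsTriangularizable ℂ (Module.End ℂ (U →ₗ[ℝ] ℂ)) (U →ₗ[ℝ] ℂ) :=
    ⟨fun _ => Module.End.iSup_maxGenEigenspace_eq_top _⟩
  obtain ⟨μ, l, -, P⟩ := t.exists_hasPrimitiveVectorWith (R := ℂ) (M := U →ₗ[ℝ] ℂ)
  obtain ⟨n, rfl⟩ := P.exists_nat
  set F := precomp (j ![1, 0, 0]) + Complex.I • precomp (j ![0, 1, 0]) with hF
  have hH : ∀ k : ℕ, ((2 * Complex.I) • precomp (j ![0, 0, 1])) ((F ^ k) l) =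
      ((n : ℂ) - 2 * k) • (F ^ k) l := P.lie_h_pow_toEnd_f
  have hE : ∀ k : ℕ, (Complex.I • precomp (j ![0, 1, 0]) - precomp (j ![1, 0, 0]))
      ((F ^ (k + 1)) l) = (((k : ℂ) + 1) * (n - k)) • (F ^ k) l := P.lie_e_pow_succ_toEnd_f
  have hne : ∀ k ≤ n, (F ^ k) l ≠ 0 := fun k => P.pow_toEnd_f_ne_zero_of_eq_nat rfl
  have hz : (F ^ (n + 1)) l = 0 := P.pow_toEnd_f_eq_zero_of_eq_nat rfl
  have hz' : ∀ k, n < k → (F ^ k) l = 0 := by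
    intro k hk
    obtain ⟨i, rfl⟩ := Nat.exists_eq_add_of_lt hk
    rw [show n + i + 1 = i + (n + 1) by ring, pow_add, Module.End.mul_apply, hz, map_zero]
  refine ⟨n, fun k => (F ^ k) l, ?_, by simpa using P.ne_zero, hz', ?_, ?_, ?_, ?_⟩
  · have hli := Module.End.eigenvectors_linearIndependent'
      ((2 * Complex.I) • precomp (j ![0, 0, 1])) (fun k : Fin (n + 1) => (n : ℂ) - 2 * (k : ℕ))
      (fun a b hab => by
        apply Fin.ext
        simpa using hab)
      (fun k => (F ^ (k : ℕ)) l)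
      (fun k => ⟨by
        rw [Module.End.mem_eigenspace_iff]
        exact hH k, hne k (by omega)⟩)
    have := hli.fintype_card_le_finrank
    rw [Fintype.card_fin, hrank] at this
    omega
  · intro k v
    beta_reduce
    rw [pow_succ']
    rfl
  · intro k v
    exact congrArg (fun f => f v) (hH k)
  · intro v
    exact congrArg (fun f => f v) P.lie_e
  · intro k v
    exact congrArg (fun f => f v) (hE k)

theorem exists_equiv_realForms [FiniteDimensional ℝ U] (hU : finrank ℝ U = 7)
    (hj : ∀ ξ η, j (crossProduct ξ η) = j ξ * j η - j η * j ξ)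
    (hirr : ∀ S : Submodule ℝ U, (∀ ξ, ∀ v ∈ S, j ξ v ∈ S) → S = ⊥ ∨ S = ⊤) :
    ∃ Φ : U ≃ₗ[ℝ] realForms 6, ∀ ξ v, (Φ (j ξ v) : ℂ[X]) = rotForm 6 ξ (Φ v) := by
  obtain ⟨n, l, hn, hl0, hz, hF, hH, hE0, hE⟩ := exists_weight_sequence (by omega) hj hirr
  -- the generating polynomial of the weight sequence
  let Ψ : U →ₗ[ℝ] ℂ[X] :=
    { toFun := fun v => ∑ k ∈ Finset.range (n + 1), C (l k v / k.factorial) * X ^ k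
      map_add' := fun v w => by
        simp only [map_add, add_div, add_mul, Finset.sum_add_distrib]
      map_smul' := fun c v => by
        simp only [map_smul, RingHom.id_apply, Finset.smul_sum]
        refine Finset.sum_congr rfl fun k _ => ?_
        ext i
        simp only [coeff_C_mul, coeff_smul, Complex.real_smul]
        ring }
  have hcoeff : ∀ v k, (Ψ v).coeff k = l k v / k.factorial := by
    intro v k
    change (∑ k ∈ Finset.range (n + 1), C (l k v / k.factorial) * X ^ k).coeff k = _
    rw [finsetSum_coeff]
    simp only [coeff_C_mul, coeff_X_pow, mul_ite, mul_one, mul_zero, Finset.sum_ite_eq,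
      Finset.mem_range]
    split_ifs with h
    · rfl
    · simp [hz k (by omega)]
  have hdeg : ∀ v, (Ψ v).natDegree ≤ n := fun v =>
    natDegree_le_iff_coeff_eq_zero.2 fun k hk => by simp [hcoeff, hz k hk]
  have h1 : ∀ k v, 2 * l k (j ![1, 0, 0] v) = l (k + 1) v -
      (Complex.I * l k (j ![0, 1, 0] v) - l k (j ![1, 0, 0] v)) := by
    intro k v
    rw [← hF]
    ring
  have h2 : ∀ k v, 2 * Complex.I * l k (j ![0, 1, 0] v) = l (k + 1) v +
      (Complex.I * l k (j ![0, 1, 0] v) - l k (j ![1, 0, 0] v)) := by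
    intro k v
    rw [← hF]
    ring
  have hξ : ∀ ξ : Fin 3 → ℝ, ∀ k v, l k (j ξ v) = ξ 0 * l k (j ![1, 0, 0] v) +
      ξ 1 * l k (j ![0, 1, 0] v) + ξ 2 * l k (j ![0, 0, 1] v) := by
    intro ξ k v
    rw [map_eq_sum_basis]
    simp
  -- With the divisors `k!`, the raising and lowering rules for `l` become the three-term recursion
  -- for the coefficients of `rotForm`.
  have hint : ∀ ξ v, Ψ (j ξ v) = rotForm n ξ (Ψ v) := by
    intro ξ v
    ext k
    rcases k with _ | k
    · rw [coeff_rotForm_zero, hcoeff, hcoeff, hcoeff, hξ]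
      have e1 := h1 0 v
      have e2 := h2 0 v
      have e3 := hH 0 v
      rw [hE0] at e1 e2
      simp only [Nat.factorial, Nat.cast_one, div_one]
      push_cast at e3
      linear_combination (ξ 0 / 2 : ℂ) * e1 - (Complex.I / 2) * ξ 1 * e2 -
        (Complex.I / 2) * ξ 2 * e3 +
        (ξ 1 * l 0 (j ![0, 1, 0] v) + ξ 2 * l 0 (j ![0, 0, 1] v)) * Complex.I_sq
    · rw [coeff_rotForm_succ, hcoeff, hcoeff, hcoeff, hcoeff, hξ]
      have e1 := h1 (k + 1) v
      have e2 := h2 (k + 1) v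
      have e3 := hH (k + 1) v
      rw [hE] at e1 e2
      have f0 : (k.factorial : ℂ) ≠ 0 := by exact_mod_cast k.factorial_ne_zero
      have f1 : ((k : ℂ) + 1) ≠ 0 := by exact_mod_cast k.succ_ne_zero
      have f2 : ((k : ℂ) + 2) ≠ 0 := by exact_mod_cast (k + 1).succ_ne_zero
      push_cast at e3
      have e4 : ξ 0 * l (k + 1) (j ![1, 0, 0] v) + ξ 1 * l (k + 1) (j ![0, 1, 0] v) +
          ξ 2 * l (k + 1) (j ![0, 0, 1] v) =
          1 / 2 * (ξ 0 - Complex.I * ξ 1) * l (k + 2) v +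
          Complex.I * ξ 2 * ((k + 1) - n / 2) * l (k + 1) v +
          1 / 2 * (ξ 0 + Complex.I * ξ 1) * (k + 1) * (k - n) * l k v := by
        linear_combination (ξ 0 / 2 : ℂ) * e1 - (Complex.I / 2) * ξ 1 * e2 -
          (Complex.I / 2) * ξ 2 * e3 +
          (ξ 1 * l (k + 1) (j ![0, 1, 0] v) + ξ 2 * l (k + 1) (j ![0, 0, 1] v)) * Complex.I_sq
      rw [e4]
      push_cast [Nat.factorial_succ]
      have f3 : ((k : ℂ) + 1 + 1) ≠ 0 := by convert f2 using 1; ring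
      field_simp
      ring
  have hker : LinearMap.ker Ψ = ⊥ := by
    refine (hirr (LinearMap.ker Ψ) fun ξ v hv => ?_).resolve_right fun h => hl0 ?_
    · rw [LinearMap.mem_ker] at hv ⊢
      rw [hint, hv]
      simp [rotForm]
    · ext v
      have : v ∈ LinearMap.ker Ψ := h ▸ Submodule.mem_top
      have h0 := hcoeff v 0
      rw [LinearMap.mem_ker.1 this] at h0
      simpa using h0.symm
  have hinj : Function.Injective Ψ := LinearMap.ker_eq_bot.1 hker
  -- If `l k v ≠ 0`, then `2 i t = n - 2 k` with `t` real, so `n = 2 k`. Thus `n` is even and `Ψ v`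
  -- is a multiple of the middle monomial.
  obtain ⟨t, v, hv, hvt⟩ := exists_eigenvector_of_odd (by rw [hU]; decide) (j ![0, 0, 1])
  have hv' : ∀ k, l k v ≠ 0 → n = 2 * k := by
    intro k hk
    have := hH k v
    rw [hvt, map_smul, Complex.real_smul, ← mul_assoc, mul_left_inj' hk] at this
    have := congrArg Complex.re this
    simp at this
    exact_mod_cast (sub_eq_zero.1 this.symm)
  obtain ⟨m, hm⟩ : ∃ m, l m v ≠ 0 := by
    by_contra! h
    refine hv (hinj ?_)
    ext k
    simp [hcoeff, h]
  have hnm := hv' m hm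
  have hΨv : Ψ v = C ((Ψ v).coeff m) * X ^ m := by
    ext k
    rw [coeff_C_mul_X_pow]
    split_ifs with h
    · rw [h]
    · rw [hcoeff]
      by_contra h'
      have := hv' k (fun h0 => h' (by simp [h0]))
      omega
  obtain ⟨c, hc, hcm⟩ := exists_smul_X_pow_mem_quadPow m
  have ha : (Ψ v).coeff m ≠ 0 := fun h => hv (hinj (by rw [hΨv, h]; simp))
  set a := (Ψ v).coeff m
  -- The intertwiner is free up to a complex scalar. This choice puts the image of `v` in the
  -- invariant real subspace `quadPow m`, and irreducibility puts all of `U` there.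
  let Ψ' : U →ₗ[ℝ] ℂ[X] := ((LinearMap.lsmul ℂ ℂ[X] (c / a)).restrictScalars ℝ).comp Ψ
  have hΨ' : ∀ v, Ψ' v = (c / a) • Ψ v := fun v => rfl
  have hint' : ∀ ξ v, Ψ' (j ξ v) = rotForm n ξ (Ψ' v) := by
    intro ξ v
    rw [hΨ', hΨ', hint, rotForm_smul]
  have hinj' : Function.Injective Ψ' := by
    intro x y hxy
    rw [hΨ', hΨ'] at hxy
    exact hinj (smul_right_injective _ (div_ne_zero hc ha) hxy)
  have hmem : ∀ w, Ψ' w ∈ quadPow m := by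
    have := (hirr ((quadPow m).comap Ψ') fun ξ w hw => ?_).resolve_left fun h => ?_
    · intro w
      have hw : w ∈ (quadPow m).comap Ψ' := this ▸ Submodule.mem_top
      exact hw
    · rw [Submodule.mem_comap] at hw ⊢
      rw [hint', hnm]
      exact rotForm_mem_quadPow m ξ hw
    · have hv2 : v ∈ (quadPow m).comap Ψ' := by
        rw [Submodule.mem_comap, hΨ', hΨv, smul_eq_C_mul, ← mul_assoc, ← C_mul,
          div_mul_cancel₀ _ ha]
        exact hcm
      rw [h] at hv2
      exact hv hv2
  have hmem' : ∀ w, Ψ' w ∈ realForms n := fun w => hnm ▸ quadPow_le_realForms m (hmem w)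
  obtain ⟨hfin, hle'⟩ := finrank_realForms_le n
  let Φ : U →ₗ[ℝ] realForms n := LinearMap.codRestrict _ Ψ' hmem'
  have hΦ : Function.Injective Φ := fun x y hxy => hinj' (congrArg Subtype.val hxy)
  have hle := LinearMap.finrank_le_finrank_of_injective hΦ
  -- Here `n < 7` comes from the weights, and `7 ≤ n + 1` from the injection into `realForms n`.
  obtain rfl : n = 6 := by omega
  have heq : finrank ℝ U = finrank ℝ (realForms 6) := by omega
  refine ⟨LinearEquiv.ofInjectiveOfFinrankEq Φ hΦ heq, fun ξ w => hint' ξ w⟩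

end Irreducible

end BinarySextic

/-! ### Factorisation of real forms into quadratic forms, and its uniqueness. -/

namespace BinarySextic

open Polynomial Module

lemma quad_injective : Function.Injective quad := by
  rw [← LinearMap.ker_eq_bot, LinearMap.ker_eq_bot']
  intro u hu
  obtain ⟨h0, h1, h2⟩ := coeff_quad u
  rw [hu, coeff_zero] at h0 h1 h2
  have e0 : (u 0 : ℂ) = 0 := by linear_combination -(h0 + h2) / 2
  have e1 : Complex.I * (u 1 : ℂ) = 0 := by linear_combination (h0 - h2) / 2
  have e2 : (u 2 : ℂ) = 0 := by simpa using h1.symm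
  ext i
  fin_cases i
  · simpa using e0
  · simpa using e1
  · simpa using e2

lemma quad_ne_zero {u : Fin 3 → ℝ} (hu : u ≠ 0) : quad u ≠ 0 := fun h =>
  hu (quad_injective (by rw [h, map_zero]))

/-- The vector of `ℝ³` whose quadratic form has the root `z`. -/
noncomputable def rootVec (z : ℂ) : Fin 3 → ℝ := ![z.im, z.re, (1 - Complex.normSq z) / 2]

lemma quad_rootVec (z : ℂ) :
    quad (rootVec z) = C Complex.I * ((X - C z) * (C 1 + C ((starRingEnd ℂ) z) * X)) := by
  have h : (C Complex.I * ((X - C z) * (C 1 + C ((starRingEnd ℂ) z) * X)) : ℂ[X]) =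
      C (-(Complex.I * z)) + C (Complex.I * (1 - z * (starRingEnd ℂ) z)) * X +
        C (Complex.I * (starRingEnd ℂ) z) * X ^ 2 := by
    simp only [map_mul, map_sub, map_neg, map_one]
    ring
  rw [h, quad_apply, Complex.mul_conj]
  congr 2
  · congr 1
    apply Complex.ext <;> simp [rootVec]
  · congr 2
    simp only [rootVec, Matrix.cons_val]
    push_cast
    ring
  · congr 1
    apply Complex.ext <;> simp [rootVec]

/-- Applying the antipode to `X - z ∣ p` gives `1 + z̄ X ∣ p`. The two factors are coprime because
`1 + |z|² ≠ 0`, and their product is `quad (rootVec z)` up to the factor `i`. -/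
lemma exists_eq_quad_rootVec_mul {m : ℕ} {p : ℂ[X]} (hp : p ∈ realForms (2 + 2 * m)) {z : ℂ}
    (hz : p.IsRoot z) : ∃ q ∈ realForms (2 * m), p = quad (rootVec z) * q := by
  rcases eq_or_ne p 0 with rfl | hp0
  · exact ⟨0, zero_mem _, by simp⟩
  have hd1 : X - C z ∣ p := dvd_iff_isRoot.2 hz
  have hd2 : C 1 + C ((starRingEnd ℂ) z) * X ∣ p := by
    obtain ⟨r, hr⟩ := hd1
    have hr0 : r ≠ 0 := by
      rintro rfl
      exact hp0 (by simpa using hr)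
    have hrd : r.natDegree ≤ 2 * m + 1 := by
      have h1 := hp.1
      rw [hr, natDegree_mul (X_sub_C_ne_zero z) hr0, natDegree_X_sub_C] at h1
      omega
    have h1 : antipode 1 (X - C z) = C 1 + C ((starRingEnd ℂ) z) * X := by
      have hle : (antipode 1 (X - C z)).natDegree ≤ 1 := natDegree_antipode_le 1 (by simp)
      rw [eq_X_add_C_of_natDegree_le_one hle, coeff_antipode le_rfl, coeff_antipode zero_le_one]
      simp [coeff_X, coeff_C, add_comm]
    refine ⟨antipode (2 * m + 1) r, ?_⟩
    rw [← h1, ← antipode_mul (by simp) hrd, ← hr, show 1 + (2 * m + 1) = 2 + 2 * m by ring, hp.2]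
  have hcop : IsCoprime (X - C z) (C 1 + C ((starRingEnd ℂ) z) * X) := by
    have hne : (1 : ℂ) + z * (starRingEnd ℂ) z ≠ 0 := by
      rw [Complex.mul_conj]
      have := Complex.normSq_nonneg z
      exact_mod_cast (by positivity : (1 : ℝ) + Complex.normSq z ≠ 0)
    refine ⟨-C ((1 + z * (starRingEnd ℂ) z)⁻¹ * (starRingEnd ℂ) z),
      C ((1 + z * (starRingEnd ℂ) z)⁻¹), ?_⟩
    have : (C ((1 + z * (starRingEnd ℂ) z)⁻¹) * C (1 + z * (starRingEnd ℂ) z) : ℂ[X]) = 1 := by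
      rw [← C_mul, inv_mul_cancel₀ hne, C_1]
    rw [← this]
    simp only [map_mul, map_add]
    ring
  obtain ⟨s, hs⟩ := hcop.mul_dvd hd1 hd2
  have hpq : p = quad (rootVec z) * (C (-Complex.I) * s) := by
    have hI : (C Complex.I * C (-Complex.I) : ℂ[X]) = 1 := by
      rw [← C_mul]; simp
    rw [quad_rootVec]
    linear_combination hs - (X - C z) * (C 1 + C ((starRingEnd ℂ) z) * X) * s * hI
  set q := C (-Complex.I) * s
  have hq0 : q ≠ 0 := by
    intro h
    rw [h, mul_zero] at hpq
    exact hp0 hpq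
  have hu0 : quad (rootVec z) ≠ 0 := by
    intro h
    rw [h, zero_mul] at hpq
    exact hp0 hpq
  have hdeg := congrArg natDegree hpq
  rw [natDegree_mul hu0 hq0] at hdeg
  have hq : q.natDegree ≤ 2 * m := by
    have h1 := hp.1
    -- For `z = 0` the antipodal root is at infinity, so the quadratic factor has degree only 1.
    -- Then `p 0 = 0` makes the top coefficient of `p` vanish, which restores the degree bound.
    rcases eq_or_ne z 0 with rfl | hz0
    · have h2 : (quad (rootVec 0)).natDegree = 1 := by
        rw [quad_rootVec]
        simp
      have h3 : p.coeff (2 + 2 * m) = 0 := by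
        rw [coeff_eq_of_mem_realForms hp le_rfl, Nat.sub_self, coeff_zero_eq_eval_zero]
        simp [show eval 0 p = 0 from hz]
      have h4 : p.natDegree ≠ 2 + 2 * m := by
        intro h
        rw [← h, coeff_natDegree, leadingCoeff_eq_zero] at h3
        exact hp0 h3
      omega
    · have h2 : 2 ≤ (quad (rootVec z)).natDegree := by
        refine le_natDegree_of_ne_zero ?_
        have h3 := (coeff_quad (rootVec z)).2.2
        rw [h3]
        intro h4
        apply hz0
        have h5 := congrArg Complex.re h4
        have h6 := congrArg Complex.im h4
        simp [rootVec] at h5 h6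
        exact Complex.ext h6 h5
      omega
  refine ⟨q, ⟨hq, ?_⟩, hpq⟩
  have h1 := hp.2
  rw [hpq, antipode_mul (natDegree_quad_le _) hq, (quad_mem_realForms _).2] at h1
  exact mul_left_cancel₀ hu0 h1

lemma exists_isRoot_of_mem_realForms {n : ℕ} {p : ℂ[X]} (hp : p ∈ realForms (n + 1))
    (hp0 : p ≠ 0) : ∃ z, p.IsRoot z := by
  refine IsAlgClosed.exists_root p fun h => ?_
  have hd : p.natDegree = 0 := natDegree_eq_of_degree_eq_some h
  have h0 : p.coeff 0 = 0 := by
    rw [coeff_eq_of_mem_realForms hp (Nat.zero_le _), Nat.sub_zero,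
      coeff_eq_zero_of_natDegree_lt (by omega)]
    simp
  rw [eq_C_of_natDegree_eq_zero hd, h0, C_0] at hp0
  exact hp0 rfl

lemma exists_real_of_mem_realForms_zero {p : ℂ[X]} (hp : p ∈ realForms 0) :
    ∃ c : ℝ, p = C (c : ℂ) := by
  have h1 := coeff_eq_of_mem_realForms hp le_rfl
  simp only [pow_zero, one_mul, Nat.sub_zero] at h1
  obtain ⟨c, hc⟩ := Complex.conj_eq_iff_real.1 h1.symm
  exact ⟨c, by rw [← hc]; exact eq_C_of_natDegree_le_zero hp.1⟩

lemma C_ofReal_mul_quad (c : ℝ) (u : Fin 3 → ℝ) : C (c : ℂ) * quad u = quad (c • u) := by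
  rw [map_smul, ← smul_eq_C_mul]
  ext k
  simp

lemma eq_smul_rootVec {u : Fin 3 → ℝ} {z : ℂ} (hz : (quad u).IsRoot z) :
    ∃ c : ℝ, u = c • rootVec z := by
  obtain ⟨q, hq, h⟩ := exists_eq_quad_rootVec_mul (m := 0) (quad_mem_realForms u) hz
  obtain ⟨c, rfl⟩ := exists_real_of_mem_realForms_zero hq
  refine ⟨c, quad_injective ?_⟩
  rw [h, mul_comm, C_ofReal_mul_quad]

lemma exists_eq_smul_of_isRoot {u v : Fin 3 → ℝ} (hu : u ≠ 0) {z : ℂ} (hz : (quad u).IsRoot z)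
    (hz' : (quad v).IsRoot z) : ∃ c : ℝ, v = c • u := by
  obtain ⟨a, rfl⟩ := eq_smul_rootVec hz
  obtain ⟨b, rfl⟩ := eq_smul_rootVec hz'
  have ha : a ≠ 0 := by
    rintro rfl
    simp at hu
  exact ⟨b / a, by rw [smul_smul, div_mul_cancel₀ _ ha]⟩

lemma exists_eq_quad_mul {m : ℕ} {p : ℂ[X]} (hp : p ∈ realForms (2 + 2 * m)) (hp0 : p ≠ 0) :
    ∃ (u : Fin 3 → ℝ) (q : ℂ[X]), u ≠ 0 ∧ q ≠ 0 ∧ q ∈ realForms (2 * m) ∧ p = quad u * q := by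
  obtain ⟨z, hz⟩ := exists_isRoot_of_mem_realForms (n := 1 + 2 * m)
    (by rwa [show 1 + 2 * m + 1 = 2 + 2 * m by ring]) hp0
  obtain ⟨q, hq, h⟩ := exists_eq_quad_rootVec_mul hp hz
  refine ⟨rootVec z, q, ?_, ?_, hq, h⟩
  · intro h0
    rw [h0, map_zero, zero_mul] at h
    exact hp0 h
  · rintro rfl
    rw [mul_zero] at h
    exact hp0 h

/-- Every real sextic form is a product of three quadratic forms of equal norm. -/
theorem exists_eq_quad_mul_quad_mul_quad {p : ℂ[X]} (hp : p ∈ realForms 6) :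
    ∃ x : Fin 3 → Fin 3 → ℝ, dotProduct (x 0) (x 0) = dotProduct (x 1) (x 1) ∧
      dotProduct (x 1) (x 1) = dotProduct (x 2) (x 2) ∧
      p = quad (x 0) * quad (x 1) * quad (x 2) := by
  rcases eq_or_ne p 0 with rfl | hp0
  · exact ⟨0, by simp⟩
  obtain ⟨u, q, hu, hq0, hq, rfl⟩ := exists_eq_quad_mul (m := 2) hp hp0
  obtain ⟨v, r, hv, hr0, hr, rfl⟩ := exists_eq_quad_mul (m := 1) hq hq0
  obtain ⟨w, s, hw, hs0, hs, rfl⟩ := exists_eq_quad_mul (m := 0) hr hr0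
  obtain ⟨c, rfl⟩ := exists_real_of_mem_realForms_zero hs
  have hnorm : ∀ u : Fin 3 → ℝ, u ≠ 0 → ∃ (a : ℝ) (e : Fin 3 → ℝ), u = a • e ∧
      dotProduct e e = 1 := by
    intro u hu
    have hpos : 0 < dotProduct u u := by simpa using Matrix.dotProduct_star_self_pos_iff.2 hu
    have hs := Real.sq_sqrt hpos.le
    have hs0 : Real.sqrt (dotProduct u u) ≠ 0 := (Real.sqrt_pos.2 hpos).ne'
    refine ⟨Real.sqrt (dotProduct u u), (Real.sqrt (dotProduct u u))⁻¹ • u, ?_, ?_⟩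
    · rw [smul_smul, mul_inv_cancel₀ hs0, one_smul]
    · rw [smul_dotProduct, dotProduct_smul, smul_eq_mul, smul_eq_mul]
      field_simp
      exact hs.symm
  obtain ⟨a1, e1, rfl, h1⟩ := hnorm u hu
  obtain ⟨a2, e2, rfl, h2⟩ := hnorm v hv
  obtain ⟨a3, e3, rfl, h3⟩ := hnorm w hw
  -- A real cube root spreads the total scalar, including its sign, evenly over three unit vectors.
  obtain ⟨t, ht⟩ : ∃ t : ℝ, t ^ 3 = a1 * a2 * a3 * c := by
    have hroot : ∀ y : ℝ, 0 ≤ y → ∃ t : ℝ, t ^ 3 = y := fun y hy =>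
      ⟨y ^ ((3 : ℕ) : ℝ)⁻¹, Real.rpow_inv_natCast_pow hy (by norm_num)⟩
    rcases le_total 0 (a1 * a2 * a3 * c) with h | h
    · exact hroot _ h
    · obtain ⟨t, ht⟩ := hroot _ (neg_nonneg.2 h)
      exact ⟨-t, by linear_combination -ht⟩
  refine ⟨![t • e1, t • e2, t • e3], ?_, ?_, ?_⟩
  · simp [h1, h2]
  · simp [h2, h3]
  · simp only [Matrix.cons_val_zero, Matrix.cons_val_one, Matrix.cons_val, ← C_ofReal_mul_quad]
    have : (C (t : ℂ) : ℂ[X]) ^ 3 = C (a1 : ℂ) * C (a2 : ℂ) * C (a3 : ℂ) * C (c : ℂ) := by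
      rw [← C_pow, ← C_mul, ← C_mul, ← C_mul]
      congr 1
      exact_mod_cast ht
    linear_combination -(quad e1 * quad e2 * quad e3) * this

/-- Cancelling gives `w = (a b) w'`. Equality of norms then yields `a² = b²` and `a⁶ = 1`, so only
signs with product 1 remain. -/
lemma eq_smul_of_quad_mul_eq {u v w w' : Fin 3 → ℝ} {a b : ℝ} (hu : u ≠ 0) (hv : v ≠ 0)
    (hw : w ≠ 0) (h : quad u * quad v * quad w = quad (a • u) * quad (b • v) * quad w')
    (h1 : dotProduct u u = dotProduct v v) (h2 : dotProduct v v = dotProduct w w)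
    (h3 : dotProduct (a • u) (a • u) = dotProduct (b • v) (b • v))
    (h4 : dotProduct (b • v) (b • v) = dotProduct w' w') :
    (a = 1 ∨ a = -1) ∧ (b = 1 ∨ b = -1) ∧ w' = (a * b) • w := by
  have hw' : w = (a * b) • w' := by
    apply quad_injective
    rw [← C_ofReal_mul_quad a, ← C_ofReal_mul_quad b] at h
    rw [← C_ofReal_mul_quad]
    push_cast
    rw [C_mul]
    exact mul_left_cancel₀ (mul_ne_zero (quad_ne_zero hu) (quad_ne_zero hv))
      (by linear_combination h)
  have hpos : 0 < dotProduct w w := by simpa using Matrix.dotProduct_star_self_pos_iff.2 hw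
  have e1 : dotProduct w w = (a * b) ^ 2 * dotProduct w' w' := by
    conv_lhs => rw [hw']
    rw [smul_dotProduct, dotProduct_smul]
    simp only [smul_eq_mul]
    ring
  simp only [smul_dotProduct, dotProduct_smul, smul_eq_mul, h1, h2] at h3 h4
  have hab : a ^ 2 = b ^ 2 := mul_right_cancel₀ hpos.ne' (by linear_combination h3)
  have h5 : (a ^ 2) ^ 3 = 1 := by
    refine mul_right_cancel₀ hpos.ne' ?_
    linear_combination a ^ 2 * (a ^ 2 + b ^ 2) * dotProduct w w * hab - e1 + (a * b) ^ 2 * h4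
  have h6 : a ^ 2 = 1 := by
    rwa [pow_eq_one_iff_of_nonneg (sq_nonneg a) (by norm_num)] at h5
  refine ⟨sq_eq_one_iff.1 h6,
    sq_eq_one_iff.1 (hab ▸ h6), ?_⟩
  conv_rhs => rw [hw', smul_smul]
  rw [show a * b * (a * b) = a ^ 2 * b ^ 2 by ring, ← hab, h6, one_mul, one_smul]

/-- A product of three quadratic forms of equal norm determines the factors up to a permutation
and an even number of sign changes. -/
theorem apply_eq_of_quad_mul_eq {Y : Type*} {f : (Fin 3 → ℝ) → (Fin 3 → ℝ) → (Fin 3 → ℝ) → Y}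
    (f1 : ∀ u v w, f v u w = f u v w) (f2 : ∀ u v w, f u w v = f u v w)
    (f3 : ∀ u v w, f u (-v) (-w) = f u v w) {u v w u' v' w' : Fin 3 → ℝ} (hu : u ≠ 0) (hv : v ≠ 0)
    (hw : w ≠ 0) (h : quad u * quad v * quad w = quad u' * quad v' * quad w')
    (h1 : dotProduct u u = dotProduct v v) (h2 : dotProduct v v = dotProduct w w)
    (h3 : dotProduct u' u' = dotProduct v' v') (h4 : dotProduct v' v' = dotProduct w' w') :
    f u' v' w' = f u v w := by
  have f3' : ∀ u v w, f (-u) v (-w) = f u v w := fun u v w => by rw [f1, f3, f1]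
  have f3'' : ∀ u v w, f (-u) (-v) w = f u v w := fun u v w => by rw [f2, f3', f2]
  have base : ∀ (a b : ℝ) (x : Fin 3 → ℝ),
      (a = 1 ∨ a = -1) ∧ (b = 1 ∨ b = -1) ∧ x = (a * b) • w → f (a • u) (b • v) x = f u v w := by
    rintro a b x ⟨rfl | rfl, rfl | rfl, rfl⟩ <;> simp [f3, f3', f3'']
  have hne := mul_ne_zero (mul_ne_zero (quad_ne_zero hu) (quad_ne_zero hv)) (quad_ne_zero hw)
  obtain ⟨z, hz⟩ := exists_isRoot_of_mem_realForms (quad_mem_realForms u) (quad_ne_zero hu)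
  obtain ⟨y, hy⟩ := exists_isRoot_of_mem_realForms (quad_mem_realForms v) (quad_ne_zero hv)
  have hroot : (quad u').IsRoot z ∨ (quad v').IsRoot z ∨ (quad w').IsRoot z := by
    have : (quad u' * quad v' * quad w').IsRoot z := by
      rw [← h, IsRoot, eval_mul, eval_mul, show eval z (quad u) = 0 from hz]
      simp
    rw [root_mul, root_mul] at this
    tauto
  -- One root determines a real quadratic form up to a real scalar. Matching a root of `quad u`, and
  -- then one of `quad v`, pairs the factors.
  have key : ∀ u' v' w' : Fin 3 → ℝ, (quad u').IsRoot z →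
      quad u * quad v * quad w = quad u' * quad v' * quad w' →
      dotProduct u' u' = dotProduct v' v' → dotProduct v' v' = dotProduct w' w' →
      f u' v' w' = f u v w := by
    intro u' v' w' hz' h h3 h4
    obtain ⟨a, rfl⟩ := exists_eq_smul_of_isRoot hu hz hz'
    have h' : quad v * quad w = C (a : ℂ) * (quad v' * quad w') := by
      rw [← C_ofReal_mul_quad] at h
      exact mul_left_cancel₀ (quad_ne_zero hu) (by linear_combination h)
    have hy' : (C (a : ℂ) * (quad v' * quad w')).IsRoot y := by
      rw [← h', IsRoot, eval_mul, show eval y (quad v) = 0 from hy, zero_mul]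
    have ha : (a : ℂ) ≠ 0 := by
      rintro h0
      rw [h0, C_0, zero_mul] at h'
      exact mul_ne_zero (quad_ne_zero hv) (quad_ne_zero hw) h'
    rw [root_mul, root_mul] at hy'
    rcases hy' with hy' | hy' | hy'
    · simp [ha] at hy'
    · obtain ⟨b, rfl⟩ := exists_eq_smul_of_isRoot hv hy hy'
      exact base a b _ (eq_smul_of_quad_mul_eq hu hv hw h h1 h2 h3 h4)
    · obtain ⟨b, rfl⟩ := exists_eq_smul_of_isRoot hv hy hy'
      rw [f2]
      exact base a b _ (eq_smul_of_quad_mul_eq hu hv hw (by rw [h]; ring) h1 h2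
        (h3.trans h4) h4.symm)
  rcases hroot with hz' | hz' | hz'
  · exact key u' v' w' hz' h h3 h4
  · rw [f1]
    exact key v' u' w' hz' (by rw [h]; ring) h3.symm (h3.trans h4)
  · rw [f2, f1]
    exact key w' u' v' hz' (by rw [h]; ring) (h3.trans h4).symm h3

end BinarySextic

/-! ### The Weyl chamber of type `D₃` and its wall coordinates. -/

namespace BinarySextic

open Polynomial Module

section Chamber

/-- The three wall coordinates of the point of the closed Weyl chamber `α ≥ β ≥ |γ|` equivalent
to `(a, b, c)` under permutations and even sign changes. -/
noncomputable def wall (a b c : ℝ) : ℝ × ℝ × ℝ :=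
  let hi := max (max |a| |b|) |c|
  let lo := min (min |a| |b|) |c|
  let mid := |a| + |b| + |c| - hi - lo
  let ga := SignType.sign (a * b * c) * lo
  (hi - mid, mid - ga, mid + ga)

lemma wall_swap₁ (a b c : ℝ) : wall b a c = wall a b c := by
  simp only [wall, max_comm |b|, min_comm |b|, mul_comm b, add_comm |b|]

lemma wall_swap₂ (a b c : ℝ) : wall a c b = wall a b c := by
  simp only [wall, max_right_comm |a| |c|, min_right_comm |a| |c|, mul_right_comm a c,
    add_right_comm |a| |c|]

lemma wall_neg (a b c : ℝ) : wall a (-b) (-c) = wall a b c := by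
  simp only [wall, abs_neg, mul_neg, neg_mul, neg_neg]

lemma wall_of_sorted {a b c : ℝ} (hab : b ≤ a) (hbc : |c| ≤ b) :
    wall a b c = (a - b, b - c, b + c) := by
  have hb : 0 ≤ b := (abs_nonneg c).trans hbc
  have ha : 0 ≤ a := hb.trans hab
  have hs : (SignType.sign (a * b * c) : ℝ) * |c| = c := by
    rcases eq_or_lt_of_le hb with h | h
    · have : c = 0 := by rw [← h] at hbc; exact abs_nonpos_iff.1 hbc
      simp [this]
    · rw [sign_mul, sign_pos (mul_pos (h.trans_le hab) h), one_mul, sign_mul_abs]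
  simp only [wall, abs_of_nonneg ha, abs_of_nonneg hb, max_eq_left hab, min_eq_right hab,
    max_eq_left (hbc.trans hab), min_eq_right hbc, hs]
  ext <;> simp <;> ring

/-- Sorting by absolute value and moving signs in pairs onto the last entry brings any triple into
the chamber. Statements stable under the moves need checking only there. -/
lemma sorted_induction {S : ℝ → ℝ → ℝ → Prop} (h₁ : ∀ a b c, S a b c → S b a c)
    (h₂ : ∀ a b c, S a b c → S a c b) (h₃ : ∀ a b c, S a b c → S a (-b) (-c))
    (h : ∀ a b c, b ≤ a → |c| ≤ b → S a b c) (a b c : ℝ) : S a b c := by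
  have h₃' : ∀ a b c, S a b c → S (-a) b (-c) := fun a b c hs => h₁ _ _ _ (h₃ _ _ _ (h₁ _ _ _ hs))
  have e1 : ∀ a b c, |b| ≤ |a| → |c| ≤ |b| → S a b c := by
    intro a b c hab hbc
    rcases abs_cases a with ⟨ha, ha'⟩ | ⟨ha, ha'⟩ <;> rcases abs_cases b with ⟨hb, hb'⟩ | ⟨hb, hb'⟩ <;>
      rw [ha, hb] at hab <;> rw [hb] at hbc
    · exact h a b c hab hbc
    · have := h₃ _ _ _ (h a (-b) (-c) hab (by rwa [abs_neg]))
      rwa [neg_neg, neg_neg] at this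
    · have := h₃' _ _ _ (h (-a) b (-c) hab (by rwa [abs_neg]))
      rwa [neg_neg, neg_neg] at this
    · have := h₃' _ _ _ (h₃ _ _ _ (h (-a) (-b) c hab hbc))
      rwa [neg_neg, neg_neg, neg_neg] at this
  have e2 : ∀ a b c, |b| ≤ |a| → S a b c := by
    intro a b c hab
    rcases le_total |c| |b| with hbc | hbc
    · exact e1 a b c hab hbc
    · rcases le_total |c| |a| with hac | hac
      · exact h₂ _ _ _ (e1 a c b hac hbc)
      · exact h₂ _ _ _ (h₁ _ _ _ (e1 c a b hac hab))
  rcases le_total |b| |a| with hab | hab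
  · exact e2 a b c hab
  · exact h₁ _ _ _ (e2 b a c hab)

lemma wall_nonneg (a b c : ℝ) : 0 ≤ (wall a b c).1 ∧ 0 ≤ (wall a b c).2.1 ∧
    0 ≤ (wall a b c).2.2 := by
  refine sorted_induction (S := fun a b c => 0 ≤ (wall a b c).1 ∧ 0 ≤ (wall a b c).2.1 ∧
    0 ≤ (wall a b c).2.2) ?_ ?_ ?_ ?_ a b c
  · intro a b c h; rwa [wall_swap₁]
  · intro a b c h; rwa [wall_swap₂]
  · intro a b c h; rwa [wall_neg]
  · intro a b c h h'
    rw [wall_of_sorted h h']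
    have := abs_le.1 h'
    exact ⟨by simpa using h, by simpa using this.2, by simpa using (by linarith [this.1] : 0 ≤ b + c)⟩

/-- The alternating polynomial vanishing on the walls. -/
def wallPoly (a b c : ℝ) : ℝ := (a ^ 2 - b ^ 2) * (b ^ 2 - c ^ 2) * (a ^ 2 - c ^ 2)

/-- On the chamber, vanishing of `a + b`, `a - c` or `a + c` forces `a = b`, so these factors add no
new zeros. -/
lemma wall_eq_zero_of_wallPoly (a b c : ℝ) (h0 : wallPoly a b c = 0) :
    (wall a b c).1 = 0 ∨ (wall a b c).2.1 = 0 ∨ (wall a b c).2.2 = 0 := by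
  revert h0
  refine sorted_induction (S := fun a b c => wallPoly a b c = 0 → (wall a b c).1 = 0 ∨
    (wall a b c).2.1 = 0 ∨ (wall a b c).2.2 = 0) ?_ ?_ ?_ ?_ a b c
  · intro a b c h h0
    rw [wall_swap₁]
    exact h (by rw [wallPoly] at h0 ⊢; linear_combination -h0)
  · intro a b c h h0
    rw [wall_swap₂]
    exact h (by rw [wallPoly] at h0 ⊢; linear_combination -h0)
  · intro a b c h h0
    rw [wall_neg]
    exact h (by rw [wallPoly] at h0 ⊢; linear_combination h0)
  · intro a b c h h' h0
    rw [wall_of_sorted h h']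
    have hbc := abs_le.1 h'
    simp only
    have : (a - b) * (b - c) * (b + c) * ((a + b) * ((a - c) * (a + c))) = 0 := by
      rw [← h0, wallPoly]; ring
    rcases mul_eq_zero.1 this with h1 | h1
    · simp only [mul_eq_zero] at h1
      tauto
    · simp only [mul_eq_zero] at h1
      rcases h1 with h1 | h1 | h1
      · left; linarith [hbc.1, hbc.2]
      · left; linarith [hbc.1, hbc.2]
      · left; linarith [hbc.1, hbc.2]

/-- On the chamber the three coordinates add up to `a + b`. The bound feeds the properness of
`unfold`. -/
lemma abs_le_wall (a b c : ℝ) : |a| ≤ (wall a b c).1 + (wall a b c).2.1 + (wall a b c).2.2 ∧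
    |b| ≤ (wall a b c).1 + (wall a b c).2.1 + (wall a b c).2.2 ∧
    |c| ≤ (wall a b c).1 + (wall a b c).2.1 + (wall a b c).2.2 := by
  refine sorted_induction (S := fun a b c =>
    |a| ≤ (wall a b c).1 + (wall a b c).2.1 + (wall a b c).2.2 ∧
    |b| ≤ (wall a b c).1 + (wall a b c).2.1 + (wall a b c).2.2 ∧
    |c| ≤ (wall a b c).1 + (wall a b c).2.1 + (wall a b c).2.2) ?_ ?_ ?_ ?_ a b c
  · intro a b c h; rw [wall_swap₁]; tauto
  · intro a b c h; rw [wall_swap₂]; tauto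
  · intro a b c h; rw [wall_neg, abs_neg, abs_neg]; tauto
  · intro a b c h h'
    rw [wall_of_sorted h h']
    have hbc := abs_le.1 h'
    have hb : 0 ≤ b := (abs_nonneg c).trans h'
    rw [abs_of_nonneg hb, abs_of_nonneg (hb.trans h)]
    simp only
    refine ⟨by linarith, by linarith, by linarith⟩

/-- The sign is locally constant off the zeros of `f`, and at those zeros `g` tends to 0. -/
lemma continuous_sign_mul {Z : Type*} [TopologicalSpace Z] {f g : Z → ℝ} (hf : Continuous f)
    (hg : Continuous g) (h : ∀ z, f z = 0 → g z = 0) :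
    Continuous fun z => (SignType.sign (f z) : ℝ) * g z := by
  rw [continuous_iff_continuousAt]
  intro z
  rcases eq_or_ne (f z) 0 with hz | hz
  · have h1 : Filter.Tendsto g (nhds z) (nhds 0) := by
      have := hg.tendsto z
      rwa [h z hz] at this
    rw [ContinuousAt, h z hz, mul_zero]
    refine squeeze_zero_norm (fun x => ?_) (by simpa using h1.norm)
    rw [norm_mul]
    refine mul_le_of_le_one_left (norm_nonneg _) ?_
    rcases lt_trichotomy (f x) 0 with h | h | h <;> simp [h]
  · have h1 : ∀ᶠ x in nhds z, SignType.sign (f x) = SignType.sign (f z) := by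
      rcases lt_or_gt_of_ne hz with h | h
      · filter_upwards [hf.continuousAt.eventually (gt_mem_nhds h)] with x hx
        rw [sign_neg hx, sign_neg h]
      · filter_upwards [hf.continuousAt.eventually (lt_mem_nhds h)] with x hx
        rw [sign_pos hx, sign_pos h]
    have h2 : ContinuousAt (fun x => (SignType.sign (f z) : ℝ) * g x) z :=
      (continuous_const.mul hg).continuousAt
    refine h2.congr ?_
    filter_upwards [h1] with x hx
    rw [hx]

lemma continuous_wall : Continuous fun p : ℝ × ℝ × ℝ => wall p.1 p.2.1 p.2.2 := by
  have h := continuous_sign_mul (Z := ℝ × ℝ × ℝ) (f := fun p => p.1 * p.2.1 * p.2.2)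
    (g := fun p => min (min |p.1| |p.2.1|) |p.2.2|) (by fun_prop) (by fun_prop) (by
      intro p hp
      rcases mul_eq_zero.1 hp with hp | hp
      · rcases mul_eq_zero.1 hp with hp | hp <;> simp [hp]
      · simp [hp])
  unfold wall
  refine Continuous.prodMk ?_ (Continuous.prodMk ?_ ?_)
  · fun_prop
  · exact Continuous.sub (by fun_prop) h
  · exact Continuous.add (by fun_prop) h

end Chamber

end BinarySextic

/-! ### The invariant map from triples of vectors to `ℝ⁴`. -/

namespace BinarySextic

open Polynomial Module Matrix

/-- The triple product. -/
def triple (u v w : Fin 3 → ℝ) : ℝ := u ⬝ᵥ (v ⨯₃ w)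

lemma triple_swap₁ (u v w : Fin 3 → ℝ) : triple v u w = -triple u v w := by
  simp only [triple, cross_apply, vec3_dotProduct, cons_val_zero, cons_val_one, cons_val]
  ring

lemma triple_swap₂ (u v w : Fin 3 → ℝ) : triple u w v = -triple u v w := by
  simp only [triple, cross_apply, vec3_dotProduct, cons_val_zero, cons_val_one, cons_val]
  ring

lemma triple_neg (u v w : Fin 3 → ℝ) : triple u (-v) (-w) = triple u v w := by
  simp [triple]

lemma triple_sq (u v w : Fin 3 → ℝ) : triple u v w ^ 2 =
    (u ⬝ᵥ u) * (v ⬝ᵥ v) * (w ⬝ᵥ w) + 2 * (v ⬝ᵥ w) * (u ⬝ᵥ w) * (u ⬝ᵥ v) -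
      (u ⬝ᵥ u) * (v ⬝ᵥ w) ^ 2 - (v ⬝ᵥ v) * (u ⬝ᵥ w) ^ 2 - (w ⬝ᵥ w) * (u ⬝ᵥ v) ^ 2 := by
  simp only [triple, cross_apply, vec3_dotProduct, cons_val_zero, cons_val_one, cons_val]
  ring

/-- The wall coordinates of the Gram matrix together with the volume. -/
noncomputable def orthant (u v w : Fin 3 → ℝ) : Fin 4 → ℝ :=
  let y := wall (v ⬝ᵥ w) (u ⬝ᵥ w) (u ⬝ᵥ v)
  ![y.1, y.2.1, y.2.2, |triple u v w|]

/-- The smallest coordinate of a point of the orthant. -/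
noncomputable def lowest (y : Fin 4 → ℝ) : ℝ := min (min (y 0) (y 1)) (min (y 2) (y 3))

/-- The sign telling apart the two sheets of the doubled orthant. -/
noncomputable def sheet (u v w : Fin 3 → ℝ) : ℝ :=
  triple u v w * wallPoly (v ⬝ᵥ w) (u ⬝ᵥ w) (u ⬝ᵥ v)

/-- The doubled orthant unfolded onto `ℝ⁴`. -/
noncomputable def unfold (u v w : Fin 3 → ℝ) : Fin 4 → ℝ :=
  ![orthant u v w 0 - orthant u v w 3, orthant u v w 1 - orthant u v w 3,
    orthant u v w 2 - orthant u v w 3,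
    SignType.sign (sheet u v w) * lowest (orthant u v w)]

lemma orthant_swap₁ (u v w : Fin 3 → ℝ) : orthant v u w = orthant u v w := by
  simp only [orthant, triple_swap₁ u, abs_neg, dotProduct_comm v u, wall_swap₁ (v ⬝ᵥ w)]

lemma orthant_swap₂ (u v w : Fin 3 → ℝ) : orthant u w v = orthant u v w := by
  simp only [orthant, triple_swap₂ u v, abs_neg, dotProduct_comm w v, wall_swap₂ _ (u ⬝ᵥ w)]

lemma orthant_neg (u v w : Fin 3 → ℝ) : orthant u (-v) (-w) = orthant u v w := by
  simp only [orthant, triple_neg, neg_dotProduct, dotProduct_neg, neg_neg, wall_neg]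

lemma sheet_swap₁ (u v w : Fin 3 → ℝ) : sheet v u w = sheet u v w := by
  simp only [sheet, triple_swap₁ u, dotProduct_comm v u, wallPoly]
  ring

lemma sheet_swap₂ (u v w : Fin 3 → ℝ) : sheet u w v = sheet u v w := by
  simp only [sheet, triple_swap₂ u v, dotProduct_comm w v, wallPoly]
  ring

lemma sheet_neg (u v w : Fin 3 → ℝ) : sheet u (-v) (-w) = sheet u v w := by
  simp only [sheet, triple_neg, neg_dotProduct, dotProduct_neg, neg_neg, wallPoly]
  ring

lemma unfold_swap₁ (u v w : Fin 3 → ℝ) : unfold v u w = unfold u v w := by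
  simp only [unfold, orthant_swap₁ u, sheet_swap₁ u]

lemma unfold_swap₂ (u v w : Fin 3 → ℝ) : unfold u w v = unfold u v w := by
  simp only [unfold, orthant_swap₂ u v, sheet_swap₂ u v]

lemma unfold_neg (u v w : Fin 3 → ℝ) : unfold u (-v) (-w) = unfold u v w := by
  simp only [unfold, orthant_neg, sheet_neg]

lemma orthant_nonneg (u v w : Fin 3 → ℝ) (i : Fin 4) : 0 ≤ orthant u v w i := by
  obtain ⟨h0, h1, h2⟩ := wall_nonneg (v ⬝ᵥ w) (u ⬝ᵥ w) (u ⬝ᵥ v)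
  fin_cases i
  · exact h0
  · exact h1
  · exact h2
  · exact abs_nonneg _

lemma lowest_nonneg (u v w : Fin 3 → ℝ) : 0 ≤ lowest (orthant u v w) :=
  le_min (le_min (orthant_nonneg u v w 0) (orthant_nonneg u v w 1))
    (le_min (orthant_nonneg u v w 2) (orthant_nonneg u v w 3))

/-- The sign of `sheet` is undetermined only on the boundary of the orthant, where the two sheets
are glued. -/
lemma lowest_eq_zero_of_sheet {u v w : Fin 3 → ℝ} (h : sheet u v w = 0) :
    lowest (orthant u v w) = 0 := by
  refine le_antisymm ?_ (lowest_nonneg u v w)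
  have h0 : lowest (orthant u v w) ≤ orthant u v w 0 := (min_le_left _ _).trans (min_le_left _ _)
  have h1 : lowest (orthant u v w) ≤ orthant u v w 1 := (min_le_left _ _).trans (min_le_right _ _)
  have h2 : lowest (orthant u v w) ≤ orthant u v w 2 := (min_le_right _ _).trans (min_le_left _ _)
  have h3 : lowest (orthant u v w) ≤ orthant u v w 3 := (min_le_right _ _).trans (min_le_right _ _)
  rcases mul_eq_zero.1 h with h | h
  · exact h3.trans_eq (by simp [orthant, h])
  · rcases wall_eq_zero_of_wallPoly _ _ _ h with h | h | h
    · exact h0.trans_eq h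
    · exact h1.trans_eq h
    · exact h2.trans_eq h

lemma abs_unfold_three (u v w : Fin 3 → ℝ) : |unfold u v w 3| = lowest (orthant u v w) := by
  change |(SignType.sign (sheet u v w) : ℝ) * lowest (orthant u v w)| = _
  rw [abs_mul, abs_of_nonneg (lowest_nonneg u v w)]
  rcases lt_trichotomy (sheet u v w) 0 with h | h | h
  · simp [h]
  · simp [lowest_eq_zero_of_sheet h]
  · simp [h]

lemma continuous_unfold :
    Continuous fun x : Fin 3 → Fin 3 → ℝ => unfold (x 0) (x 1) (x 2) := by
  have ht : Continuous fun x : Fin 3 → Fin 3 → ℝ => triple (x 0) (x 1) (x 2) := by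
    simp only [triple, cross_apply, vec3_dotProduct, cons_val_zero, cons_val_one, cons_val]
    fun_prop
  have hg : Continuous fun x : Fin 3 → Fin 3 → ℝ =>
      (x 1 ⬝ᵥ x 2, x 0 ⬝ᵥ x 2, x 0 ⬝ᵥ x 1) := by
    simp only [vec3_dotProduct]
    fun_prop
  have hw := continuous_wall.comp hg
  have ho : Continuous fun x : Fin 3 → Fin 3 → ℝ => orthant (x 0) (x 1) (x 2) := by
    refine continuous_pi fun i => ?_
    fin_cases i
    · exact hw.fst
    · exact hw.snd.fst
    · exact hw.snd.snd
    · exact ht.abs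
  have ho' := fun i => (continuous_apply i).comp ho
  have hs : Continuous fun x : Fin 3 → Fin 3 → ℝ => sheet (x 0) (x 1) (x 2) := by
    simp only [sheet, wallPoly]
    refine ht.mul ?_
    simp only [vec3_dotProduct]
    fun_prop
  refine continuous_pi fun i => ?_
  fin_cases i
  · exact (ho' 0).sub (ho' 3)
  · exact (ho' 1).sub (ho' 3)
  · exact (ho' 2).sub (ho' 3)
  · exact continuous_sign_mul hs (((ho' 0).min (ho' 1)).min ((ho' 2).min (ho' 3)))
      fun x hx => lowest_eq_zero_of_sheet hx

/-- The minimum of `y` is `y 3` plus the minimum of `0` and the differences `y i - y 3`. So the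
differences and the minimum recover `y 3`, hence `y`. -/
lemma orthant_eq_of_unfold_eq {u v w u' v' w' : Fin 3 → ℝ} (h : unfold u v w = unfold u' v' w') :
    orthant u v w = orthant u' v' w' := by
  have e0 : orthant u v w 0 - orthant u v w 3 = orthant u' v' w' 0 - orthant u' v' w' 3 :=
    congrFun h 0
  have e1 : orthant u v w 1 - orthant u v w 3 = orthant u' v' w' 1 - orthant u' v' w' 3 :=
    congrFun h 1
  have e2 : orthant u v w 2 - orthant u v w 3 = orthant u' v' w' 2 - orthant u' v' w' 3 :=
    congrFun h 2
  have e3 : lowest (orthant u v w) = lowest (orthant u' v' w') := by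
    rw [← abs_unfold_three, ← abs_unfold_three, h]
  have hlow : ∀ y : Fin 4 → ℝ, lowest y =
      min (min (y 0 - y 3) (y 1 - y 3)) (min (y 2 - y 3) 0) + y 3 := by
    intro y
    simp only [lowest, ← min_add_add_right, sub_add_cancel, zero_add]
  rw [hlow, hlow (orthant u' v' w'), e0, e1, e2, add_right_inj] at e3
  ext i
  fin_cases i
  · simpa [e3] using e0
  · simpa [e3] using e1
  · simpa [e3] using e2
  · exact e3

/-- The squared volume is `r³ - r (a² + b² + c²) + 2abc` with `r` the common squared norm. By
Cauchy–Schwarz `r` bounds `|a|`, `|b|`, `|c|`, and the cubic is strictly increasing in that range.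
-/
lemma norm_eq_of_triple_sq_eq {u v w u' v' w' : Fin 3 → ℝ} (h1 : u ⬝ᵥ u = v ⬝ᵥ v)
    (h2 : v ⬝ᵥ v = w ⬝ᵥ w) (h1' : u' ⬝ᵥ u' = v' ⬝ᵥ v') (h2' : v' ⬝ᵥ v' = w' ⬝ᵥ w')
    (ha : v ⬝ᵥ w = v' ⬝ᵥ w') (hb : u ⬝ᵥ w = u' ⬝ᵥ w') (hc : u ⬝ᵥ v = u' ⬝ᵥ v')
    (ht : triple u v w ^ 2 = triple u' v' w' ^ 2) : u ⬝ᵥ u = u' ⬝ᵥ u' := by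
  have cs : ∀ u v : Fin 3 → ℝ, (u ⬝ᵥ v) ^ 2 ≤ (u ⬝ᵥ u) * (v ⬝ᵥ v) := by
    intro u v
    simp only [vec3_dotProduct]
    nlinarith [sq_nonneg (u 0 * v 1 - u 1 * v 0), sq_nonneg (u 0 * v 2 - u 2 * v 0),
      sq_nonneg (u 1 * v 2 - u 2 * v 1)]
  have key : ∀ (r s a b c : ℝ), 0 ≤ r → 0 ≤ s → a ^ 2 ≤ r ^ 2 → b ^ 2 ≤ r ^ 2 → c ^ 2 ≤ r ^ 2 →
      r ^ 3 - r * (a ^ 2 + b ^ 2 + c ^ 2) = s ^ 3 - s * (a ^ 2 + b ^ 2 + c ^ 2) → ¬ r < s := by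
    intro r s a b c hr hs ha hb hc h hlt
    have h1 : (s - r) * (s ^ 2 + r * s + r ^ 2 - (a ^ 2 + b ^ 2 + c ^ 2)) = 0 := by
      linear_combination -h
    rcases mul_eq_zero.1 h1 with h2 | h2
    · linarith
    · nlinarith
  have hr : 0 ≤ u ⬝ᵥ u := by simpa using dotProduct_self_star_nonneg u
  have hs : 0 ≤ u' ⬝ᵥ u' := by simpa using dotProduct_self_star_nonneg u'
  rw [triple_sq, triple_sq, ← ha, ← hb, ← hc, ← h2, ← h1, ← h2', ← h1'] at ht
  have c1 := cs u v
  have c2 := cs u w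
  have c3 := cs v w
  have c1' := cs u' v'
  have c2' := cs u' w'
  have c3' := cs v' w'
  rw [← h1] at c1
  rw [← h2, ← h1] at c2 c3
  rw [← h1', ← hc] at c1'
  rw [← h2', ← h1', ← hb] at c2'
  rw [← h2', ← h1', ← ha] at c3'
  rw [← pow_two] at c1 c2 c3 c1' c2' c3'
  refine le_antisymm (not_lt.1 (key _ _ _ _ _ hs hr c3' c2' c1' (by linear_combination -ht)))
    (not_lt.1 (key _ _ _ _ _ hr hs c3 c2 c1 (by linear_combination ht)))

/-- Equivalence under the moves is expressed by the agreement of all invariant functions `f`, so no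
group action has to be set up. -/
lemma exists_sorted (u v w : Fin 3 → ℝ) : ∃ u' v' w' : Fin 3 → ℝ,
    u' ⬝ᵥ w' ≤ v' ⬝ᵥ w' ∧ |u' ⬝ᵥ v'| ≤ u' ⬝ᵥ w' ∧
      ∀ {Y : Type} (f : (Fin 3 → ℝ) → (Fin 3 → ℝ) → (Fin 3 → ℝ) → Y),
        (∀ u v w, f v u w = f u v w) → (∀ u v w, f u w v = f u v w) →
        (∀ u v w, f u (-v) (-w) = f u v w) → f u' v' w' = f u v w := by
  refine sorted_induction (S := fun a b c => ∀ u v w : Fin 3 → ℝ, v ⬝ᵥ w = a → u ⬝ᵥ w = b →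
    u ⬝ᵥ v = c → ∃ u' v' w' : Fin 3 → ℝ, u' ⬝ᵥ w' ≤ v' ⬝ᵥ w' ∧ |u' ⬝ᵥ v'| ≤ u' ⬝ᵥ w' ∧
      ∀ {Y : Type} (f : (Fin 3 → ℝ) → (Fin 3 → ℝ) → (Fin 3 → ℝ) → Y),
        (∀ u v w, f v u w = f u v w) → (∀ u v w, f u w v = f u v w) →
        (∀ u v w, f u (-v) (-w) = f u v w) → f u' v' w' = f u v w) ?_ ?_ ?_ ?_ _ _ _ u v w
        rfl rfl rfl
  · rintro a b c h u v w rfl rfl rfl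
    obtain ⟨u', v', w', h1, h2, h3⟩ := h v u w rfl rfl (dotProduct_comm _ _)
    exact ⟨u', v', w', h1, h2, fun f f1 f2 f3 => (h3 f f1 f2 f3).trans (f1 _ _ _)⟩
  · rintro a b c h u v w rfl rfl rfl
    obtain ⟨u', v', w', h1, h2, h3⟩ := h u w v (dotProduct_comm _ _) rfl rfl
    exact ⟨u', v', w', h1, h2, fun f f1 f2 f3 => (h3 f f1 f2 f3).trans (f2 _ _ _)⟩
  · intro a b c h u v w ha hb hc
    obtain ⟨u', v', w', h1, h2, h3⟩ := h u (-v) (-w) (by simpa using ha) (by simp [hb])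
      (by simp [hc])
    exact ⟨u', v', w', h1, h2, fun f f1 f2 f3 => (h3 f f1 f2 f3).trans (f3 _ _ _)⟩
  · rintro a b c h h' u v w rfl rfl rfl
    exact ⟨u, v, w, h, h', fun f _ _ _ => rfl⟩

/-! ### Congruence of triples under rotations. -/

section Rotation

lemma zero_le_dotProduct_self (u : Fin 3 → ℝ) : 0 ≤ u ⬝ᵥ u := by
  simpa using dotProduct_self_star_nonneg u

lemma mulVec_dotProduct_mulVec {R : Matrix (Fin 3) (Fin 3) ℝ}
    (hR : R ∈ specialOrthogonalGroup (Fin 3) ℝ) (u v : Fin 3 → ℝ) :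
    (R *ᵥ u) ⬝ᵥ (R *ᵥ v) = u ⬝ᵥ v := by
  have h := (mem_orthogonalGroup_iff' _ _).1 (mem_specialOrthogonalGroup_iff.1 hR).1
  rw [dotProduct_mulVec, ← vecMul_transpose, vecMul_vecMul, h, vecMul_one]

lemma of_mul_transpose (u v w : Fin 3 → ℝ) (R : Matrix (Fin 3) (Fin 3) ℝ) :
    of ![u, v, w] * Rᵀ = of ![R *ᵥ u, R *ᵥ v, R *ᵥ w] := by
  ext i j
  fin_cases i <;> simp [Matrix.mul_apply, mulVec, dotProduct, mul_comm]

lemma det_of_rows (u v w : Fin 3 → ℝ) : (of ![u, v, w]).det = triple u v w :=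
  (triple_product_eq_det u v w).symm

lemma triple_mulVec {R : Matrix (Fin 3) (Fin 3) ℝ}
    (hR : R ∈ specialOrthogonalGroup (Fin 3) ℝ) (u v w : Fin 3 → ℝ) :
    triple (R *ᵥ u) (R *ᵥ v) (R *ᵥ w) = triple u v w := by
  rw [← det_of_rows, ← of_mul_transpose, det_mul, det_transpose,
    (mem_specialOrthogonalGroup_iff.1 hR).2, mul_one, det_of_rows]

lemma unfold_mulVec {R : Matrix (Fin 3) (Fin 3) ℝ}
    (hR : R ∈ specialOrthogonalGroup (Fin 3) ℝ) (u v w : Fin 3 → ℝ) :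
    unfold (R *ᵥ u) (R *ᵥ v) (R *ᵥ w) = unfold u v w := by
  simp only [unfold, orthant, sheet, triple_mulVec hR, mulVec_dotProduct_mulVec hR]

lemma of_mul_transpose_of (u v w : Fin 3 → ℝ) : of ![u, v, w] * (of ![u, v, w])ᵀ =
    !![u ⬝ᵥ u, u ⬝ᵥ v, u ⬝ᵥ w; u ⬝ᵥ v, v ⬝ᵥ v, v ⬝ᵥ w; u ⬝ᵥ w, v ⬝ᵥ w, w ⬝ᵥ w] := by
  ext i j
  fin_cases i <;> fin_cases j <;> simp [Matrix.mul_apply, dotProduct, mul_comm]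

/-- With the vectors as rows of invertible matrices `B`, `B'`, the map is `(B⁻¹ B')ᵀ`. Equal Gram
matrices make it orthogonal, and equal volumes give determinant 1. -/
lemma exists_rotation_of_triple_ne_zero {u v w u' v' w' : Fin 3 → ℝ}
    (h1 : u ⬝ᵥ u = u' ⬝ᵥ u') (h2 : v ⬝ᵥ v = v' ⬝ᵥ v') (h3 : w ⬝ᵥ w = w' ⬝ᵥ w')
    (ha : v ⬝ᵥ w = v' ⬝ᵥ w') (hb : u ⬝ᵥ w = u' ⬝ᵥ w') (hc : u ⬝ᵥ v = u' ⬝ᵥ v')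
    (ht : triple u v w = triple u' v' w') (h0 : triple u v w ≠ 0) :
    ∃ R ∈ specialOrthogonalGroup (Fin 3) ℝ, R *ᵥ u = u' ∧ R *ᵥ v = v' ∧ R *ᵥ w = w' := by
  set B := of ![u, v, w] with hB
  set B' := of ![u', v', w'] with hB'
  have hdet : IsUnit B.det := by
    rw [hB, det_of_rows]
    exact isUnit_iff_ne_zero.2 h0
  have hdet' : B.det = B'.det := by rw [hB, hB', det_of_rows, det_of_rows, ht]
  have hgram : B * Bᵀ = B' * B'ᵀ := by
    rw [hB, hB', of_mul_transpose_of, of_mul_transpose_of, h1, h2, h3, ha, hb, hc]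
  have hBt : IsUnit Bᵀ.det := by rwa [det_transpose]
  have hR : B * (B⁻¹ * B') = B' := by rw [← Matrix.mul_assoc, mul_nonsing_inv _ hdet, one_mul]
  have hRt : (B⁻¹ * B')ᵀ * (B⁻¹ * B')ᵀᵀ = 1 := by
    have hdu' : IsUnit B'.det := hdet' ▸ hdet
    have h4 : B' * ((B⁻¹ * B')ᵀ * (B⁻¹ * B')ᵀᵀ) = B' := by
      rw [transpose_transpose, transpose_mul, Matrix.mul_assoc, ← Matrix.mul_assoc, ← hgram,
        transpose_nonsing_inv, Matrix.mul_assoc B, ← Matrix.mul_assoc Bᵀ, mul_nonsing_inv _ hBt,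
        one_mul, hR]
    calc _ = B'⁻¹ * (B' * ((B⁻¹ * B')ᵀ * (B⁻¹ * B')ᵀᵀ)) := by
          rw [← Matrix.mul_assoc, nonsing_inv_mul _ hdu', one_mul]
      _ = 1 := by rw [h4, nonsing_inv_mul _ hdu']
  have hmem : (B⁻¹ * B')ᵀ ∈ specialOrthogonalGroup (Fin 3) ℝ := by
    rw [mem_specialOrthogonalGroup_iff, mem_orthogonalGroup_iff]
    refine ⟨by simpa [star_eq_conjTranspose] using hRt, ?_⟩
    rw [det_transpose, det_mul, ← hdet', ← det_mul, nonsing_inv_mul _ hdet, det_one]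
  have hrows : of ![(B⁻¹ * B')ᵀ *ᵥ u, (B⁻¹ * B')ᵀ *ᵥ v, (B⁻¹ * B')ᵀ *ᵥ w] = of ![u', v', w'] := by
    rw [← of_mul_transpose, transpose_transpose, ← hB, hR]
  refine ⟨_, hmem, congrFun hrows 0, congrFun hrows 1, congrFun hrows 2⟩

lemma exists_rotation_of_cross_ne_zero {u v u' v' : Fin 3 → ℝ}
    (h1 : u ⬝ᵥ u = u' ⬝ᵥ u') (h2 : v ⬝ᵥ v = v' ⬝ᵥ v') (hc : u ⬝ᵥ v = u' ⬝ᵥ v')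
    (h0 : u ⨯₃ v ≠ 0) :
    ∃ R ∈ specialOrthogonalGroup (Fin 3) ℝ, R *ᵥ u = u' ∧ R *ᵥ v = v' := by
  have hpos : 0 < (u ⨯₃ v) ⬝ᵥ (u ⨯₃ v) := by
    simpa using Matrix.dotProduct_star_self_pos_iff.2 h0
  have ht : ∀ u v : Fin 3 → ℝ, triple u v (u ⨯₃ v) = (u ⨯₃ v) ⬝ᵥ (u ⨯₃ v) := by
    intro u v
    simp only [triple, cross_apply, vec3_dotProduct, cons_val_zero, cons_val_one, cons_val]
    ring
  have hcc : (u ⨯₃ v) ⬝ᵥ (u ⨯₃ v) = (u' ⨯₃ v') ⬝ᵥ (u' ⨯₃ v') := by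
    rw [cross_dot_cross, cross_dot_cross, h1, h2, dotProduct_comm v u, dotProduct_comm v' u', hc]
  obtain ⟨R, hR, e1, e2, -⟩ := exists_rotation_of_triple_ne_zero (w := u ⨯₃ v) (w' := u' ⨯₃ v')
    h1 h2 hcc (by simp) (by simp) hc (by rw [ht, ht, hcc]) (by rw [ht]; exact hpos.ne')
  exact ⟨R, hR, e1, e2⟩

lemma exists_orthogonal (u : Fin 3 → ℝ) :
    ∃ p : Fin 3 → ℝ, u ⬝ᵥ p = 0 ∧ p ⬝ᵥ p = 1 := by
  obtain ⟨p, hp, hp0⟩ : ∃ p : Fin 3 → ℝ, u ⬝ᵥ p = 0 ∧ p ≠ 0 := by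
    by_cases h : u 0 = 0 ∧ u 1 = 0
    · exact ⟨![1, 0, 0], by simp [dotProduct, Fin.sum_univ_three, h.1], fun h => by simpa using congrFun h 0⟩
    · refine ⟨![-u 1, u 0, 0], by simp [dotProduct, Fin.sum_univ_three]; ring, fun h' => h ⟨?_, ?_⟩⟩
      · simpa using congrFun h' 1
      · simpa using congrFun h' 0
  have hpos : 0 < p ⬝ᵥ p := by simpa using Matrix.dotProduct_star_self_pos_iff.2 hp0
  refine ⟨(Real.sqrt (p ⬝ᵥ p))⁻¹ • p, by simp [hp], ?_⟩
  have hs := Real.sq_sqrt hpos.le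
  have hs0 : Real.sqrt (p ⬝ᵥ p) ≠ 0 := (Real.sqrt_pos.2 hpos).ne'
  rw [smul_dotProduct, dotProduct_smul, smul_eq_mul, smul_eq_mul]
  field_simp
  exact hs.symm

lemma exists_rotation {u u' : Fin 3 → ℝ} (h : u ⬝ᵥ u = u' ⬝ᵥ u') :
    ∃ R ∈ specialOrthogonalGroup (Fin 3) ℝ, R *ᵥ u = u' := by
  by_cases hu : u = 0
  · subst hu
    refine ⟨1, one_mem _, ?_⟩
    rw [dotProduct_zero] at h
    rw [dotProduct_self_eq_zero.1 h.symm, mulVec_zero]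
  · have hpos : 0 < u ⬝ᵥ u := by simpa using Matrix.dotProduct_star_self_pos_iff.2 hu
    have hu' : u' ≠ 0 := by
      rintro rfl
      rw [h, dotProduct_zero] at hpos
      exact hpos.false
    obtain ⟨p, hp, hp1⟩ := exists_orthogonal u
    obtain ⟨p', hp', hp1'⟩ := exists_orthogonal u'
    obtain ⟨R, hR, e, -⟩ := exists_rotation_of_cross_ne_zero (v := p) (v' := p') h
      (hp1.trans hp1'.symm) (hp.trans hp'.symm) (by
        intro h0
        have := cross_dot_cross u p u p
        rw [h0, hp1, hp, zero_dotProduct] at this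
        linarith)
    exact ⟨R, hR, e⟩

lemma eq_of_dotProduct_eq {u v : Fin 3 → ℝ} (h1 : u ⬝ᵥ u = v ⬝ᵥ v) (h2 : u ⬝ᵥ v = u ⬝ᵥ u) :
    u = v := by
  rw [← sub_eq_zero, ← dotProduct_self_eq_zero]
  rw [sub_dotProduct, dotProduct_sub, dotProduct_sub, dotProduct_comm v u]
  linarith

lemma dotProduct_sq_le (u v : Fin 3 → ℝ) : (u ⬝ᵥ v) ^ 2 ≤ (u ⬝ᵥ u) * (v ⬝ᵥ v) := by
  have := cross_dot_cross u v u v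
  have h2 := zero_le_dotProduct_self (u ⨯₃ v)
  rw [dotProduct_comm v u] at this
  nlinarith

/-- In the chain `|u·v| ≤ u·w ≤ v·w ≤ u·u` the ends agree, so all terms do. -/
lemma eq_of_sorted_of_cross_eq_zero {u v w : Fin 3 → ℝ} (h1 : u ⬝ᵥ u = v ⬝ᵥ v)
    (h2 : v ⬝ᵥ v = w ⬝ᵥ w) (hab : u ⬝ᵥ w ≤ v ⬝ᵥ w) (hbc : |u ⬝ᵥ v| ≤ u ⬝ᵥ w)
    (hcs : (u ⬝ᵥ v) ^ 2 = (u ⬝ᵥ u) ^ 2) : u = w ∧ v = w := by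
  have hr := zero_le_dotProduct_self u
  have h3 := abs_eq_abs.2 (sq_eq_sq_iff_eq_or_eq_neg.1 hcs)
  rw [abs_of_nonneg hr] at h3
  have hvw : v ⬝ᵥ w ≤ u ⬝ᵥ u := by
    refine le_of_sq_le_sq ?_ hr
    rw [h1, pow_two (v ⬝ᵥ v)]
    nth_rw 2 [h2]
    exact dotProduct_sq_le v w
  exact ⟨eq_of_dotProduct_eq (h1.trans h2) (by linarith), eq_of_dotProduct_eq h2 (by linarith)⟩

lemma exists_rotation_of_sorted {u v w u' v' w' : Fin 3 → ℝ} (h1 : u ⬝ᵥ u = v ⬝ᵥ v)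
    (h2 : v ⬝ᵥ v = w ⬝ᵥ w) (h1' : u' ⬝ᵥ u' = v' ⬝ᵥ v') (h2' : v' ⬝ᵥ v' = w' ⬝ᵥ w')
    (h : u ⬝ᵥ u = u' ⬝ᵥ u')
    (ha : v ⬝ᵥ w = v' ⬝ᵥ w') (hb : u ⬝ᵥ w = u' ⬝ᵥ w') (hc : u ⬝ᵥ v = u' ⬝ᵥ v')
    (ht : triple u v w = triple u' v' w') (hab : u ⬝ᵥ w ≤ v ⬝ᵥ w) (hbc : |u ⬝ᵥ v| ≤ u ⬝ᵥ w) :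
    ∃ R ∈ specialOrthogonalGroup (Fin 3) ℝ, R *ᵥ u = u' ∧ R *ᵥ v = v' ∧ R *ᵥ w = w' := by
  have hv : v ⬝ᵥ v = v' ⬝ᵥ v' := by rw [← h1, h, h1']
  have hw : w ⬝ᵥ w = w' ⬝ᵥ w' := by rw [← h2, hv, h2']
  by_cases ht0 : triple u v w = 0
  · by_cases h0 : u ⨯₃ v = 0
    · have hcs : (u ⬝ᵥ v) ^ 2 = (u ⬝ᵥ u) ^ 2 := by
        have := cross_dot_cross u v u v
        rw [h0, zero_dotProduct, dotProduct_comm v u, ← h1] at this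
        linarith
      obtain ⟨rfl, rfl⟩ := eq_of_sorted_of_cross_eq_zero h1 h2 hab hbc hcs
      obtain ⟨e1, e2⟩ := eq_of_sorted_of_cross_eq_zero h1' h2' (by linarith) (by rwa [← hc, ← hb])
        (by rw [← hc, ← h, hcs])
      subst e1 e2
      obtain ⟨R, hR, e⟩ := exists_rotation h
      exact ⟨R, hR, e, e, e⟩
    · obtain ⟨R, hR, e1, e2⟩ := exists_rotation_of_cross_ne_zero h hv hc h0
      refine ⟨R, hR, e1, e2, ?_⟩
      obtain ⟨α, β, hαβ⟩ : ∃ α β : ℝ, w = α • u + β • v := by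
        have hpos : 0 < (u ⨯₃ v) ⬝ᵥ (u ⨯₃ v) := by
          simpa using Matrix.dotProduct_star_self_pos_iff.2 h0
        -- Cramer's rule in the basis `u`, `v`, `u ⨯₃ v`; the last coefficient is the volume, which
        -- is zero here.
        have key : ((u ⨯₃ v) ⬝ᵥ (u ⨯₃ v)) • w = ((w ⨯₃ v) ⬝ᵥ (u ⨯₃ v)) • u +
            ((u ⨯₃ w) ⬝ᵥ (u ⨯₃ v)) • v + triple u v w • (u ⨯₃ v) := by
          ext i
          simp only [triple, cross_apply, vec3_dotProduct, cons_val_zero, cons_val_one, cons_val,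
            Pi.add_apply, Pi.smul_apply, smul_eq_mul]
          fin_cases i <;> simp only [Fin.zero_eta, Fin.mk_one, Fin.reduceFinMk, cons_val_zero,
            cons_val_one, cons_val] <;> ring
        rw [ht0, zero_smul, add_zero] at key
        refine ⟨((u ⨯₃ v) ⬝ᵥ (u ⨯₃ v))⁻¹ * ((w ⨯₃ v) ⬝ᵥ (u ⨯₃ v)),
          ((u ⨯₃ v) ⬝ᵥ (u ⨯₃ v))⁻¹ * ((u ⨯₃ w) ⬝ᵥ (u ⨯₃ v)), ?_⟩
        rw [mul_smul, mul_smul, ← smul_add, ← key, smul_smul, inv_mul_cancel₀ hpos.ne', one_smul]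
      refine eq_of_dotProduct_eq ((mulVec_dotProduct_mulVec hR w w).trans hw) ?_
      rw [mulVec_dotProduct_mulVec hR]
      have e3 : R *ᵥ w = α • u' + β • v' := by
        rw [hαβ, mulVec_add, mulVec_smul, mulVec_smul, e1, e2]
      rw [e3, add_dotProduct, smul_dotProduct, smul_dotProduct, ← ha, ← hb, ← smul_dotProduct,
        ← smul_dotProduct, ← add_dotProduct, ← hαβ]
  · exact exists_rotation_of_triple_ne_zero h hv hw ha hb hc ht ht0

end Rotation

/-- On the chamber the orthant point determines the Gram matrix and the volume up to sign. If the
volumes are opposite and nonzero, the last coordinate of `unfold` forces the point onto a wall. The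
reflection in that wall then keeps the Gram matrix and the product while reversing the volume. -/
lemma exists_rotation_of_unfold_eq_of_sorted {u v w u' v' w' : Fin 3 → ℝ} (h1 : u ⬝ᵥ u = v ⬝ᵥ v)
    (h2 : v ⬝ᵥ v = w ⬝ᵥ w) (h1' : u' ⬝ᵥ u' = v' ⬝ᵥ v') (h2' : v' ⬝ᵥ v' = w' ⬝ᵥ w')
    (hab : u ⬝ᵥ w ≤ v ⬝ᵥ w) (hbc : |u ⬝ᵥ v| ≤ u ⬝ᵥ w)
    (hab' : u' ⬝ᵥ w' ≤ v' ⬝ᵥ w') (hbc' : |u' ⬝ᵥ v'| ≤ u' ⬝ᵥ w')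
    (hy : unfold u v w = unfold u' v' w') : ∃ R ∈ specialOrthogonalGroup (Fin 3) ℝ,
      quad (R *ᵥ u) * quad (R *ᵥ v) * quad (R *ᵥ w) = quad u' * quad v' * quad w' := by
  have ho := orthant_eq_of_unfold_eq hy
  have o0 : v ⬝ᵥ w - u ⬝ᵥ w = v' ⬝ᵥ w' - u' ⬝ᵥ w' := by
    have := congrFun ho 0
    simpa [orthant, wall_of_sorted hab hbc, wall_of_sorted hab' hbc'] using this
  have o1 : u ⬝ᵥ w - u ⬝ᵥ v = u' ⬝ᵥ w' - u' ⬝ᵥ v' := by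
    have := congrFun ho 1
    simpa [orthant, wall_of_sorted hab hbc, wall_of_sorted hab' hbc'] using this
  have o2 : u ⬝ᵥ w + u ⬝ᵥ v = u' ⬝ᵥ w' + u' ⬝ᵥ v' := by
    have := congrFun ho 2
    simpa [orthant, wall_of_sorted hab hbc, wall_of_sorted hab' hbc'] using this
  have o3 : |triple u v w| = |triple u' v' w'| := congrFun ho 3
  have hb : u ⬝ᵥ w = u' ⬝ᵥ w' := by linarith
  have hc : u ⬝ᵥ v = u' ⬝ᵥ v' := by linarith
  have ha : v ⬝ᵥ w = v' ⬝ᵥ w' := by linarith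
  have hr := norm_eq_of_triple_sq_eq h1 h2 h1' h2' ha hb hc (sq_eq_sq_iff_abs_eq_abs _ _ |>.2 o3)
  by_cases ht : triple u v w = triple u' v' w'
  · obtain ⟨R, hR, e1, e2, e3⟩ := exists_rotation_of_sorted h1 h2 h1' h2' hr ha hb hc ht hab hbc
    exact ⟨R, hR, by rw [e1, e2, e3]⟩
  · have ht' : triple u' v' w' = -triple u v w := by
      rcases abs_eq_abs.1 o3 with h | h
      · exact absurd h ht
      · rw [h, neg_neg]
    have ht0 : triple u v w ≠ 0 := fun h => ht (by rw [ht', h, neg_zero])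
    have hlow : lowest (orthant u v w) = 0 := by
      have h3 : (SignType.sign (sheet u v w) : ℝ) * lowest (orthant u v w) =
          SignType.sign (sheet u' v' w') * lowest (orthant u' v' w') := congrFun hy 3
      have hs : sheet u' v' w' = -sheet u v w := by
        rw [sheet, sheet, ht', ha, hb, hc]
        ring
      rw [hs, ← ho, Left.sign_neg] at h3
      push_cast at h3
      have h4 : unfold u v w 3 = 0 := by
        change (SignType.sign (sheet u v w) : ℝ) * lowest (orthant u v w) = 0
        linarith
      rw [← abs_unfold_three, h4, abs_zero]
    have hcase : v ⬝ᵥ w = u ⬝ᵥ w ∨ u ⬝ᵥ w = u ⬝ᵥ v ∨ u ⬝ᵥ w = -(u ⬝ᵥ v) := by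
      have l0 : orthant u v w 0 = v ⬝ᵥ w - u ⬝ᵥ w := by simp [orthant, wall_of_sorted hab hbc]
      have l1 : orthant u v w 1 = u ⬝ᵥ w - u ⬝ᵥ v := by simp [orthant, wall_of_sorted hab hbc]
      have l2 : orthant u v w 2 = u ⬝ᵥ w + u ⬝ᵥ v := by simp [orthant, wall_of_sorted hab hbc]
      have l3 : orthant u v w 3 = |triple u v w| := rfl
      have hpos := abs_pos.2 ht0
      by_contra! hne
      have n0 := lt_of_le_of_ne (orthant_nonneg u v w 0) (by rw [l0]; exact (sub_ne_zero.2 hne.1).symm)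
      have n1 := lt_of_le_of_ne (orthant_nonneg u v w 1) (by rw [l1]; exact (sub_ne_zero.2 hne.2.1).symm)
      have n2 := lt_of_le_of_ne (orthant_nonneg u v w 2)
        (by rw [l2]; exact fun h => hne.2.2 (by linarith))
      have : 0 < lowest (orthant u v w) := lt_min (lt_min n0 n1) (lt_min n2 (l3 ▸ hpos))
      exact this.ne' hlow
    rcases hcase with he | he | he
    · obtain ⟨R, hR, e1, e2, e3⟩ := exists_rotation_of_sorted (u := v) (v := u) (w := w) h1.symm
        (h1.trans h2) h1' h2' (h1.symm.trans hr) (he ▸ ha) (by rw [he, hb])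
        (by rw [dotProduct_comm, hc]) (by rw [triple_swap₁, ht']) he.le
        (by rw [dotProduct_comm, he]; exact hbc)
      exact ⟨R, hR, by rw [← e1, ← e2, ← e3]; ring⟩
    · obtain ⟨R, hR, e1, e2, e3⟩ := exists_rotation_of_sorted (u := u) (v := w) (w := v)
        (h1.trans h2) h2.symm h1' h2' hr (by rw [dotProduct_comm, ha]) (by rw [← he, hb])
        (by rw [he, hc]) (by rw [triple_swap₂, ht']) (by rw [dotProduct_comm w, ← he]; exact hab)
        (by rw [← he, abs_of_nonneg ((abs_nonneg _).trans hbc)])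
      exact ⟨R, hR, by rw [← e1, ← e2, ← e3]; ring⟩
    · obtain ⟨R, hR, e1, e2, e3⟩ := exists_rotation_of_sorted (u := u) (v := -w) (w := -v)
        (by simpa using h1.trans h2) (by simpa using h2.symm) h1' h2' hr
        (by rw [neg_dotProduct_neg, dotProduct_comm, ha]) (by rw [dotProduct_neg, ← he, hb])
        (by rw [dotProduct_neg, he, neg_neg, hc]) (by rw [triple_neg, triple_swap₂, ht'])
        (by rw [neg_dotProduct_neg, dotProduct_neg, ← he, dotProduct_comm w]; exact hab)
        (by rw [dotProduct_neg, dotProduct_neg, ← he, abs_neg,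
          abs_of_nonneg ((abs_nonneg _).trans hbc)])
      refine ⟨R, hR, ?_⟩
      rw [← e1, ← e2, ← e3, mulVec_neg, mulVec_neg, map_neg, map_neg]
      ring

/-- Triples of equal norm with the same image in `ℝ⁴` have products conjugate by a rotation. -/
theorem exists_rotation_of_unfold_eq {u v w u' v' w' : Fin 3 → ℝ} (h1 : u ⬝ᵥ u = v ⬝ᵥ v)
    (h2 : v ⬝ᵥ v = w ⬝ᵥ w) (h1' : u' ⬝ᵥ u' = v' ⬝ᵥ v') (h2' : v' ⬝ᵥ v' = w' ⬝ᵥ w')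
    (hy : unfold u v w = unfold u' v' w') : ∃ R ∈ specialOrthogonalGroup (Fin 3) ℝ,
      quad (R *ᵥ u) * quad (R *ᵥ v) * quad (R *ᵥ w) = quad u' * quad v' * quad w' := by
  -- Everything that must survive the passage to a sorted triple is bundled into one invariant:
  -- equality of norms, the image in `ℝ⁴` and the rotated products.
  let f : (Fin 3 → ℝ) → (Fin 3 → ℝ) → (Fin 3 → ℝ) →
      Prop × (Fin 4 → ℝ) × (Matrix (Fin 3) (Fin 3) ℝ → ℂ[X]) := fun u v w =>
    (u ⬝ᵥ u = v ⬝ᵥ v ∧ v ⬝ᵥ v = w ⬝ᵥ w, unfold u v w, fun R =>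
      quad (R *ᵥ u) * quad (R *ᵥ v) * quad (R *ᵥ w))
  have f1 : ∀ u v w, f v u w = f u v w := by
    intro u v w
    refine Prod.ext (propext ?_) (Prod.ext (unfold_swap₁ u v w) (funext fun R => ?_))
    · exact ⟨fun h => ⟨h.1.symm, h.1.trans h.2⟩, fun h => ⟨h.1.symm, h.1.trans h.2⟩⟩
    · simp only [f]; ring
  have f2 : ∀ u v w, f u w v = f u v w := by
    intro u v w
    refine Prod.ext (propext ?_) (Prod.ext (unfold_swap₂ u v w) (funext fun R => ?_))
    · exact ⟨fun h => ⟨h.1.trans h.2, h.2.symm⟩, fun h => ⟨h.1.trans h.2, h.2.symm⟩⟩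
    · simp only [f]; ring
  have f3 : ∀ u v w, f u (-v) (-w) = f u v w := by
    intro u v w
    refine Prod.ext (propext ?_) (Prod.ext (unfold_neg u v w) (funext fun R => ?_))
    · simp only [f, neg_dotProduct_neg]
    · simp only [f, mulVec_neg, map_neg]; ring
  obtain ⟨a, b, c, hab, hbc, hf⟩ := exists_sorted u v w
  obtain ⟨a', b', c', hab', hbc', hf'⟩ := exists_sorted u' v' w'
  have e := hf f f1 f2 f3
  have e' := hf' f f1 f2 f3
  have n := (congrArg Prod.fst e).mpr ⟨h1, h2⟩
  have n' := (congrArg Prod.fst e').mpr ⟨h1', h2'⟩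
  have y : unfold a b c = unfold u v w := congrArg (fun t => t.2.1) e
  have y' : unfold a' b' c' = unfold u' v' w' := congrArg (fun t => t.2.1) e'
  have q : ∀ R, quad (R *ᵥ a) * quad (R *ᵥ b) * quad (R *ᵥ c) =
    quad (R *ᵥ u) * quad (R *ᵥ v) * quad (R *ᵥ w) := fun R => congrFun (congrArg (fun t => t.2.2) e) R
  have q' : ∀ R, quad (R *ᵥ a') * quad (R *ᵥ b') * quad (R *ᵥ c') =
    quad (R *ᵥ u') * quad (R *ᵥ v') * quad (R *ᵥ w') :=
    fun R => congrFun (congrArg (fun t => t.2.2) e') R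
  obtain ⟨R, hR, h⟩ := exists_rotation_of_unfold_eq_of_sorted n.1 n.2 n'.1 n'.2 hab hbc hab' hbc'
    (y.trans (hy.trans y'.symm))
  have q1 := q' 1
  simp only [one_mulVec] at q1
  exact ⟨R, hR, by rw [← q, h, q1]⟩

/-- Triples of equal norm with the same product have the same image in `ℝ⁴`. -/
theorem unfold_eq_of_quad_mul_eq {u v w u' v' w' : Fin 3 → ℝ} (h1 : u ⬝ᵥ u = v ⬝ᵥ v)
    (h2 : v ⬝ᵥ v = w ⬝ᵥ w) (h1' : u' ⬝ᵥ u' = v' ⬝ᵥ v') (h2' : v' ⬝ᵥ v' = w' ⬝ᵥ w')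
    (h : quad u * quad v * quad w = quad u' * quad v' * quad w') :
    unfold u v w = unfold u' v' w' := by
  have hzero : ∀ {u v w : Fin 3 → ℝ}, u ⬝ᵥ u = v ⬝ᵥ v → v ⬝ᵥ v = w ⬝ᵥ w →
      u = 0 ∨ v = 0 ∨ w = 0 → u = 0 ∧ v = 0 ∧ w = 0 := by
    intro u v w h1 h2 h
    have hu : u ⬝ᵥ u = 0 := by
      rcases h with rfl | rfl | rfl
      · simp
      · rw [h1, dotProduct_zero]
      · rw [h1, h2, dotProduct_zero]
    exact ⟨dotProduct_self_eq_zero.1 hu, dotProduct_self_eq_zero.1 (h1 ▸ hu),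
      dotProduct_self_eq_zero.1 (h2 ▸ h1 ▸ hu)⟩
  have hprod : ∀ u v w : Fin 3 → ℝ, quad u * quad v * quad w = 0 → u = 0 ∨ v = 0 ∨ w = 0 := by
    intro u v w h
    by_contra! hne
    exact mul_ne_zero (mul_ne_zero (quad_ne_zero hne.1) (quad_ne_zero hne.2.1))
      (quad_ne_zero hne.2.2) h
  by_cases h0 : u = 0 ∨ v = 0 ∨ w = 0
  · obtain ⟨rfl, rfl, rfl⟩ := hzero h1 h2 h0
    obtain ⟨rfl, rfl, rfl⟩ := hzero h1' h2' (hprod _ _ _ (by rw [← h]; simp))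
    rfl
  · push Not at h0
    exact (apply_eq_of_quad_mul_eq unfold_swap₁ unfold_swap₂ unfold_neg h0.1 h0.2.1 h0.2.2 h h1 h2
      h1' h2').symm

/-! ### Surjectivity and properness. -/

lemma pow_three_le_of_abs_le {a b c B t : ℝ} (ha : |a| ≤ B) (hb : |b| ≤ B) (hc : |c| ≤ B)
    (ht : 0 ≤ t) : t ^ 3 ≤ (2 * B + t) ^ 3 - (2 * B + t) * (a ^ 2 + b ^ 2 + c ^ 2) +
      2 * a * b * c := by
  have hB : 0 ≤ B := (abs_nonneg a).trans ha
  have h1 : a ^ 2 + b ^ 2 + c ^ 2 ≤ 3 * B ^ 2 := by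
    have := sq_le_sq' (neg_le_of_abs_le ha) (le_of_abs_le ha)
    have := sq_le_sq' (neg_le_of_abs_le hb) (le_of_abs_le hb)
    have := sq_le_sq' (neg_le_of_abs_le hc) (le_of_abs_le hc)
    linarith
  have h2 : |a * b * c| ≤ B ^ 3 := by
    rw [abs_mul, abs_mul, pow_three']
    gcongr
  have h3 := neg_le_of_abs_le h2
  have h4 : (2 * B + t) * (a ^ 2 + b ^ 2 + c ^ 2) ≤ (2 * B + t) * (3 * B ^ 2) := by gcongr
  -- In the worst case the right side is `(2B + t)³ - 3B² (2B + t) - 2B³`, which exceeds `t³` by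
  -- exactly this quantity.
  have h5 : 0 ≤ 9 * B ^ 2 * t + 6 * B * t ^ 2 := by positivity
  nlinarith

lemma exists_triple {a b c : ℝ} (hab : b ≤ a) (hbc : |c| ≤ b) (D : ℝ) :
    ∃ u v w : Fin 3 → ℝ, u ⬝ᵥ u = v ⬝ᵥ v ∧ v ⬝ᵥ v = w ⬝ᵥ w ∧ v ⬝ᵥ w = a ∧ u ⬝ᵥ w = b ∧
      u ⬝ᵥ v = c ∧ triple u v w = D := by
  have hb : 0 ≤ b := (abs_nonneg c).trans hbc
  have ha : 0 ≤ a := hb.trans hab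
  have hca : |c| ≤ a := hbc.trans hab
  -- The squared norm is found by the intermediate value theorem: the Gram determinant is `-a (b -
  -- c)² ≤ 0` at `r = a`, and at least `(1 + D²)³` at `r = 2a + 1 + D²`.
  obtain ⟨r, hr, hD⟩ : ∃ r, a ≤ r ∧
      r ^ 3 - r * (a ^ 2 + b ^ 2 + c ^ 2) + 2 * a * b * c = D ^ 2 := by
    have hle : a ≤ 2 * a + (1 + D ^ 2) := by nlinarith [sq_nonneg D]
    have := intermediate_value_Icc hle
      (f := fun r => r ^ 3 - r * (a ^ 2 + b ^ 2 + c ^ 2) + 2 * a * b * c) (by fun_prop)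
    obtain ⟨r, hr, h⟩ := this (a := D ^ 2) (by
      refine ⟨?_, ?_⟩
      · have : 0 ≤ a * (b - c) ^ 2 := by positivity
        nlinarith [sq_nonneg D]
      · refine le_trans ?_ (pow_three_le_of_abs_le (B := a) (t := 1 + D ^ 2)
          (by rw [abs_of_nonneg ha]) (by rwa [abs_of_nonneg hb]) hca (by positivity))
        nlinarith [sq_nonneg D, sq_nonneg (D ^ 2)])
    exact ⟨r, hr.1, h⟩
  have hr0 : 0 ≤ r := ha.trans hr
  -- If `|c| = r`, the sorted chain collapses to `a = b = r` and three equal vectors do. Otherwise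
  -- `u`, `v` are independent and `w` is solved for: its last coordinate comes from the volume, and
  -- its norm is right by `hD`.
  rcases eq_or_lt_of_le (hca.trans hr) with hcr | hcr
  · have e1 : a = r := by linarith
    have e2 : b = r := by linarith
    have hcD : c = r ∧ D = 0 := by
      rcases eq_or_eq_neg_of_abs_eq hcr with h | h
      · subst e1 e2 h
        exact ⟨rfl, pow_eq_zero_iff two_ne_zero |>.1 (by linarith)⟩
      · rw [e1, e2, h] at hD
        have h3 : 0 ≤ r ^ 3 := by positivity
        have h4 : r ^ 3 = 0 := by nlinarith [sq_nonneg D]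
        have h5 : r = 0 := by simpa using h4
        exact ⟨by rw [h, h5, neg_zero], by simpa [h5] using hD.symm⟩
    refine ⟨![√r, 0, 0], ![√r, 0, 0], ![√r, 0, 0], rfl, rfl, ?_, ?_, ?_, ?_⟩
    · simp [e1, Real.mul_self_sqrt hr0]
    · simp [e2, Real.mul_self_sqrt hr0]
    · simp [hcD.1, Real.mul_self_sqrt hr0]
    · simp [hcD.2, triple]
  · have hrpos : 0 < r := (abs_nonneg c).trans_lt hcr
    have hspos : 0 < r ^ 2 - c ^ 2 := by
      rw [sub_pos, ← sq_abs c]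
      exact pow_lt_pow_left₀ hcr (abs_nonneg c) two_ne_zero
    obtain ⟨q, hq, hq0⟩ : ∃ q : ℝ, q ^ 2 = r ∧ q ≠ 0 :=
      ⟨√r, Real.sq_sqrt hr0, (Real.sqrt_pos.2 hrpos).ne'⟩
    obtain ⟨s, hs, hs0⟩ : ∃ s : ℝ, s ^ 2 = r ^ 2 - c ^ 2 ∧ s ≠ 0 :=
      ⟨√(r ^ 2 - c ^ 2), Real.sq_sqrt hspos.le, (Real.sqrt_pos.2 hspos).ne'⟩
    have hs' : s ^ 2 = q ^ 4 - c ^ 2 := by rw [hs, ← hq]; ring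
    refine ⟨![q, 0, 0], ![c / q, s / q, 0], ![b / q, (a * q ^ 2 - b * c) / (q * s), D / s],
      ?_, ?_, ?_, ?_, ?_, ?_⟩ <;>
    simp only [triple, cross_apply, vec3_dotProduct, cons_val_zero, cons_val_one, cons_val]
    · field_simp
      linear_combination -hs'
    · field_simp
      rw [← hq] at hD
      have h6 : q ^ 2 * s ^ 2 * (c ^ 2 + s ^ 2 - b ^ 2) = q ^ 2 * ((a * q ^ 2 - b * c) ^ 2 + q ^ 2 * D ^ 2) := by
        rw [hs', ← hD]
        ring
      have h7 := mul_left_cancel₀ (pow_ne_zero 2 hq0) ((mul_assoc _ _ _).symm.trans h6)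
      linear_combination h7
    · field_simp
      ring
    · field_simp
      ring
    · field_simp
      ring
    · field_simp
      ring

/-- Triples of vectors of equal norm in `ℝ³`. -/
def equalNorm : Set (Fin 3 → Fin 3 → ℝ) := {x | x 0 ⬝ᵥ x 0 = x 1 ⬝ᵥ x 1 ∧ x 1 ⬝ᵥ x 1 = x 2 ⬝ᵥ x 2}

lemma exists_unfold_eq (p : Fin 4 → ℝ) :
    ∃ x ∈ equalNorm, unfold (x 0) (x 1) (x 2) = p := by
  -- The value of `|D|`: shifting `(p 0, p 1, p 2, 0)` by `t` makes its smallest entry `|p 3|`. The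
  -- sign of `D` follows that of `p 3`.
  obtain ⟨t, ht⟩ : ∃ t, t = |p 3| - min (min (p 0) (p 1)) (min (p 2) 0) := ⟨_, rfl⟩
  have hlow : min (min (p 0 + t) (p 1 + t)) (min (p 2 + t) t) = |p 3| := by
    nth_rw 4 [← zero_add t]
    rw [min_add_add_right, min_add_add_right, min_add_add_right, ht]
    ring
  have hp := abs_nonneg (p 3)
  have l0 : |p 3| ≤ p 0 + t := hlow ▸ (min_le_left _ _).trans (min_le_left _ _)
  have l1 : |p 3| ≤ p 1 + t := hlow ▸ (min_le_left _ _).trans (min_le_right _ _)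
  have l2 : |p 3| ≤ p 2 + t := hlow ▸ (min_le_right _ _).trans (min_le_left _ _)
  have l3 : |p 3| ≤ t := hlow ▸ (min_le_right _ _).trans (min_le_right _ _)
  obtain ⟨D, hD, hDs⟩ : ∃ D : ℝ, |D| = t ∧ (0 < p 3 → 0 < D) ∧ (p 3 < 0 → D < 0) := by
    rcases le_or_gt 0 (p 3) with h | h
    · exact ⟨t, abs_of_nonneg (hp.trans l3), fun h => (abs_pos.2 h.ne').trans_le l3,
        fun h' => absurd h h'.not_ge⟩
    · exact ⟨-t, by rw [abs_neg, abs_of_nonneg (hp.trans l3)], fun h' => absurd h h'.not_gt,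
        fun h' => neg_neg_of_pos ((abs_pos.2 h'.ne).trans_le l3)⟩
  have hbc : |(p 2 - p 1) / 2| ≤ (p 1 + t + (p 2 + t)) / 2 :=
    abs_le.2 ⟨by linarith, by linarith⟩
  have hab : (p 1 + t + (p 2 + t)) / 2 ≤ p 0 + t + (p 1 + t + (p 2 + t)) / 2 := by linarith
  obtain ⟨u, v, w, h1, h2, ha, hb, hc, hd⟩ := exists_triple hab hbc D
  refine ⟨![u, v, w], ⟨h1, h2⟩, ?_⟩
  change unfold u v w = p
  have ho : orthant u v w = ![p 0 + t, p 1 + t, p 2 + t, t] := by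
    rw [orthant, ha, hb, hc, hd, wall_of_sorted hab hbc, hD]
    ext i
    fin_cases i <;> simp <;> ring
  have hl : lowest (orthant u v w) = |p 3| := by rw [ho, ← hlow]; rfl
  have h3 : (SignType.sign (sheet u v w) : ℝ) * lowest (orthant u v w) = p 3 := by
    rw [hl]
    rcases eq_or_ne (p 3) 0 with h0 | h0
    · simp [h0]
    · have hpos := abs_pos.2 h0
      have hw : 0 < wallPoly (v ⬝ᵥ w) (u ⬝ᵥ w) (u ⬝ᵥ v) := by
        rw [ha, hb, hc, wallPoly]
        refine mul_pos (mul_pos ?_ ?_) ?_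
        · nlinarith
        · have : 0 < (p 1 + t) * (p 2 + t) := mul_pos (by linarith) (by linarith)
          nlinarith
        · have : 0 < (p 1 + t) * (p 2 + t) := mul_pos (by linarith) (by linarith)
          have : 0 < (p 0 + t) * (p 0 + t + (p 1 + t) + (p 2 + t)) :=
            mul_pos (by linarith) (by linarith)
          nlinarith
      rw [sheet, sign_mul, sign_pos hw, mul_one, hd]
      rcases lt_or_gt_of_ne h0 with h | h
      · rw [sign_neg (hDs.2 h), abs_of_neg h]; simp
      · rw [sign_pos (hDs.1 h), abs_of_pos h]; simp
  rw [unfold, h3, ho]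
  ext i
  fin_cases i <;> simp

lemma isClosed_equalNorm : IsClosed equalNorm := by
  have h : Continuous fun x : Fin 3 → Fin 3 → ℝ => fun i => x i ⬝ᵥ x i := by
    simp only [vec3_dotProduct]
    fun_prop
  exact (isClosed_eq ((continuous_apply 0).comp h) ((continuous_apply 1).comp h)).inter
    (isClosed_eq ((continuous_apply 1).comp h) ((continuous_apply 2).comp h))

/-- The bounds give `|D| ≤ 2C` and wall coordinates with sum at most `9C`, which also bounds the
inner products. A larger norm would push the Gram determinant past `(1 + 4C²)³ ≥ (2C)²`. -/
lemma dotProduct_self_le_of_unfold {u v w : Fin 3 → ℝ} (h1 : u ⬝ᵥ u = v ⬝ᵥ v)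
    (h2 : v ⬝ᵥ v = w ⬝ᵥ w) {C : ℝ} (hC : ∀ i, |unfold u v w i| ≤ C) :
    u ⬝ᵥ u ≤ 18 * C + (1 + 4 * C ^ 2) := by
  have hC0 : 0 ≤ C := (abs_nonneg _).trans (hC 0)
  have y0 : |orthant u v w 0 - orthant u v w 3| ≤ C := hC 0
  have y1 : |orthant u v w 1 - orthant u v w 3| ≤ C := hC 1
  have y2 : |orthant u v w 2 - orthant u v w 3| ≤ C := hC 2
  have y3 : lowest (orthant u v w) ≤ C := abs_unfold_three u v w ▸ hC 3
  rw [abs_le] at y0 y1 y2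
  have t3 : orthant u v w 3 ≤ 2 * C := by
    have : orthant u v w 3 - C ≤ lowest (orthant u v w) :=
      le_min (le_min (by linarith) (by linarith)) (le_min (by linarith) (by linarith))
    linarith
  have hsum : orthant u v w 0 + orthant u v w 1 + orthant u v w 2 ≤ 9 * C := by linarith
  obtain ⟨ha, hb, hc⟩ := abs_le_wall (v ⬝ᵥ w) (u ⬝ᵥ w) (u ⬝ᵥ v)
  have ht : triple u v w ^ 2 ≤ (2 * C) ^ 2 := sq_le_sq.2 (by
    rw [abs_of_nonneg (by positivity : 0 ≤ 2 * C)]; exact t3)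
  rw [triple_sq, ← h2, ← h1] at ht
  by_contra! hlt
  have hpos : 0 ≤ u ⬝ᵥ u - 18 * C := by nlinarith [sq_nonneg C]
  have := pow_three_le_of_abs_le (ha.trans hsum) (hb.trans hsum) (hc.trans hsum) hpos
  have h3 : (1 + 4 * C ^ 2) ^ 3 < (u ⬝ᵥ u - 18 * C) ^ 3 :=
    pow_lt_pow_left₀ (by linarith) (by positivity) three_ne_zero
  have h4 : (2 * C) ^ 2 ≤ (1 + 4 * C ^ 2) ^ 3 := by nlinarith [sq_nonneg C, sq_nonneg (C ^ 2)]
  rw [show 2 * (9 * C) + (u ⬝ᵥ u - 18 * C) = u ⬝ᵥ u by ring] at this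
  linarith

lemma isCompact_of_dotProduct_self_le {S : Set equalNorm} (hS : IsClosed S) {B : ℝ}
    (h : ∀ x ∈ S, x.1 0 ⬝ᵥ x.1 0 ≤ B) : IsCompact S := by
  rw [Subtype.isCompact_iff]
  refine Metric.isCompact_of_isClosed_isBounded
    (isClosed_equalNorm.isClosedEmbedding_subtypeVal.isClosedMap _ hS) ?_
  refine (Metric.isBounded_closedBall (x := (0 : Fin 3 → Fin 3 → ℝ)) (r := 1 + |B|)).subset ?_
  rintro _ ⟨x, hx, rfl⟩
  rw [mem_closedBall_zero_iff]
  refine (pi_norm_le_iff_of_nonneg (by positivity)).2 fun i =>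
    (pi_norm_le_iff_of_nonneg (by positivity)).2 fun j => ?_
  have h1 : x.1 i ⬝ᵥ x.1 i ≤ B := by
    have := h x hx
    fin_cases i
    · exact this
    · exact x.2.1 ▸ this
    · exact x.2.2 ▸ x.2.1 ▸ this
  have h2 : x.1 i j ^ 2 ≤ x.1 i ⬝ᵥ x.1 i := by
    rw [vec3_dotProduct]
    fin_cases j <;> simp <;> nlinarith [sq_nonneg (x.1 i 0), sq_nonneg (x.1 i 1), sq_nonneg (x.1 i 2)]
  rw [Real.norm_eq_abs]
  refine abs_le_of_sq_le_sq ?_ (by positivity)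
  nlinarith [le_abs_self B, abs_nonneg B]

lemma isProperMap_unfold :
    IsProperMap fun x : equalNorm => unfold (x.1 0) (x.1 1) (x.1 2) := by
  have hc : Continuous fun x : equalNorm => unfold (x.1 0) (x.1 1) (x.1 2) :=
    continuous_unfold.comp continuous_subtype_val
  refine isProperMap_iff_isCompact_preimage.2 ⟨hc, fun K hK => ?_⟩
  obtain ⟨C, hC⟩ := hK.isBounded.exists_norm_le
  refine isCompact_of_dotProduct_self_le (hK.isClosed.preimage hc) fun x hx =>
    dotProduct_self_le_of_unfold (C := C) x.2.1 x.2.2 fun i => ?_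
  rw [← Real.norm_eq_abs]
  exact (norm_le_pi_norm _ i).trans (hC _ hx)

/-- A cubic map without nontrivial zeros on triples of equal norm is proper. -/
lemma isProperMap_of_homogeneous {U : Type*} [NormedAddCommGroup U] [NormedSpace ℝ U]
    [FiniteDimensional ℝ U] {μ : (Fin 3 → Fin 3 → ℝ) → U} (hμ : Continuous μ)
    (hhom : ∀ (t : ℝ) x, μ (t • x) = t ^ 3 • μ x) (h0 : ∀ x ∈ equalNorm, μ x = 0 → x 0 = 0) :
    IsProperMap fun x : equalNorm => μ x := by
  have hc : Continuous fun x : equalNorm => μ x := hμ.comp continuous_subtype_val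
  have : ProperSpace U := FiniteDimensional.proper ℝ U
  have hn : Continuous fun x : equalNorm => x.1 0 ⬝ᵥ x.1 0 := by
    have h : Continuous fun x : Fin 3 → Fin 3 → ℝ => x 0 ⬝ᵥ x 0 := by
      simp only [vec3_dotProduct]
      fun_prop
    exact h.comp continuous_subtype_val
  -- On unit triples, a compact set, `‖μ‖` has a positive minimum. By homogeneity a triple of norm
  -- `s` satisfies `s³ m ≤ ‖μ x‖`, so bounded values force bounded triples.
  obtain ⟨m, hm, hmS⟩ : ∃ m > 0, ∀ x : equalNorm, x.1 0 ⬝ᵥ x.1 0 = 1 → m ≤ ‖μ x‖ := by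
    have hcomp : IsCompact {x : equalNorm | x.1 0 ⬝ᵥ x.1 0 = 1} :=
      isCompact_of_dotProduct_self_le (isClosed_eq hn continuous_const) (B := 1) fun x hx => hx.le
    rcases {x : equalNorm | x.1 0 ⬝ᵥ x.1 0 = 1}.eq_empty_or_nonempty with he | hne
    · exact ⟨1, one_pos, fun x hx => absurd (show x ∈ {x : equalNorm | x.1 0 ⬝ᵥ x.1 0 = 1} from hx)
        (by simp [he])⟩
    · obtain ⟨x, hx, hmin⟩ := hcomp.exists_isMinOn hne hc.norm.continuousOn
      refine ⟨‖μ x‖, norm_pos_iff.2 fun h => ?_, fun y hy => hmin hy⟩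
      have : x.1 0 ⬝ᵥ x.1 0 = 1 := hx
      rw [h0 x x.2 h, dotProduct_zero] at this
      exact zero_ne_one this
  refine isProperMap_iff_isCompact_preimage.2 ⟨hc, fun K hK => ?_⟩
  obtain ⟨C, hC⟩ := hK.isBounded.exists_norm_le
  refine isCompact_of_dotProduct_self_le (hK.isClosed.preimage hc) (B := (1 + |C| / m) ^ 2)
    fun x hx => ?_
  have hr := zero_le_dotProduct_self (x.1 0)
  obtain ⟨s, hs, hsr⟩ : ∃ s : ℝ, 0 ≤ s ∧ x.1 0 ⬝ᵥ x.1 0 = s ^ 2 :=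
    ⟨√(x.1 0 ⬝ᵥ x.1 0), Real.sqrt_nonneg _, (Real.sq_sqrt hr).symm⟩
  rw [hsr]
  refine pow_le_pow_left₀ hs ?_ 2
  rcases eq_or_lt_of_le hs with hs0 | hs0
  · rw [← hs0]; positivity
  have hy : s⁻¹ • x.1 ∈ equalNorm := by
    constructor <;> simp [x.2.1, x.2.2]
  have h1 := hmS ⟨s⁻¹ • x.1, hy⟩ (by
    simp only [Pi.smul_apply, smul_dotProduct, dotProduct_smul, smul_eq_mul, hsr]
    field_simp)
  have h2 : s ^ 3 • μ (s⁻¹ • x.1) = μ x := by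
    rw [← hhom, smul_smul, mul_inv_cancel₀ hs0.ne', one_smul]
  have h3 : s ^ 3 * m ≤ |C| := by
    calc s ^ 3 * m ≤ s ^ 3 * ‖μ (s⁻¹ • x.1)‖ := by gcongr
      _ = ‖μ x‖ := by rw [← h2, norm_smul, Real.norm_eq_abs, abs_of_nonneg (by positivity)]
      _ ≤ |C| := (hC _ hx).trans (le_abs_self C)
  have h4 : s ^ 3 ≤ |C| / m := (le_div_iff₀ hm).2 h3
  by_contra! hlt
  have h5 : 1 ≤ s := by
    have : 0 ≤ |C| / m := by positivity
    linarith
  nlinarith [mul_le_mul h5 h5 zero_le_one hs]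

/-! ### Rotations about an axis, and the cross product as a criterion for rotations. -/

section Rodrigues

lemma mulVec_cross {R : Matrix (Fin 3) (Fin 3) ℝ} (hR : R ∈ specialOrthogonalGroup (Fin 3) ℝ)
    (u v : Fin 3 → ℝ) : R *ᵥ (u ⨯₃ v) = (R *ᵥ u) ⨯₃ (R *ᵥ v) := by
  have hRt := (mem_orthogonalGroup_iff _ _).1 (mem_specialOrthogonalGroup_iff.1 hR).1
  refine dotProduct_eq _ _ fun w => ?_
  have hw : R *ᵥ (Rᵀ *ᵥ w) = w := by rw [mulVec_mulVec, hRt, one_mulVec]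
  have h := triple_mulVec hR (Rᵀ *ᵥ w) u v
  rw [triple, triple, hw] at h
  rw [dotProduct_comm, dotProduct_comm _ w, h]
  nth_rw 1 [← hw]
  exact mulVec_dotProduct_mulVec hR _ _

/-- The rotation by the angle `t` about the unit vector `n`. -/
noncomputable def rodrigues (n : Fin 3 → ℝ) (t : ℝ) (u : Fin 3 → ℝ) : Fin 3 → ℝ :=
  Real.cos t • u + Real.sin t • (n ⨯₃ u) + ((1 - Real.cos t) * (n ⬝ᵥ u)) • n

lemma rodrigues_zero (n u : Fin 3 → ℝ) : rodrigues n 0 u = u := by simp [rodrigues]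

lemma hasDerivAt_rodrigues {n : Fin 3 → ℝ} (hn : n ⬝ᵥ n = 1) (u : Fin 3 → ℝ) (t : ℝ) :
    HasDerivAt (fun t => rodrigues n t u) (n ⨯₃ rodrigues n t u) t := by
  have h1 : HasDerivAt (fun t => rodrigues n t u) (-Real.sin t • u + Real.cos t • (n ⨯₃ u) +
      ((-(-Real.sin t)) * (n ⬝ᵥ u)) • n) t :=
    (((Real.hasDerivAt_cos t).smul_const u).add ((Real.hasDerivAt_sin t).smul_const (n ⨯₃ u))).add
      ((((Real.hasDerivAt_cos t).const_sub 1).mul_const (n ⬝ᵥ u)).smul_const n)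
  have h2 : n ⨯₃ (n ⨯₃ u) = (n ⬝ᵥ u) • n - (n ⬝ᵥ n) • u := by
    ext i
    simp only [cross_apply, vec3_dotProduct, cons_val_zero, cons_val_one, cons_val,
      Pi.sub_apply, Pi.smul_apply, smul_eq_mul]
    fin_cases i <;> simp only [Fin.zero_eta, Fin.mk_one, Fin.reduceFinMk, cons_val_zero,
      cons_val_one, cons_val] <;> ring
  convert h1 using 1
  rw [rodrigues, map_add, map_add, map_smul, map_smul, map_smul, h2, hn, cross_self]
  module

lemma exists_cos_sin {a b : ℝ} (h : a ^ 2 + b ^ 2 = 1) :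
    ∃ t, Real.cos t = a ∧ Real.sin t = b := by
  have hn : ‖(⟨a, b⟩ : ℂ)‖ = 1 := by
    rw [Complex.norm_eq_sqrt_sq_add_sq, h, Real.sqrt_one]
  have h0 : (⟨a, b⟩ : ℂ) ≠ 0 := norm_ne_zero_iff.1 (by rw [hn]; exact one_ne_zero)
  exact ⟨Complex.arg ⟨a, b⟩, by rw [Complex.cos_arg h0, hn, div_one],
    by rw [Complex.sin_arg, hn, div_one]⟩

lemma eq_sum_of_orthonormal {n p : Fin 3 → ℝ} (hn : n ⬝ᵥ n = 1) (hp : p ⬝ᵥ p = 1)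
    (hnp : n ⬝ᵥ p = 0) (u : Fin 3 → ℝ) :
    u = (u ⬝ᵥ n) • n + (u ⬝ᵥ p) • p + (u ⬝ᵥ (n ⨯₃ p)) • (n ⨯₃ p) := by
  have key : ((n ⨯₃ p) ⬝ᵥ (n ⨯₃ p)) • u = (((u ⬝ᵥ n) * (p ⬝ᵥ p) - (u ⬝ᵥ p) * (n ⬝ᵥ p))) • n +
      ((u ⬝ᵥ p) * (n ⬝ᵥ n) - (u ⬝ᵥ n) * (n ⬝ᵥ p)) • p + (u ⬝ᵥ (n ⨯₃ p)) • (n ⨯₃ p) := by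
    ext i
    simp only [cross_apply, vec3_dotProduct, cons_val_zero, cons_val_one, cons_val,
      Pi.add_apply, Pi.smul_apply, smul_eq_mul]
    fin_cases i <;> simp only [Fin.zero_eta, Fin.mk_one, Fin.reduceFinMk, cons_val_zero,
      cons_val_one, cons_val] <;> ring
  rw [cross_dot_cross, dotProduct_comm p n, hn, hp, hnp] at key
  simpa using key

/-- Euler's theorem: every rotation of `ℝ³` is a rotation about an axis. -/
lemma exists_rodrigues_eq {R : Matrix (Fin 3) (Fin 3) ℝ}
    (hR : R ∈ specialOrthogonalGroup (Fin 3) ℝ) :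
    ∃ (n : Fin 3 → ℝ) (t : ℝ), n ⬝ᵥ n = 1 ∧ ∀ u, R *ᵥ u = rodrigues n t u := by
  have hRt := (mem_orthogonalGroup_iff _ _).1 (mem_specialOrthogonalGroup_iff.1 hR).1
  have hdet := (mem_specialOrthogonalGroup_iff.1 hR).2
  obtain ⟨n, hn, hRn⟩ : ∃ n : Fin 3 → ℝ, n ⬝ᵥ n = 1 ∧ R *ᵥ n = n := by
    have h1 : (R - 1).det = 0 := by
      -- As `R Rᵀ = 1`, the matrix `R - 1` equals `R (1 - R)ᵀ`, and in odd dimension the sign comes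
      -- out of the determinant.
      have h2 : (R - 1).det = -(R - 1).det := by
        calc (R - 1).det = (R * (-(R - 1))ᵀ).det := by
              rw [transpose_neg, transpose_sub, transpose_one, Matrix.mul_neg, Matrix.mul_sub, hRt,
                mul_one, neg_sub]
          _ = -(R - 1).det := by
              rw [det_mul, hdet, one_mul, det_transpose, det_neg, Fintype.card_fin]
              ring
      linarith
    obtain ⟨v, hv, hv0⟩ := exists_mulVec_eq_zero_iff.2 h1
    have hpos : 0 < v ⬝ᵥ v := by simpa using Matrix.dotProduct_star_self_pos_iff.2 hv
    have hs := Real.sq_sqrt hpos.le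
    have hs0 : √(v ⬝ᵥ v) ≠ 0 := (Real.sqrt_pos.2 hpos).ne'
    refine ⟨(√(v ⬝ᵥ v))⁻¹ • v, ?_, ?_⟩
    · rw [smul_dotProduct, dotProduct_smul, smul_eq_mul, smul_eq_mul]
      field_simp
      exact hs.symm
    · rw [sub_mulVec, one_mulVec, sub_eq_zero] at hv0
      rw [mulVec_smul, hv0]
  obtain ⟨p, hnp, hp⟩ := exists_orthogonal n
  have hRp : R *ᵥ p = ((R *ᵥ p) ⬝ᵥ p) • p + ((R *ᵥ p) ⬝ᵥ (n ⨯₃ p)) • (n ⨯₃ p) := by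
    have h := eq_sum_of_orthonormal hn hp hnp (R *ᵥ p)
    have h0 : (R *ᵥ p) ⬝ᵥ n = 0 := by
      have := mulVec_dotProduct_mulVec hR p n
      rwa [hRn, dotProduct_comm p, hnp] at this
    rwa [h0, zero_smul, zero_add] at h
  have hq : (n ⨯₃ p) ⬝ᵥ (n ⨯₃ p) = 1 := by
    rw [cross_dot_cross, dotProduct_comm p n, hn, hp, hnp]; simp
  obtain ⟨t, hc, hs⟩ : ∃ t, Real.cos t = (R *ᵥ p) ⬝ᵥ p ∧ Real.sin t = (R *ᵥ p) ⬝ᵥ (n ⨯₃ p) := by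
    refine exists_cos_sin ?_
    have h := mulVec_dotProduct_mulVec hR p p
    rw [hp] at h
    nth_rw 2 [hRp] at h
    rw [dotProduct_add, dotProduct_smul, dotProduct_smul, smul_eq_mul, smul_eq_mul] at h
    linarith
  rw [← hc, ← hs] at hRp
  have h2 : n ⨯₃ (n ⨯₃ p) = -p := by
    have h := eq_sum_of_orthonormal hn hp hnp (n ⨯₃ (n ⨯₃ p))
    have e1 : (n ⨯₃ (n ⨯₃ p)) ⬝ᵥ n = 0 := by rw [dotProduct_comm]; simp
    have e2 : (n ⨯₃ (n ⨯₃ p)) ⬝ᵥ p = -1 := by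
      rw [← hq]
      simp only [cross_apply, vec3_dotProduct, cons_val_zero, cons_val_one, cons_val]
      ring
    have e3 : (n ⨯₃ (n ⨯₃ p)) ⬝ᵥ (n ⨯₃ p) = 0 := by rw [dotProduct_comm]; simp
    rw [e1, e2, e3] at h
    simpa using h
  have hRq : R *ᵥ (n ⨯₃ p) = Real.cos t • (n ⨯₃ p) - Real.sin t • p := by
    rw [mulVec_cross hR, hRn, hRp, map_add, map_smul, map_smul, h2]
    module
  refine ⟨n, t, hn, fun u => ?_⟩
  have hu := eq_sum_of_orthonormal hn hp hnp u
  generalize u ⬝ᵥ n = a at hu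
  generalize u ⬝ᵥ p = b at hu
  generalize u ⬝ᵥ (n ⨯₃ p) = c at hu
  subst hu
  rw [rodrigues]
  simp only [mulVec_add, mulVec_smul, hRn, hRp, hRq, map_add, map_smul, h2, cross_self,
    dotProduct_add, dotProduct_smul, hn, hnp, dot_self_cross, smul_eq_mul]
  module

/-- An injective endomorphism of `ℝ³` compatible with the cross product is a rotation. -/
lemma mem_specialOrthogonalGroup_of_cross {R : Matrix (Fin 3) (Fin 3) ℝ}
    (hR : ∀ u v, R *ᵥ (u ⨯₃ v) = (R *ᵥ u) ⨯₃ (R *ᵥ v)) (h0 : ∀ u, R *ᵥ u = 0 → u = 0) :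
    R ∈ specialOrthogonalGroup (Fin 3) ℝ := by
  have hdet : R.det ≠ 0 := fun h => by
    obtain ⟨v, hv, hv0⟩ := exists_mulVec_eq_zero_iff.2 h
    exact hv (h0 v hv0)
  -- Cross products span `ℝ³`, so this gives `Rᵀ R = det R • 1`. Determinants then give `(det R)² =
  -- (det R)³`, hence `det R = 1`.
  have hd : ∀ u v w, (R *ᵥ u) ⬝ᵥ (R *ᵥ (v ⨯₃ w)) = R.det * (u ⬝ᵥ (v ⨯₃ w)) := by
    intro u v w
    have h1 := det_of_rows (R *ᵥ u) (R *ᵥ v) (R *ᵥ w)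
    rw [← of_mul_transpose, det_mul, det_transpose, det_of_rows, triple, triple, ← hR] at h1
    rw [← h1, mul_comm]
  have hcross : ∀ w : Fin 3 → ℝ, ∃ a b c d e f : Fin 3 → ℝ, w = a ⨯₃ b + c ⨯₃ d + e ⨯₃ f := by
    intro w
    refine ⟨w 0 • ![0, 1, 0], ![0, 0, 1], w 1 • ![0, 0, 1], ![1, 0, 0], w 2 • ![1, 0, 0],
      ![0, 1, 0], ?_⟩
    ext i
    fin_cases i <;> simp [cross_apply]
  have hdot : ∀ u w, (R *ᵥ u) ⬝ᵥ (R *ᵥ w) = R.det * (u ⬝ᵥ w) := by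
    intro u w
    obtain ⟨a, b, c, d, e, f, rfl⟩ := hcross w
    simp only [mulVec_add, dotProduct_add, hd]
    ring
  have hRR : Rᵀ * R = R.det • (1 : Matrix (Fin 3) (Fin 3) ℝ) := by
    refine Matrix.ext_of_mulVec_single fun i => ?_
    refine dotProduct_eq _ _ fun w => ?_
    rw [← mulVec_mulVec, smul_mulVec, one_mulVec, smul_dotProduct, dotProduct_comm, smul_eq_mul,
      dotProduct_mulVec, vecMul_transpose, hdot, dotProduct_comm]
  have hdet1 : R.det = 1 := by
    have h := congrArg det hRR
    rw [det_mul, det_transpose, det_smul, det_one, Fintype.card_fin, mul_one] at h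
    refine mul_left_cancel₀ (mul_ne_zero hdet hdet) ?_
    linear_combination -h
  rw [mem_specialOrthogonalGroup_iff, mem_orthogonalGroup_iff']
  exact ⟨by rw [hRR, hdet1, one_smul], hdet1⟩

end Rodrigues

/-! ### Products of three quadratic forms and the exponential of an infinitesimal rotation. -/

section Cubic

variable {U : Type*} [NormedAddCommGroup U] [NormedSpace ℝ U]

/-- The linear image of a product of three quadratic forms. -/
noncomputable def cubic (Ψ : ℂ[X] →ₗ[ℝ] U) :
    ContinuousMultilinearMap ℝ (fun _ : Fin 3 => Fin 3 → ℝ) U where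
  toMultilinearMap := Ψ.compMultilinearMap
    ((MultilinearMap.mkPiAlgebra ℝ (Fin 3) ℂ[X]).compLinearMap fun _ => quad)
  cont := by
    set M := Ψ.compMultilinearMap
      ((MultilinearMap.mkPiAlgebra ℝ (Fin 3) ℂ[X]).compLinearMap fun _ => quad)
    -- Expanding in the standard basis makes `M` polynomial in the coordinates, so its continuity
    -- requires none of `Ψ`.
    have h : ∀ x : Fin 3 → Fin 3 → ℝ, M x =
        ∑ r : Fin 3 → Fin 3, (∏ i, x i (r i)) • M fun i => Pi.single (r i) 1 := by
      intro x
      have hx : x = fun i => ∑ j, x i j • (Pi.single j 1 : Fin 3 → ℝ) := by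
        ext i j
        simp only [Finset.sum_apply, Pi.smul_apply, Pi.single_apply, smul_eq_mul, mul_ite, mul_one,
          mul_zero, Finset.sum_ite_eq, Finset.mem_univ, if_true]
      conv_lhs => rw [hx, M.map_sum]
      exact Finset.sum_congr rfl fun r _ => M.map_smul_univ _ _
    have hc : Continuous fun x : Fin 3 → Fin 3 → ℝ =>
        ∑ r : Fin 3 → Fin 3, (∏ i, x i (r i)) • M fun i => Pi.single (r i) 1 := by
      fun_prop
    exact hc.congr fun x => (h x).symm

lemma cubic_apply (Ψ : ℂ[X] →ₗ[ℝ] U) (x : Fin 3 → Fin 3 → ℝ) :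
    cubic Ψ x = Ψ (quad (x 0) * quad (x 1) * quad (x 2)) := by
  change Ψ (∏ i, quad (x i)) = _
  rw [Fin.prod_univ_three]

lemma rotForm_quad_mul (ξ u v w : Fin 3 → ℝ) : rotForm 6 ξ (quad u * quad v * quad w) =
    quad (ξ ⨯₃ u) * quad v * quad w + quad u * quad (ξ ⨯₃ v) * quad w +
      quad u * quad v * quad (ξ ⨯₃ w) := by
  rw [rotForm_mul 4 2, rotForm_mul 2 2, rotForm_quad, rotForm_quad, rotForm_quad]
  ring

lemma quad_mul_mem_realForms (u v w : Fin 3 → ℝ) : quad u * quad v * quad w ∈ realForms 6 :=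
  mul_mem_realForms (mul_mem_realForms (quad_mem_realForms u) (quad_mem_realForms v))
    (quad_mem_realForms w)

/-- Infinitesimal rotations integrate to rotations. -/
theorem exp_apply_cubic [CompleteSpace U] {Ψ : ℂ[X] →ₗ[ℝ] U} {n : Fin 3 → ℝ} (hn : n ⬝ᵥ n = 1)
    {A : U →L[ℝ] U} (hA : ∀ p ∈ realForms 6, A (Ψ p) = Ψ (rotForm 6 n p))
    (x : Fin 3 → Fin 3 → ℝ) (t : ℝ) :
    NormedSpace.exp (t • A) (cubic Ψ x) = cubic Ψ fun i => rodrigues n t (x i) := by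
  have h1 : ∀ t, HasDerivAt (fun t : ℝ => NormedSpace.exp (t • A) (cubic Ψ x))
      (A (NormedSpace.exp (t • A) (cubic Ψ x))) t := fun t => by
    simpa using (hasDerivAt_exp_smul_const' A t).clm_apply (hasDerivAt_const t (cubic Ψ x))
  have h2 : ∀ t, HasDerivAt (fun t => cubic Ψ fun i => rodrigues n t (x i))
      (A (cubic Ψ fun i => rodrigues n t (x i))) t := by
    intro t
    have h3 : HasDerivAt (fun t i => rodrigues n t (x i))
      (fun i => n ⨯₃ rodrigues n t (x i)) t :=
      hasDerivAt_pi.2 fun i => hasDerivAt_rodrigues hn (x i) t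
    have h4 : HasDerivAt (fun t => cubic Ψ fun i => rodrigues n t (x i))
        ((cubic Ψ).linearDeriv (fun i => rodrigues n t (x i))
          (fun i => n ⨯₃ rodrigues n t (x i))) t :=
      ((cubic Ψ).hasFDerivAt (fun i => rodrigues n t (x i))).comp_hasDerivAt t h3
    convert h4 using 1
    rw [cubic_apply, hA _ (quad_mul_mem_realForms _ _ _), rotForm_quad_mul,
      ContinuousMultilinearMap.linearDeriv_apply, Fin.sum_univ_three]
    simp [cubic_apply, Function.update]
  -- Both sides solve the linear equation `y' = A y` with the same value at `0`.
  have h := ODE_solution_unique_univ (v := fun _ => A) (s := fun _ => Set.univ) (t₀ := 0)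
    (fun _ => A.lipschitz.lipschitzOnWith) (fun t => ⟨h1 t, trivial⟩) (fun t => ⟨h2 t, trivial⟩)
    (by simp [rodrigues_zero])
  exact congrFun h t

end Cubic

end BinarySextic

namespace LieGroupRep

open BinarySextic Polynomial Module Matrix

/-! ### The orbit space as a quotient of the triples of equal norm. -/

section OrbitSpace

variable {G : Type*} [Group G] {V : Type*} [NormedAddCommGroup V] [NormedSpace ℝ V]

lemma rho_injective (ρ : G →* (V →L[ℝ] V)) (g : G) : Function.Injective (ρ g) := by
  intro v w h
  have h2 : ∀ v, ρ g⁻¹ (ρ g v) = v := fun v => by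
    rw [← mul_apply_eq_comp, ← map_mul, inv_mul_cancel, map_one]
    rfl
  rw [← h2 v, h, h2]

variable [FiniteDimensional ℝ V]

/-- If `G` fixes `V₀` and moves products of three quadratic forms exactly by the rotations, then
the orbit space is `ℝ⁴ × V₀`. -/
theorem nonempty_orbitSpace_homeomorph (ρ : G →* (V →L[ℝ] V)) {V₀ V₁ : Submodule ℝ V}
    (hcompl : IsCompl V₀ V₁) (Φ : V₁ ≃ₗ[ℝ] realForms 6) {Ψ : ℂ[X] →ₗ[ℝ] V₁}
    (hΨ : ∀ p : realForms 6, Ψ p = Φ.symm p) (hfix : ∀ g, ∀ v ∈ V₀, ρ g v = v)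
    (hreal : ∀ R ∈ specialOrthogonalGroup (Fin 3) ℝ, ∃ g, ∀ x : Fin 3 → Fin 3 → ℝ,
      ρ g (cubic Ψ x) = cubic Ψ fun i => R *ᵥ x i)
    (hrot : ∀ g, ∃ R ∈ specialOrthogonalGroup (Fin 3) ℝ, ∀ x : Fin 3 → Fin 3 → ℝ,
      ρ g (cubic Ψ x) = cubic Ψ fun i => R *ᵥ x i) :
    Nonempty (OrbitSpace ρ ≃ₜ (Fin 4 → ℝ) × V₀) := by
  have hΦ : ∀ x : Fin 3 → Fin 3 → ℝ,
      (Φ (cubic Ψ x) : ℂ[X]) = quad (x 0) * quad (x 1) * quad (x 2) := by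
    intro x
    rw [cubic_apply, hΨ ⟨_, quad_mul_mem_realForms (x 0) (x 1) (x 2)⟩, Φ.apply_symm_apply]
  have hcubic : ∀ {x y : Fin 3 → Fin 3 → ℝ}, cubic Ψ x = cubic Ψ y ↔
      quad (x 0) * quad (x 1) * quad (x 2) = quad (y 0) * quad (y 1) * quad (y 2) := by
    intro x y
    rw [← hΦ, ← hΦ, SetLike.coe_eq_coe, Φ.injective.eq_iff]
  have hμ : IsProperMap fun x : equalNorm => cubic Ψ x := by
    refine isProperMap_of_homogeneous (cubic Ψ).cont (fun t x => ?_) fun x hx h => ?_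
    · have h : cubic Ψ (fun i => t • x i) = t ^ 3 • cubic Ψ x := by
        simpa using (cubic Ψ).map_smul_univ (fun _ => t) x
      exact h
    · have h1 := hΦ x
      rw [h, map_zero, ZeroMemClass.coe_zero] at h1
      by_contra h0
      have hpos : x 0 ⬝ᵥ x 0 ≠ 0 := fun h => h0 (dotProduct_self_eq_zero.1 h)
      refine mul_ne_zero (mul_ne_zero (quad_ne_zero h0) (quad_ne_zero ?_)) (quad_ne_zero ?_) h1.symm
      · intro h
        rw [hx.1, h, dotProduct_zero] at hpos
        exact hpos rfl
      · intro h
        rw [hx.1, hx.2, h, dotProduct_zero] at hpos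
        exact hpos rfl
  have hμs : Function.Surjective fun x : equalNorm => cubic Ψ x := by
    intro v
    obtain ⟨x, h1, h2, h⟩ := exists_eq_quad_mul_quad_mul_quad (Φ v).2
    refine ⟨⟨x, h1, h2⟩, Φ.injective (Subtype.ext ?_)⟩
    rw [hΦ, h]
  have hy := isProperMap_unfold
  have hys : Function.Surjective fun x : equalNorm => unfold (x.1 0) (x.1 1) (x.1 2) := by
    intro p
    obtain ⟨x, hx, h⟩ := exists_unfold_eq p
    exact ⟨⟨x, hx⟩, h⟩
  have hproper : ProperSpace V₀ := FiniteDimensional.proper ℝ V₀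
  have hid : IsProperMap (id : V₀ → V₀) := isProperMap_id
  let e : (V₀ × V₁) ≃ₗ[ℝ] V := V₀.prodEquivOfIsCompl V₁ hcompl
  have he : ∀ v, e v = v.1 + v.2 := fun v => by
    simp [e, Submodule.coe_prodEquivOfIsCompl']
  let e' : (V₀ × V₁) ≃ₜ V := e.toContinuousLinearEquiv.toHomeomorph
  -- A proper map is closed, so a proper surjection is a quotient map, and properness passes to the
  -- product with the identity of `V₀`.
  have hq1 : Topology.IsQuotientMap fun z : equalNorm × V₀ =>
      ((z.2 : V) + (cubic Ψ z.1.1 : V)) := by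
    have h1 := (hμ.prodMap hid)
    have h2 : Topology.IsQuotientMap (Prod.map (fun x : equalNorm => cubic Ψ x) (id : V₀ → V₀)) :=
      h1.isClosedMap.isQuotientMap h1.continuous (hμs.prodMap Function.surjective_id)
    have h3 := e'.isQuotientMap.comp ((Homeomorph.prodComm V₁ V₀).isQuotientMap.comp h2)
    convert h3 using 1
    ext z
    exact (he (z.2, cubic Ψ z.1.1)).symm
  have hq2 : Topology.IsQuotientMap fun z : equalNorm × V₀ =>
      (Quotient.mk (orbitSetoid ρ) ((z.2 : V) + (cubic Ψ z.1.1 : V)) : OrbitSpace ρ) :=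
    isQuotientMap_quotient_mk'.comp hq1
  have hq3 : Topology.IsQuotientMap fun z : equalNorm × V₀ =>
      (unfold (z.1.1 0) (z.1.1 1) (z.1.1 2), z.2) := by
    have h1 := (hy.prodMap hid)
    exact h1.isClosedMap.isQuotientMap h1.continuous (hys.prodMap Function.surjective_id)
  have hker : ∀ z z' : equalNorm × V₀,
      (Quotient.mk (orbitSetoid ρ) ((z.2 : V) + (cubic Ψ z.1.1 : V)) : OrbitSpace ρ) =
        Quotient.mk (orbitSetoid ρ) ((z'.2 : V) + (cubic Ψ z'.1.1 : V)) ↔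
      (unfold (z.1.1 0) (z.1.1 1) (z.1.1 2), z.2) =
        (unfold (z'.1.1 0) (z'.1.1 1) (z'.1.1 2), z'.2) := by
    rintro ⟨⟨x, hx⟩, v⟩ ⟨⟨x', hx'⟩, v'⟩
    rw [Quotient.eq, Prod.mk.injEq]
    constructor
    · rintro ⟨g, hg⟩
      obtain ⟨R, hR, h⟩ := hrot g
      rw [map_add, h, hfix g v v.2] at hg
      have h2 : e (v, cubic Ψ fun i => R *ᵥ x i) = e (v', cubic Ψ x') := by
        rw [he, he]
        exact hg
      have h3 := e.injective h2
      rw [Prod.mk.injEq, hcubic] at h3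
      refine ⟨?_, h3.1⟩
      rw [← unfold_mulVec hR]
      refine unfold_eq_of_quad_mul_eq ?_ ?_ hx'.1 hx'.2 h3.2
      · rw [mulVec_dotProduct_mulVec hR, mulVec_dotProduct_mulVec hR, hx.1]
      · rw [mulVec_dotProduct_mulVec hR, mulVec_dotProduct_mulVec hR, hx.2]
    · rintro ⟨h, rfl⟩
      obtain ⟨R, hR, h2⟩ := exists_rotation_of_unfold_eq hx.1 hx.2 hx'.1 hx'.2 h
      obtain ⟨g, hg⟩ := hreal R hR
      refine ⟨g, ?_⟩
      rw [map_add, hg, hfix g v v.2]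
      congr 2
      exact hcubic.2 h2
  let f2 : C(equalNorm × V₀, OrbitSpace ρ) := ⟨_, hq2.continuous⟩
  let f3 : C(equalNorm × V₀, (Fin 4 → ℝ) × V₀) := ⟨_, hq3.continuous⟩
  have hset : Setoid.ker f2 = Setoid.ker f3 := Setoid.ext fun z z' => hker z z'
  have h2 : Topology.IsQuotientMap f2 := hq2
  have h3 : Topology.IsQuotientMap f3 := hq3
  have h3' := h3.homeomorph
  rw [← hset] at h3'
  exact ⟨h2.homeomorph.symm.trans h3'⟩

end OrbitSpace

/-- On the cube of `quad u` the action gives `3 quad (ξ ⨯₃ u) (quad u)²`, so `ξ ⨯₃ u = 0` for every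
`u`. This makes the action faithful. -/
lemma eq_zero_of_rotForm_eq_zero {ξ : Fin 3 → ℝ} (h : ∀ p ∈ realForms 6, rotForm 6 ξ p = 0) :
    ξ = 0 := by
  have h1 : ∀ u : Fin 3 → ℝ, u ≠ 0 → ξ ⨯₃ u = 0 := by
    intro u hu
    have h2 := h _ (quad_mul_mem_realForms u u u)
    rw [rotForm_quad_mul] at h2
    have h3 : 3 * (quad (ξ ⨯₃ u) * (quad u * quad u)) = 0 := by linear_combination h2
    by_contra h0
    exact mul_ne_zero (by norm_num) (mul_ne_zero (quad_ne_zero h0)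
      (mul_ne_zero (quad_ne_zero hu) (quad_ne_zero hu))) h3
  have e0 := h1 ![1, 0, 0] fun h => by simpa using congrFun h 0
  have e1 := h1 ![0, 1, 0] fun h => by simpa using congrFun h 1
  ext i
  fin_cases i
  · simpa [cross_apply] using congrFun e1 2
  · simpa [cross_apply] using congrFun e0 2
  · simpa [cross_apply] using congrFun e0 1

/-! ### Determinants of the group elements. -/

section Det

variable {V : Type*} [NormedAddCommGroup V] [NormedSpace ℝ V]

lemma det_eq_pow_of_isCompl [FiniteDimensional ℝ V] {V₀ V₁ : Submodule ℝ V} (hcompl : IsCompl V₀ V₁) {T : V →ₗ[ℝ] V}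
    {c : ℝ} (h0 : ∀ v ∈ V₀, T v = v) (h1 : ∀ v ∈ V₁, T v = c • v) :
    LinearMap.det T = c ^ finrank ℝ V₁ := by
  let e : (V₀ × V₁) ≃ₗ[ℝ] V := V₀.prodEquivOfIsCompl V₁ hcompl
  have hT : T = e.toLinearMap ∘ₗ
      (LinearMap.prodMap (LinearMap.id : V₀ →ₗ[ℝ] V₀) (c • (LinearMap.id : V₁ →ₗ[ℝ] V₁))) ∘ₗ
        e.symm.toLinearMap := by
    ext v
    obtain ⟨⟨a, b⟩, rfl⟩ := e.surjective v
    simp [e, Submodule.coe_prodEquivOfIsCompl', h0 a a.2, h1 b b.2]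
  rw [hT, LinearMap.det_conj, LinearMap.det_prodMap, LinearMap.det_smul]
  simp

variable {G : Type*} [Group G]

/-- The determinant is a continuous character: connectedness makes it positive, and compactness
bounds the powers of its values, also for inverses. -/
lemma det_eq_one [TopologicalSpace G] [CompactSpace G] [ConnectedSpace G] {ρ : G →* (V →L[ℝ] V)}
    (hρ : Continuous ρ) (g : G) : LinearMap.det (ρ g : V →ₗ[ℝ] V) = 1 := by
  let f : G →* ℝ :=
    { toFun := fun g => LinearMap.det (ρ g : V →ₗ[ℝ] V)
      map_one' := by
        rw [map_one]
        exact LinearMap.det_id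
      map_mul' := fun g h => by
        rw [map_mul]
        exact LinearMap.det_comp _ _ }
  have hf : Continuous f := ContinuousLinearMap.continuous_det.comp hρ
  have hne : ∀ g, f g ≠ 0 := fun g h => by
    have h1 : f g * f g⁻¹ = 1 := by rw [← map_mul, mul_inv_cancel, map_one]
    rw [h, zero_mul] at h1
    exact zero_ne_one h1
  have hpos : ∀ g, 0 < f g := by
    intro g
    by_contra! h
    obtain ⟨x, hx⟩ := mem_range_of_exists_le_of_exists_ge hf ⟨g, h⟩
      ⟨1, (map_one f).symm ▸ zero_le_one⟩
    exact hne x hx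
  have hle : ∀ g, f g ≤ 1 := by
    intro g
    by_contra! h
    obtain ⟨x, -, hx⟩ := isCompact_univ.exists_isMaxOn ⟨1, trivial⟩ hf.continuousOn
    obtain ⟨n, hn⟩ := pow_unbounded_of_one_lt (f x) h
    rw [← map_pow] at hn
    exact absurd (hx (Set.mem_univ (g ^ n))) (not_le.2 hn)
  refine le_antisymm (hle g) ?_
  have h1 : f g * f g⁻¹ = 1 := by rw [← map_mul, mul_inv_cancel, map_one]
  have h2 := hle g⁻¹
  have h3 := hpos g
  change 1 ≤ f g
  nlinarith

end Det

/-! ### The group acts on `V₁` exactly by rotations. -/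

section Algebra

variable {G : Type*} [Group G] {V : Type*} [NormedAddCommGroup V] [NormedSpace ℝ V]
  [FiniteDimensional ℝ V]

/-- The orbit space of a representation whose infinitesimal generators `B` satisfy the
commutation relations of `ℝ³` with the cross product. -/
theorem nonempty_orbitSpace_homeomorph_of_cross (ρ : G →* (V →L[ℝ] V)) {V₀ V₁ : Submodule ℝ V}
    (hcompl : IsCompl V₀ V₁) (hdim : finrank ℝ V₁ = 7) (B : (Fin 3 → ℝ) →ₗ[ℝ] (V →L[ℝ] V))
    (hB : ∀ ξ η, B (ξ ⨯₃ η) = B ξ * B η - B η * B ξ)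
    (hV₀ : ∀ v, v ∈ V₀ ↔ ∀ ξ, B ξ v = 0) (hinv : ∀ ξ, ∀ v ∈ V₁, B ξ v ∈ V₁)
    (hirr : ∀ S ≤ V₁, (∀ ξ, ∀ v ∈ S, B ξ v ∈ S) → S = ⊥ ∨ S = V₁)
    (hexp : ∀ ξ, ∃ g, ρ g = NormedSpace.exp (B ξ))
    (hconj : ∀ g ξ, ∃ η, ρ g * B ξ = B η * ρ g) (hfix : ∀ g, ∀ v ∈ V₀, ρ g v = v)
    (hdet : ∀ g, LinearMap.det (ρ g : V →ₗ[ℝ] V) = 1) :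
    Nonempty (OrbitSpace ρ ≃ₜ (Fin 4 → ℝ) × V₀) := by
  have hV₁ : V₁ ≠ ⊥ := by
    rintro rfl
    simp at hdim
  let j : (Fin 3 → ℝ) →ₗ[ℝ] Module.End ℝ V₁ :=
    { toFun := fun ξ => (B ξ : V →ₗ[ℝ] V).restrict (hinv ξ)
      map_add' := fun ξ η => by
        ext v
        simp [LinearMap.restrict_apply]
      map_smul' := fun c ξ => by
        ext v
        simp [LinearMap.restrict_apply] }
  have hjc : ∀ ξ (v : V₁), (j ξ v : V) = B ξ v := fun ξ v => rfl
  obtain ⟨Φ, hΦ⟩ := exists_equiv_realForms (j := j) hdim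
    (fun ξ η => by
      ext v
      simp only [LinearMap.sub_apply, Module.End.mul_apply, Submodule.coe_sub, hjc, hB]
      rfl)
    (fun S hS => by
      rcases hirr (S.map V₁.subtype) (Submodule.map_subtype_le _ _) (by
        rintro ξ _ ⟨v, hv, rfl⟩
        exact ⟨j ξ v, hS ξ v hv, rfl⟩) with h | h
      · left
        refine Submodule.map_injective_of_injective V₁.subtype_injective ?_
        rw [h, Submodule.map_bot]
      · right
        refine Submodule.map_injective_of_injective V₁.subtype_injective ?_
        rw [h, Submodule.map_subtype_top])
  obtain ⟨Ψ, hΨ⟩ := LinearMap.exists_extend Φ.symm.toLinearMap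
  have hΨ' : ∀ p : realForms 6, Ψ p = Φ.symm p := fun p => LinearMap.congr_fun hΨ p
  have hA : ∀ ξ, ∀ p ∈ realForms 6, B ξ (Ψ p) = Ψ (rotForm 6 ξ p) := by
    intro ξ p hp
    have h1 : j ξ (Ψ p) = Ψ (rotForm 6 ξ p) := by
      have h2 := hΦ ξ (Ψ p)
      rw [hΨ' ⟨p, hp⟩, Φ.apply_symm_apply] at h2
      rw [← h2, hΨ', Φ.symm_apply_apply, hΨ' ⟨p, hp⟩]
    rw [← hjc, h1]
  have hcubic : ∀ x, ((cubic Ψ x : V₁) : V) = cubic (V₁.subtype ∘ₗ Ψ) x := fun x => by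
    rw [cubic_apply, cubic_apply]
    rfl
  have hsurj : ∀ v : V₁, ∃ x, cubic Ψ x = v := by
    intro v
    obtain ⟨x, -, -, h⟩ := exists_eq_quad_mul_quad_mul_quad (Φ v).2
    exact ⟨x, by rw [cubic_apply, ← h, hΨ', Φ.symm_apply_apply]⟩
  have hreal : ∀ R ∈ specialOrthogonalGroup (Fin 3) ℝ, ∃ g, ∀ x : Fin 3 → Fin 3 → ℝ,
      ρ g (cubic Ψ x) = cubic Ψ fun i => R *ᵥ x i := by
    intro R hR
    obtain ⟨n, t, hn, h⟩ := exists_rodrigues_eq hR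
    obtain ⟨g, hg⟩ := hexp (t • n)
    refine ⟨g, fun x => ?_⟩
    have : CompleteSpace V := FiniteDimensional.complete ℝ V
    rw [hg, map_smul, hcubic, hcubic, exp_apply_cubic hn fun p hp => hA n p hp]
    simp only [h]
  have hBinj : ∀ ξ, B ξ = 0 → ξ = 0 := by
    intro ξ h
    refine eq_zero_of_rotForm_eq_zero fun p hp => ?_
    have h1 := hΦ ξ (Φ.symm ⟨p, hp⟩)
    rw [Φ.apply_symm_apply] at h1
    rw [← h1, show j ξ (Φ.symm ⟨p, hp⟩) = 0 from Subtype.ext (by rw [hjc, h]; rfl), map_zero]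
    rfl
  have hmem : ∀ ξ v, B ξ v ∈ V₁ := by
    intro ξ v
    obtain ⟨a, ha, b, hb, rfl⟩ := Submodule.mem_sup.1 (hcompl.sup_eq_top ▸ Submodule.mem_top (x := v))
    rw [map_add, (hV₀ a).1 ha ξ, zero_add]
    exact hinv ξ b hb
  -- By irreducibility the vectors `B ξ v` with `v ∈ V₁` span `V₁`, and `ρ g (B ξ v) = B η (ρ g v)`
  -- lies in the image of `B η`, which is contained in `V₁`.
  have hspan : ∀ g, ∀ v ∈ V₁, ρ g v ∈ V₁ := by
    intro g
    set S : Submodule ℝ V := Submodule.span ℝ {w | ∃ ξ, ∃ v ∈ V₁, B ξ v = w} with hS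
    have hle : S ≤ V₁ := Submodule.span_le.2 (by
      rintro _ ⟨ξ, v, hv, rfl⟩
      exact hinv ξ v hv)
    have hSV : S = V₁ := by
      refine (hirr S hle fun ξ v hv => Submodule.subset_span ⟨ξ, v, hle hv, rfl⟩).resolve_left ?_
      intro hbot
      refine hV₁ (eq_bot_iff.2 fun v hv => ?_)
      have h1 : v ∈ V₀ := (hV₀ v).2 fun ξ => by
        have h2 : B ξ v ∈ S := Submodule.subset_span ⟨ξ, v, hv, rfl⟩
        rw [hbot] at h2
        exact h2
      exact (Submodule.disjoint_def.1 hcompl.disjoint) v h1 hv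
    intro v hv
    rw [← hSV, hS] at hv
    induction hv using Submodule.span_induction with
    | mem w hw =>
      obtain ⟨ξ, v, hv, rfl⟩ := hw
      obtain ⟨η, h⟩ := hconj g ξ
      have h2 : ρ g (B ξ v) = B η (ρ g v) := congrArg (fun T : V →L[ℝ] V => T v) h
      rw [h2]
      exact hmem _ _
    | zero => rw [map_zero]; exact zero_mem _
    | add x y _ _ hx hy => rw [map_add]; exact add_mem hx hy
    | smul c x _ hx => rw [map_smul]; exact Submodule.smul_mem _ _ hx
  refine nonempty_orbitSpace_homeomorph ρ hcompl Φ hΨ' hfix hreal fun g => ?_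
  -- Injectivity of `B` makes the adjoint action `N` of `g` linear and compatible with the cross
  -- product, hence a rotation `R`.
  choose N hN using hconj g
  have hcancel : ∀ S T : V →L[ℝ] V, S * ρ g = T * ρ g → S = T := by
    intro S T h
    have h1 : ρ g * ρ g⁻¹ = 1 := by rw [← map_mul, mul_inv_cancel, map_one]
    rw [← mul_one S, ← mul_one T, ← h1, ← mul_assoc, ← mul_assoc, h]
  have hBi : ∀ ξ η, B ξ * ρ g = B η * ρ g → ξ = η := by
    intro ξ η h
    rw [← sub_eq_zero]
    refine hBinj _ ?_
    rw [map_sub, hcancel _ _ h, sub_self]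
  let L : (Fin 3 → ℝ) →ₗ[ℝ] (Fin 3 → ℝ) :=
    { toFun := N
      map_add' := fun ξ η => hBi _ _ (by
        rw [map_add, add_mul, ← hN, ← hN, ← hN, map_add, mul_add])
      map_smul' := fun c ξ => hBi _ _ (by
        rw [RingHom.id_apply, map_smul, smul_mul_assoc, ← hN, ← hN, map_smul, mul_smul_comm]) }
  have hL : ∀ ξ, LinearMap.toMatrix' L *ᵥ ξ = N ξ := fun ξ => LinearMap.toMatrix'_mulVec L ξ
  set R := LinearMap.toMatrix' L with hRdef
  have hR : R ∈ specialOrthogonalGroup (Fin 3) ℝ := by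
    refine mem_specialOrthogonalGroup_of_cross (fun u v => ?_) fun u hu => ?_
    · rw [hL, hL, hL]
      refine hBi _ _ ?_
      rw [← hN, hB, hB, mul_sub, sub_mul, ← mul_assoc, ← mul_assoc, hN, hN, mul_assoc, mul_assoc,
        hN, hN, mul_assoc, mul_assoc]
    · rw [hL] at hu
      have h1 := hN u
      rw [hu, map_zero, zero_mul] at h1
      refine hBinj u ?_
      ext v
      refine rho_injective ρ g ?_
      have h2 : ρ g (B u v) = 0 := congrArg (fun T : V →L[ℝ] V => T v) h1
      rw [h2]
      simp
  obtain ⟨k, hk⟩ := hreal R hR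
  refine ⟨R, hR, fun x => ?_⟩
  have hkB : ∀ ξ, ∀ v ∈ V₁, ρ k (B ξ v) = B (N ξ) (ρ k v) := by
    intro ξ v hv
    obtain ⟨x, hx⟩ := hsurj ⟨v, hv⟩
    have hx' : v = (cubic Ψ x : V₁) := by rw [hx]
    have hexpand : ∀ (ξ : Fin 3 → ℝ) (x : Fin 3 → Fin 3 → ℝ), B ξ (cubic Ψ x : V₁) =
        ((cubic Ψ ![ξ ⨯₃ x 0, x 1, x 2] : V₁) : V) + (cubic Ψ ![x 0, ξ ⨯₃ x 1, x 2] : V₁) +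
          (cubic Ψ ![x 0, x 1, ξ ⨯₃ x 2] : V₁) := by
      intro ξ x
      rw [cubic_apply, hA ξ _ (quad_mul_mem_realForms _ _ _), rotForm_quad_mul, map_add, map_add]
      simp [cubic_apply]
    rw [hx', hk, hexpand, hexpand, map_add, map_add, hk, hk, hk, ← hL, ← mulVec_cross hR,
      ← mulVec_cross hR, ← mulVec_cross hR]
    have h3 : ∀ u v w : Fin 3 → ℝ, (fun i => R *ᵥ (![u, v, w] : Fin 3 → Fin 3 → ℝ) i) =
        ![R *ᵥ u, R *ᵥ v, R *ᵥ w] := by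
      intro u v w
      ext i : 1
      fin_cases i <;> rfl
    rw [h3, h3, h3]
  have hgk : ∀ v, ρ k (ρ (k⁻¹ * g) v) = ρ g v := fun v => by
    rw [← mul_apply_eq_comp, ← map_mul, mul_inv_cancel_left]
  -- `k` realises `R` on triples and has the same adjoint action on `V₁` as `g`, so `k⁻¹ * g`
  -- commutes with the action there. Schur's lemma makes it a scalar, real because an
  -- odd-dimensional space has a real eigenvector.
  have hcomm : ∀ ξ, ∀ v ∈ V₁, ρ (k⁻¹ * g) (B ξ v) = B ξ (ρ (k⁻¹ * g) v) := by
    intro ξ v hv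
    refine rho_injective ρ k ?_
    rw [hgk, hkB ξ _ (hspan _ v hv), hgk]
    exact congrArg (fun T : V →L[ℝ] V => T v) (hN ξ)
  obtain ⟨c, w, hw, hcw⟩ := exists_eigenvector_of_odd (U := V₁) (by rw [hdim]; decide)
    ((ρ (k⁻¹ * g) : V →ₗ[ℝ] V).restrict (hspan _))
  have hcw' : ρ (k⁻¹ * g) (w : V) = c • (w : V) := congrArg Subtype.val hcw
  have hscalar : ∀ v ∈ V₁, ρ (k⁻¹ * g) v = c • v := by
    let S : Submodule ℝ V := V₁ ⊓ LinearMap.ker ((ρ (k⁻¹ * g) : V →ₗ[ℝ] V) - c • LinearMap.id)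
    have hmemS : ∀ v, v ∈ S ↔ v ∈ V₁ ∧ ρ (k⁻¹ * g) v = c • v := by
      intro v
      simp [S, LinearMap.mem_ker, sub_eq_zero]
    have h := hirr S inf_le_left fun ξ v hv => by
      rw [hmemS] at hv ⊢
      exact ⟨hinv ξ v hv.1, by rw [hcomm ξ v hv.1, hv.2, map_smul]⟩
    rcases h with h | h
    · exfalso
      have h1 : (w : V) ∈ S := (hmemS _).2 ⟨w.2, hcw'⟩
      rw [h, Submodule.mem_bot] at h1
      exact hw (Subtype.ext h1)
    · intro v hv
      rw [← h] at hv
      exact ((hmemS v).1 hv).2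
  -- The determinant of `k⁻¹ * g` is `c ^ 7`, because it fixes `V₀`; it is also 1, and `c` is real.
  have hc : c = 1 := by
    have h1 := det_eq_pow_of_isCompl hcompl (T := (ρ (k⁻¹ * g) : V →ₗ[ℝ] V)) (hfix _) hscalar
    rw [hdet, hdim] at h1
    exact (Odd.strictMono_pow (R := ℝ) (n := 7) (by decide)).injective (by simpa using h1.symm)
  rw [← hgk, hscalar _ (cubic Ψ x).2, hc, one_smul, hk]

end Algebra

end LieGroupRep

/-! ### The Lie algebra `su₂` as `ℝ³` with the cross product, and the conclusion. -/

section SU2Cross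

open Matrix
attribute [local instance] LieRing.ofAssociativeRing

/-- The isomorphism of `ℝ³` with `su₂` given by the Pauli matrices. -/
noncomputable def pauli : (Fin 3 → ℝ) →ₗ[ℝ] su2 where
  toFun x := ⟨!![-(Complex.I * x 2 / 2), (-(Complex.I * x 0) - x 1) / 2;
    (-(Complex.I * x 0) + x 1) / 2, Complex.I * x 2 / 2], by
      constructor
      · ext i j
        fin_cases i <;> fin_cases j <;> apply Complex.ext <;> simp <;> ring
      · simp [Matrix.trace_fin_two]⟩
  map_add' x y := by
    refine Subtype.ext ?_
    ext i j
    fin_cases i <;> fin_cases j <;> simp <;> ring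
  map_smul' c x := by
    refine Subtype.ext ?_
    ext i j
    fin_cases i <;> fin_cases j <;> simp <;> ring

lemma pauli_coe (x : Fin 3 → ℝ) : (pauli x : Matrix (Fin 2) (Fin 2) ℂ) =
    !![-(Complex.I * x 2 / 2), (-(Complex.I * x 0) - x 1) / 2;
    (-(Complex.I * x 0) + x 1) / 2, Complex.I * x 2 / 2] := rfl

lemma pauli_cross (x y : Fin 3 → ℝ) : pauli (x ⨯₃ y) = ⁅pauli x, pauli y⁆ := by
  refine Subtype.ext ?_
  rw [LieSubalgebra.coe_bracket, Ring.lie_def, pauli_coe, pauli_coe, pauli_coe]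
  ext i j
  fin_cases i <;> fin_cases j <;> apply Complex.ext <;>
    simp [cross_apply] <;> ring

lemma pauli_bijective : Function.Bijective pauli := by
  constructor
  · rw [← LinearMap.ker_eq_bot, LinearMap.ker_eq_bot']
    intro x hx
    have h : !![-(Complex.I * x 2 / 2), (-(Complex.I * x 0) - x 1) / 2;
      (-(Complex.I * x 0) + x 1) / 2, Complex.I * x 2 / 2] = 0 := congrArg Subtype.val hx
    have h1 := congrFun (congrFun h 0) 1
    have h2 := congrFun (congrFun h 1) 1
    have e0 := congrArg Complex.im h1
    have e1 := congrArg Complex.re h1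
    have e2 := congrArg Complex.im h2
    simp at e0 e1 e2
    ext i
    fin_cases i
    · exact e0
    · exact e1
    · exact e2
  · rintro ⟨A, hA, hA'⟩
    refine ⟨![2 * (A 1 0).im * (-1), 2 * (A 1 0).re, 2 * (A 1 1).im], Subtype.ext ?_⟩
    rw [pauli_coe]
    rw [Matrix.trace_fin_two] at hA'
    have h00 := congrFun (congrFun hA 0) 0
    have h01 := congrFun (congrFun hA 0) 1
    have h11 := congrFun (congrFun hA 1) 1
    have e1 := congrArg Complex.re h11
    have e2 := congrArg Complex.re h00
    have e3 := congrArg Complex.im hA'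
    have e4 := congrArg Complex.re h01
    have e5 := congrArg Complex.im h01
    simp at e1 e2 e3 e4 e5
    ext i j
    fin_cases i <;> fin_cases j <;> apply Complex.ext <;> simp <;> linarith

end SU2Cross

open LieGroupRep Matrix in
theorem LieGroupRep.exists_linearEquiv_cross {d : ℕ} {G : Type*} [TopologicalSpace G]
    [ChartedSpace (EuclideanSpace ℝ (Fin d)) G] [Group G] [LieGroup (𝓡 d) ∞ G]
    (hG : Nonempty (GroupLieAlgebra (𝓡 d) G ≃ₗ⁅ℝ⁆ su2)) :
    ∃ e : (Fin 3 → ℝ) ≃ₗ[ℝ] GroupLieAlgebra (𝓡 d) G, ∀ x y, e (x ⨯₃ y) = ⁅e x, e y⁆ := by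
  obtain ⟨φ⟩ := hG
  refine ⟨(LinearEquiv.ofBijective pauli pauli_bijective).trans φ.symm.toLinearEquiv,
    fun x y => ?_⟩
  change φ.symm (pauli (x ⨯₃ y)) = ⁅φ.symm (pauli x), φ.symm (pauli y)⁆
  rw [pauli_cross, LieEquiv.map_lie]

theorem mainTheorem8 {d : ℕ} {G : Type*} [TopologicalSpace G]
    [ChartedSpace (EuclideanSpace ℝ (Fin d)) G] [Group G] [LieGroup (𝓡 d) ∞ G]
    [T2Space G] [CompactSpace G] [ConnectedSpace G]
    (hG : Nonempty (GroupLieAlgebra (𝓡 d) G ≃ₗ⁅ℝ⁆ su2))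
    {V : Type*} [NormedAddCommGroup V] [NormedSpace ℝ V] [FiniteDimensional ℝ V]
    (ρ : G →* (V →L[ℝ] V))
    (hρ : ContMDiff (𝓡 d) 𝓘(ℝ, V →L[ℝ] V) ∞ (fun g : G => ρ g))
    (V₁ : Submodule ℝ V)
    (hcompl : IsCompl (LieGroupRep.nullSubspace d ρ) V₁)
    (hirr : LieGroupRep.IsIrreducible d ρ V₁)
    (hdim : Module.finrank ℝ V₁ = 7) :
    Nonempty (LieGroupRep.OrbitSpace ρ ≃ₜ
      EuclideanSpace ℝ (Fin (4 + Module.finrank ℝ (LieGroupRep.nullSubspace d ρ)))) := by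
  have : CompleteSpace V := FiniteDimensional.complete ℝ V
  obtain ⟨e, he⟩ := LieGroupRep.exists_linearEquiv_cross hG
  let B : (Fin 3 → ℝ) →ₗ[ℝ] (V →L[ℝ] V) :=
    { toFun := fun ξ => LieGroupRep.infinitesimal ρ (e ξ)
      map_add' := fun ξ η => by rw [map_add, LieGroupRep.infinitesimal_add]
      map_smul' := fun c ξ => by
        rw [map_smul, LieGroupRep.infinitesimal_smul, RingHom.id_apply] }
  have hBe : ∀ ξ, LieGroupRep.infinitesimal ρ ξ = B (e.symm ξ) := fun ξ => by
    change _ = LieGroupRep.infinitesimal ρ (e (e.symm ξ))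
    rw [e.apply_symm_apply]
  have hnull : ∀ v, v ∈ LieGroupRep.nullSubspace d ρ ↔
      ∀ ξ : GroupLieAlgebra (𝓡 d) G, LieGroupRep.infinitesimal ρ ξ v = 0 := by
    intro v
    rw [LieGroupRep.nullSubspace, Submodule.mem_iInf]
    exact Iff.rfl
  obtain ⟨hinv, -, hirr⟩ := hirr
  obtain ⟨h⟩ := LieGroupRep.nonempty_orbitSpace_homeomorph_of_cross ρ hcompl hdim B
    (fun ξ η => by
      change LieGroupRep.infinitesimal ρ (e _) = _
      rw [he, LieGroupRep.infinitesimal_lie ρ hρ]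
      rfl)
    (fun v => by
      rw [hnull]
      exact ⟨fun h ξ => h (e ξ), fun h ξ => by rw [hBe, h]⟩)
    (fun ξ v hv => hinv (e ξ) v hv)
    (fun S hS h => hirr S hS fun ξ v hv => by
      rw [hBe]
      exact h _ v hv)
    (fun ξ => LieGroupRep.exists_eq_exp_infinitesimal ρ hρ (e ξ))
    (fun g ξ => by
      obtain ⟨η, h⟩ := LieGroupRep.exists_conj_infinitesimal ρ hρ g (e ξ)
      exact ⟨e.symm η, by rw [← hBe]; exact h⟩)
    (fun g v hv => LieGroupRep.apply_eq_self_of_infinitesimal_eq_zero ρ hρ ((hnull v).1 hv) g)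
    (LieGroupRep.det_eq_one hρ.continuous)
  have hfin : Module.finrank ℝ ((Fin 4 → ℝ) × LieGroupRep.nullSubspace d ρ) =
      Module.finrank ℝ (EuclideanSpace ℝ
        (Fin (4 + Module.finrank ℝ (LieGroupRep.nullSubspace d ρ)))) := by
    simp
  exact ⟨h.trans (ContinuousLinearEquiv.ofFinrankEq hfin).toHomeomorph⟩
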